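/- Notation. Let $\alpha_1,\alpha_2,\alpha_3,\beta$ be the $4\times4$ Pauli--Dirac matrices in the standard representation, $m>0$ and $\omega\in(-m,m)$. For $\varphi\in H^1(\mathbb R^3;\mathbb C^4)$ put $$\rho_0=\varphi^*\varphi,\quad J_0^k=\varphi^*\alpha_k\varphi,\quad \Phi_0(x)=\int_{\mathbb R^3}\frac{\rho_0(y)}{|x-y|}\,dy,\quad A_0^k(x)=\int_{\mathbb R^3}\frac{J_0^k(y)}{|x-y|}\,dy\quad(k=1,2,3).$$ A stationary solution of the Maxwell--Dirac system is a pair $\psi_0(t,x)=e^{-i\omega t}\varphi(x)$, $(\Phi_0,\mathbf A_0)$ as above, where $\varphi\in H^1(\mathbb R^3;\mathbb C^4)$ satisfies (a.e., with weak derivatives) $$\bigl(-\omega+\Phi_0-i\,\alpha\cdot\nabla-\alpha\cdot\mathbf A_0+m\beta\bigr)\varphi=0 .$$ Put $$I_k=-i\int\varphi^*\alpha_k\partial_k\varphi\,dx,\quad Q=\int\varphi^*\varphi\,dx,\quad m_0=m\int\varphi^*\beta\varphi\,dx,\quad T=\int(\rho_0\Phi_0-\mathbf J_0\cdot\mathbf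 A_0)\,dx,$$ $$T_j=\frac1{4\pi}\int\bigl(|\partial_j\Phi_0|^2-|\partial_j\mathbf A_0|^2\bigr)dx,$$ and, for fields $(\psi,\Phi,\mathbf A)$ with $\mathbf E=-\dot{\mathbf A}-\nabla\Phi$ and $\mathbf H=\nabla\times\mathbf A$, $$\mathcal E(\psi,\Phi,\mathbf A)(t)=\int\psi^*\bigl[\alpha\cdot(-i\nabla-\mathbf A)+m\beta\bigr]\psi\,dx+\frac1{8\pi}\int(|\mathbf E|^2+|\mathbf H|^2)\,dx .$$ **Lemma.** For every stationary solution of the Maxwell--Dirac system all the integrals above converge ($\Phi_0$, $\mathbf A_0$ having weak derivatives in $L^2$), and with $\hat f(k)=\int e^{-ik\cdot x}f(x)\,dx$ and $j=1,2,3$: 1. $\displaystyle T_j=\frac{4\pi}{(2\pi)^3}\int\frac{k_j^2\bigl(|\hat\rho_0(k)|^2-|\hat{\mathbf J}_0(k)|^2\bigr)}{|k|^4}\,dk$ (a convergent integral); 2. $I_j=\frac12(\omega Q-m_0)-\frac34T+T_j$; 3. $\omega Q-m_0=\frac12T$ and $I_1+I_2+I_3=-\frac12T$; 4. the energy $\mathcal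 E_0=\mathcal E(\psi_0,\Phi_0,\mathbf A_0)$ (at any time $t$) equals $m_0$. -/

import Mathlib

open MeasureTheory

noncomputable section

namespace MaxwellDirac

/-- Physical space `ℝ³`, with the Euclidean norm and Lebesgue measure. -/
abbrev Space : Type := EuclideanSpace ℝ (Fin 3)

/-- Spinor space `ℂ⁴`, with the Hermitian inner product `φ* χ = inner ℂ φ χ`. -/
abbrev Spinor : Type := EuclideanSpace ℂ (Fin 4)

/-! ### Weak derivatives and the Sobolev space `H¹` -/

/-- The `j`-th standard basis vector of `ℝ³`. -/
def basisVec (j : Fin 3) : Space := EuclideanSpace.single j 1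

section Weak

variable {F : Type*} [NormedAddCommGroup F] [NormedSpace ℝ F]

/-- `g` is a weak (distributional) partial derivative `∂_j f`, both being locally integrable
functions on `ℝ³`. -/
structure IsWeakPartial (j : Fin 3) (f g : Space → F) : Prop where
  locallyIntegrable : LocallyIntegrable f volume
  locallyIntegrable_deriv : LocallyIntegrable g volume
  integral_eq : ∀ η : Space → ℝ, ContDiff ℝ ((⊤ : ℕ∞) : WithTop ℕ∞) η → HasCompactSupport η →
    ∫ x, (fderiv ℝ η x (basisVec j)) • f x = - ∫ x, η x • g x

open Classical in
/-- The weak partial derivative `∂_j f`, determined up to a null set when it exists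
(and set to `0` otherwise). -/
def weakPartial (j : Fin 3) (f : Space → F) : Space → F :=
  if h : ∃ g, IsWeakPartial j f g then h.choose else 0

theorem isWeakPartial_weakPartial {j : Fin 3} {f g : Space → F} (h : IsWeakPartial j f g) :
    IsWeakPartial j f (weakPartial j f) := by
  have h' : ∃ g, IsWeakPartial j f g := ⟨g, h⟩
  rw [weakPartial, dif_pos h']
  exact h'.choose_spec

/-- `f ∈ H¹(ℝ³; F)`. -/
def MemH1 (f : Space → F) : Prop :=
  MemLp f 2 volume ∧ ∀ j, ∃ g, IsWeakPartial j f g ∧ MemLp g 2 volume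

end Weak

/-! ### Pauli–Dirac matrices -/

/-- The Dirac matrices `α_1, α_2, α_3` (indexed by `0, 1, 2`) in the standard representation. -/
def alphaMatrix : Fin 3 → Matrix (Fin 4) (Fin 4) ℂ :=
  ![!![0, 0, 0, 1;
       0, 0, 1, 0;
       0, 1, 0, 0;
       1, 0, 0, 0],
    !![0, 0, 0, -Complex.I;
       0, 0, Complex.I, 0;
       0, -Complex.I, 0, 0;
       Complex.I, 0, 0, 0],
    !![0, 0, 1, 0;
       0, 0, 0, -1;
       1, 0, 0, 0;
       0, -1, 0, 0]]

/-- The Dirac matrix `β`. -/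
def betaMatrix : Matrix (Fin 4) (Fin 4) ℂ :=
  !![1, 0, 0, 0;
     0, 1, 0, 0;
     0, 0, -1, 0;
     0, 0, 0, -1]

/-- `α_k` acting on spinors. -/
def alpha (k : Fin 3) : Spinor →L[ℂ] Spinor := Matrix.toEuclideanCLM (𝕜 := ℂ) (alphaMatrix k)

/-- `β` acting on spinors. -/
def beta : Spinor →L[ℂ] Spinor := Matrix.toEuclideanCLM (𝕜 := ℂ) betaMatrix

/-! ### Currents and potentials of a spinor field -/

/-- The charge density `ρ = φ* φ = |φ|²`. -/
def rho (φ : Space → Spinor) (x : Space) : ℝ := ‖φ x‖ ^ 2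

/-- The current `J^k = φ* α_k φ` (a real number, since `α_k` is Hermitian). -/
def current (φ : Space → Spinor) (k : Fin 3) (x : Space) : ℝ :=
  (inner ℂ (φ x) (alpha k (φ x))).re

/-- The Newton potential `f * (1/|x|)`, that is `x ↦ ∫ f(y) / |x - y| dy`. -/
def newtonPotential (f : Space → ℝ) (x : Space) : ℝ := ∫ y, f y / ‖x - y‖

/-- The scalar potential `Φ₀ = ρ * (1/|x|)`. -/
def Phi (φ : Space → Spinor) : Space → ℝ := newtonPotential (rho φ)

/-- The vector potential `A₀^k = J^k * (1/|x|)`. -/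
def vecA (φ : Space → Spinor) (k : Fin 3) : Space → ℝ := newtonPotential (current φ k)

/-- `φ` is the profile of a stationary solution `(ψ₀, A₀) = (e^{-iωt} φ, (Φ₀, A₀))` of the
Maxwell–Dirac system with mass `m` and frequency `ω ∈ (-m, m)`: `φ ∈ H¹(ℝ³; ℂ⁴)` and
`(-ω + Φ₀ - i α·∇ - α·A₀ + m β) φ = 0`, the potentials being those generated by `φ`. -/
structure IsStationary (m ω : ℝ) (φ : Space → Spinor) : Prop where
  mass_pos : 0 < m
  freq_gt : -m < ω
  freq_lt : ω < m
  memH1 : MemH1 φ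
  equation : ∀ᵐ x ∂(volume : Measure Space),
    -((ω : ℂ) • φ x) + (Phi φ x : ℂ) • φ x
      - Complex.I • ∑ k, alpha k (weakPartial k φ x)
      - ∑ k, (vecA φ k x : ℂ) • alpha k (φ x)
      + (m : ℂ) • beta (φ x) = 0

/-! ### The functionals -/

/-- `I_k = -i ∫ φ* α_k ∂_k φ`. -/
def I (φ : Space → Spinor) (k : Fin 3) : ℂ :=
  -Complex.I * ∫ x, inner ℂ (φ x) (alpha k (weakPartial k φ x))

/-- `Q = ∫ φ* φ`. -/
def Q (φ : Space → Spinor) : ℝ := ∫ x, rho φ x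

/-- `m₀ = m ∫ φ* β φ` (the integrand is real, since `β` is Hermitian). -/
def restMass (m : ℝ) (φ : Space → Spinor) : ℝ := m * ∫ x, (inner ℂ (φ x) (beta (φ x))).re

/-- The density `ρ₀ Φ₀ - J₀ · A₀`. -/
def interactionDensity (φ : Space → Spinor) (x : Space) : ℝ :=
  rho φ x * Phi φ x - ∑ k, current φ k x * vecA φ k x

/-- `T = ∫ (ρ₀ Φ₀ - J₀ · A₀)`. -/
def T (φ : Space → Spinor) : ℝ := ∫ x, interactionDensity φ x

/-- The directional functional `T_j = (1/4π) ∫ (|∂_j Φ₀|² - |∂_j A₀|²)`. -/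
def Tdir (φ : Space → Spinor) (j : Fin 3) : ℝ :=
  (4 * Real.pi)⁻¹ *
    ∫ x, ((weakPartial j (Phi φ) x) ^ 2 - ∑ k, (weakPartial j (vecA φ k) x) ^ 2)

/-- The Fourier transform `f̂(k) = ∫ e^{-i k·x} f(x) dx` of a real function. -/
def fourierHat (f : Space → ℝ) (k : Space) : ℂ :=
  ∫ x, Complex.exp (-(Complex.I * (inner ℝ k x : ℝ))) * (f x : ℂ)

/-- The integrand `k_j² (|ρ̂₀(k)|² - |Ĵ₀(k)|²) / |k|⁴` of the Fourier form of `T_j`. -/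
def TdirFourierDensity (φ : Space → Spinor) (j : Fin 3) (k : Space) : ℝ :=
  (k j) ^ 2 * (‖fourierHat (rho φ) k‖ ^ 2 - ∑ l, ‖fourierHat (current φ l) k‖ ^ 2) / ‖k‖ ^ 4

/-! ### The energy of the Maxwell–Dirac system -/

/-- The electric field `E = -∂_t A - ∇Φ`. -/
def electric (Φ : ℝ → Space → ℝ) (A : ℝ → Fin 3 → Space → ℝ) (t : ℝ) (j : Fin 3)
    (x : Space) : ℝ :=
  -(deriv (fun s => A s j x) t) - weakPartial j (Φ t) x

/-- The magnetic field `H = ∇ × A`. -/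
def magnetic (A : ℝ → Fin 3 → Space → ℝ) (t : ℝ) (x : Space) : Fin 3 → ℝ :=
  ![weakPartial 1 (A t 2) x - weakPartial 2 (A t 1) x,
    weakPartial 2 (A t 0) x - weakPartial 0 (A t 2) x,
    weakPartial 0 (A t 1) x - weakPartial 1 (A t 0) x]

/-- The density `ψ* [α·(-i∇ - A) + m β] ψ` of the spinor part of the energy. -/
def spinorEnergyDensity (m : ℝ) (ψ : ℝ → Space → Spinor) (A : ℝ → Fin 3 → Space → ℝ)
    (t : ℝ) (x : Space) : ℂ :=
  inner ℂ (ψ t x)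
    (∑ k, alpha k (-(Complex.I • weakPartial k (ψ t) x) - (A t k x : ℂ) • ψ t x)
      + (m : ℂ) • beta (ψ t x))

/-- The density `E² + H²`. -/
def fieldDensity (Φ : ℝ → Space → ℝ) (A : ℝ → Fin 3 → Space → ℝ) (t : ℝ) (x : Space) : ℝ :=
  ∑ j, (electric Φ A t j x) ^ 2 + ∑ j, (magnetic A t x j) ^ 2

/-- The energy at time `t` of a field configuration `(ψ, Φ, A)`:
`∫ ψ* [α·(-i∇ - A) + m β] ψ + (1/8π) ∫ (E² + H²)`. -/
def energy (m : ℝ) (ψ : ℝ → Space → Spinor) (Φ : ℝ → Space → ℝ) (A : ℝ → Fin 3 → Space → ℝ)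
    (t : ℝ) : ℂ :=
  (∫ x, spinorEnergyDensity m ψ A t x)
    + (((8 * Real.pi)⁻¹ * ∫ x, fieldDensity Φ A t x : ℝ) : ℂ)

/-- The standing wave `ψ₀(t, x) = e^{-iωt} φ(x)`. -/
def standingWave (ω : ℝ) (φ : Space → Spinor) (t : ℝ) (x : Space) : Spinor :=
  Complex.exp (-(Complex.I * ω * t)) • φ x

/-- All integrals and weak derivatives entering `Φ₀`, `A₀`, `I_k`, `Q`, `m₀`, `T`, `T_j` and
the Fourier form of `T_j` exist in the proper sense. -/
structure WellDefined (φ : Space → Spinor) : Prop where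
  potential : ∀ x, Integrable (fun y => rho φ y / ‖x - y‖)
  vecPotential : ∀ k x, Integrable (fun y => current φ k y / ‖x - y‖)
  kinetic : ∀ k, Integrable (fun x => inner ℂ (φ x) (alpha k (weakPartial k φ x)))
  charge : Integrable (rho φ)
  mass : Integrable (fun x => (inner ℂ (φ x) (beta (φ x))).re)
  interaction : Integrable (interactionDensity φ)
  gradPotential : ∀ j, IsWeakPartial j (Phi φ) (weakPartial j (Phi φ)) ∧
    MemLp (weakPartial j (Phi φ)) 2 volume
  gradVecPotential : ∀ j k, IsWeakPartial j (vecA φ k) (weakPartial j (vecA φ k)) ∧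
    MemLp (weakPartial j (vecA φ k)) 2 volume
  fourier : ∀ j, Integrable (TdirFourierDensity φ j)

end MaxwellDirac

end

/-!
# Virial identities and the energy of stationary Maxwell–Dirac solutions

Write `E(f) = ∬ f(x) f(y) / |x-y|` (`coulomb`) and `K_j(f) = ∬ f(x) f(y) (x_j-y_j)² / |x-y|³`
(`dirCoulomb`), so that `∑_j K_j = E`. Let `E` and `K_j` without argument denote the value at `ρ₀`
minus the sum of the values at the components of `J₀`; then `E = T`. The theorem follows from three
linear relations.

* Pairing the equation with `φ` and integrating gives `∑ I_k = ωQ - m₀ - T`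
  (`IsStationary.sum_kineticIm`).
* Pairing it with `2 x_j ∂_j φ` and taking real parts gives `I_j = -½ K_j`
  (`IsStationary.directional_virial`).
* By Fourier transform `‖∂_j (f * 1/|x|)‖₂² = 2π (E(f) - K_j(f))`, hence `T_j = ½ (T - K_j)`
  (`MemH1.Tdir_eq`); the same computation yields the Fourier form of `T_j`.

So `I_j = T_j - ½ T`, and summing over `j` gives `∑ I_j = -½ T` and `ωQ - m₀ = ½ T`
(`IsStationary.kineticIm_relations`). The field energy is that of `Φ₀` and of the gradients of `A₀`,
up to terms containing `div A₀`, which vanish because the equation implies `div J₀ = 0`; the total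
energy is then `∑ I_k + m₀ + ½ T = m₀` (`IsStationary.energy_eq`).

What has to be justified is the convergence, since `φ` is only in `H¹` and `x_j` is unbounded.

* A nonnegative `W^{1,1}` function has a bounded Newton potential
  (`boundedPotential_of_weakPartial`). Applied to `ρ₀`, and using `|J₀| ≤ C ρ₀`, this makes all
  Coulomb integrals absolutely convergent.
* The Fourier identity is a subordination argument: `1/|ξ|⁴`, `1/|x-y|` and `1/|x-y|³` are
  superpositions of Gaussians, for which the identity is an explicit integral
  (`BoundedPotential.directional_energy`). Plancherel's theorem then provides the weak gradient of a
  Newton potential as an `L²` function (`BoundedPotential.weakPartial_newton`).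
* In the second relation `x_j` is replaced by the bounded weight `R sin (x_j/R)`, `R → ∞`. The kinetic
  term is the null Lagrangian `2 Im (∂_j φ* α_k ∂_k φ)`, whose integral against a weight `a` involves
  only `∇a` (`integral_null_lagrangian_bilin`), so no second derivatives of `φ` occur. The potential
  terms are symmetrised in `x` and `y`, and `(a(x)-a(y)) (x_j-y_j) / |x-y|³` is dominated by
  `1/|x-y|` for Lipschitz `a` (`BoundedPotential.virial`).
-/

noncomputable section

namespace MaxwellDirac

open Filter Topology
open scoped FourierTransform

/-! ### Weak derivatives -/

/-- The classical partial derivative `∂_j η`. -/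
def pderiv (j : Fin 3) (η : Space → ℝ) (x : Space) : ℝ := fderiv ℝ η x (basisVec j)

/-- Smooth compactly supported real functions. -/
structure IsTest (η : Space → ℝ) : Prop where
  contDiff : ContDiff ℝ ((⊤ : ℕ∞) : WithTop ℕ∞) η
  compact : HasCompactSupport η

theorem norm_basisVec (j : Fin 3) : ‖basisVec j‖ = 1 := by
  simp [basisVec]

theorem inner_basisVec (j : Fin 3) (x : Space) : inner ℝ x (basisVec j) = x j := by
  simp [basisVec, EuclideanSpace.inner_single_right]

theorem contDiff_pderiv {η : Space → ℝ} (h : ContDiff ℝ ((⊤ : ℕ∞) : WithTop ℕ∞) η) (j : Fin 3) :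
    ContDiff ℝ ((⊤ : ℕ∞) : WithTop ℕ∞) (pderiv j η) := by
  unfold pderiv
  exact (h.fderiv_right (m := ((⊤ : ℕ∞) : WithTop ℕ∞)) (by simp)).clm_apply contDiff_const

theorem IsTest.pderiv {η : Space → ℝ} (h : IsTest η) (j : Fin 3) : IsTest (pderiv j η) :=
  ⟨contDiff_pderiv h.contDiff j, h.compact.fderiv_apply (𝕜 := ℝ) (basisVec j)⟩

theorem IsTest.continuous {η : Space → ℝ} (h : IsTest η) : Continuous η := h.contDiff.continuous

theorem IsTest.integrable {η : Space → ℝ} (h : IsTest η) : Integrable η :=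
  h.continuous.integrable_of_hasCompactSupport h.compact

theorem IsTest.bounded {η : Space → ℝ} (h : IsTest η) : ∃ C, ∀ x, ‖η x‖ ≤ C :=
  h.compact.exists_bound_of_continuous h.continuous

theorem IsTest.mul_left {η a : Space → ℝ} (h : IsTest η)
    (ha : ContDiff ℝ ((⊤ : ℕ∞) : WithTop ℕ∞) a) : IsTest (fun x => a x * η x) :=
  ⟨ha.mul h.contDiff, h.compact.mul_left⟩

theorem pderiv_mul {a b : Space → ℝ} {x : Space} (ha : DifferentiableAt ℝ a x)
    (hb : DifferentiableAt ℝ b x) (j : Fin 3) :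
    pderiv j (fun y => a y * b y) x = a x * pderiv j b x + pderiv j a x * b x := by
  unfold pderiv
  rw [fderiv_fun_mul ha hb]
  simp [mul_comm]

theorem IsTest.differentiable {η : Space → ℝ} (h : IsTest η) : Differentiable ℝ η :=
  h.contDiff.differentiable (by simp)

/-- The cutoffs `χ(x / (n + 1))`: test functions, uniformly bounded together with their gradients,
converging to `1` while their gradients converge to `0`. -/
theorem exists_cutoff : ∃ (χ : ℕ → Space → ℝ) (C : ℝ), (∀ n, IsTest (χ n)) ∧
    (∀ n x, |χ n x| ≤ 1) ∧ (∀ n x j, |pderiv j (χ n) x| ≤ C) ∧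
    (∀ x, Tendsto (fun n => χ n x) atTop (𝓝 1)) ∧
    (∀ x j, Tendsto (fun n => pderiv j (χ n) x) atTop (𝓝 0)) := by
  let b : ContDiffBump (0 : Space) := ⟨1, 2, by norm_num, by norm_num⟩
  have hb : ContDiff ℝ ((⊤ : ℕ∞) : WithTop ℕ∞) (b : Space → ℝ) := b.contDiff
  have hbc : HasCompactSupport (b : Space → ℝ) := b.hasCompactSupport
  obtain ⟨C, hC⟩ := (hbc.fderiv (𝕜 := ℝ)).exists_bound_of_continuous
    (hb.continuous_fderiv (by simp))
  have hd : ∀ (n : ℕ) x j, pderiv j (fun y => b ((n + 1 : ℝ)⁻¹ • y)) x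
      = (n + 1 : ℝ)⁻¹ * fderiv ℝ b ((n + 1 : ℝ)⁻¹ • x) (basisVec j) := by
    intro n x j
    have h1 : HasFDerivAt (fun y : Space => b ((n + 1 : ℝ)⁻¹ • y)) _ x :=
      ((hb.differentiable (by simp)) ((n + 1 : ℝ)⁻¹ • x)).hasFDerivAt.comp x
        ((hasFDerivAt_id x).const_smul ((n + 1 : ℝ)⁻¹))
    rw [pderiv, h1.fderiv]
    simp
  have hle : ∀ (n : ℕ), (n + 1 : ℝ)⁻¹ ≤ 1 := fun n =>
    inv_le_one_of_one_le₀ (by linarith [n.cast_nonneg (α := ℝ)])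
  have hbd : ∀ (n : ℕ) x j, |pderiv j (fun y => b ((n + 1 : ℝ)⁻¹ • y)) x| ≤ (n + 1 : ℝ)⁻¹ * C := by
    intro n x j
    rw [hd, abs_mul, abs_of_pos (by positivity)]
    gcongr
    refine ((fderiv ℝ b _).le_opNorm _).trans ?_
    rw [norm_basisVec, mul_one]
    exact hC _
  have hC0 : 0 ≤ C := (norm_nonneg _).trans (hC 0)
  have hlim : Tendsto (fun n : ℕ => (n + 1 : ℝ)⁻¹) atTop (𝓝 0) :=
    tendsto_inv_atTop_zero.comp (tendsto_atTop_add_const_right _ _ tendsto_natCast_atTop_atTop)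
  refine ⟨fun n y => b ((n + 1 : ℝ)⁻¹ • y), C, fun n => ⟨?_, ?_⟩, ?_, ?_, ?_, ?_⟩
  · exact hb.comp (contDiff_id.const_smul ((n + 1 : ℝ)⁻¹))
  · exact hbc.comp_smul (by positivity)
  · intro n x
    rw [abs_of_nonneg b.nonneg]
    exact b.le_one
  · intro n x j
    exact (hbd n x j).trans (by nlinarith [hle n])
  · intro x
    have h1 : Tendsto (fun n : ℕ => b ((n + 1 : ℝ)⁻¹ • x)) atTop (𝓝 (b ((0 : ℝ) • x))) :=
      (hb.continuous.tendsto _).comp (hlim.smul_const x)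
    have h2 : b ((0 : ℝ) • x) = 1 := by
      rw [zero_smul]
      exact b.one_of_mem_closedBall (by simp [b])
    rwa [h2] at h1
  · intro x j
    refine squeeze_zero_norm (fun n => hbd n x j) ?_
    simpa using hlim.mul_const C

/-- An identity `∫ (η G₀ + Σ_k ∂_k η G_k) = 0` with integrable data, valid for all test functions,
holds for all smooth `a` that are bounded together with their first derivatives. -/
theorem integral_multiplier_eq_zero {G₀ : Space → ℝ} {G : Fin 3 → Space → ℝ}
    (hG₀ : Integrable G₀) (hG : ∀ k, Integrable (G k))
    (h : ∀ η, IsTest η → ∫ x, (η x * G₀ x + ∑ k, pderiv k η x * G k x) = 0)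
    {a : Space → ℝ} {C : ℝ} (ha : ContDiff ℝ ((⊤ : ℕ∞) : WithTop ℕ∞) a) (haC : ∀ x, |a x| ≤ C)
    (hda : ∀ k x, |pderiv k a x| ≤ C) :
    ∫ x, (a x * G₀ x + ∑ k, pderiv k a x * G k x) = 0 := by
  obtain ⟨χ, D, hχ, hχ1, hχD, hlim, hlim'⟩ := exists_cutoff
  have hC : 0 ≤ C := (abs_nonneg _).trans (haC 0)
  have hD : 0 ≤ D := (abs_nonneg _).trans (hχD 0 0 0)
  have hpd : ∀ n x k, pderiv k (fun x => a x * χ n x) x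
      = a x * pderiv k (χ n) x + pderiv k a x * χ n x := fun n x k =>
    pderiv_mul (ha.differentiable (by simp) x) ((hχ n).differentiable x) k
  have hbd : ∀ n x k, |pderiv k (fun x => a x * χ n x) x| ≤ C * D + C := by
    intro n x k
    rw [hpd]
    refine (abs_add_le _ _).trans ?_
    rw [abs_mul, abs_mul]
    have := mul_le_mul (haC x) (hχD n x k) (abs_nonneg _) hC
    have := mul_le_mul (hda k x) (hχ1 n x) (abs_nonneg _) hC
    linarith
  have key : Tendsto (fun n => ∫ x, ((a x * χ n x) * G₀ x
      + ∑ k, pderiv k (fun x => a x * χ n x) x * G k x)) atTop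
      (𝓝 (∫ x, (a x * G₀ x + ∑ k, pderiv k a x * G k x))) := by
    refine tendsto_integral_of_dominated_convergence
      (fun x => C * |G₀ x| + ∑ k, (C * D + C) * |G k x|) ?_ ?_ ?_ ?_
    · intro n
      refine AEStronglyMeasurable.add ?_ ?_
      · exact ((ha.continuous.mul (hχ n).continuous).aestronglyMeasurable).mul hG₀.1
      · refine Finset.aestronglyMeasurable_fun_sum _ fun k _ => ?_
        exact ((((hχ n).mul_left ha).pderiv k).continuous.aestronglyMeasurable).mul (hG k).1
    · exact (hG₀.abs.const_mul _).add (integrable_finsetSum _ fun k _ => (hG k).abs.const_mul _)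
    · intro n
      refine Eventually.of_forall fun x => ?_
      rw [Real.norm_eq_abs]
      refine (abs_add_le _ _).trans (add_le_add ?_ ?_)
      · rw [abs_mul, abs_mul]
        have := mul_le_mul (haC x) (hχ1 n x) (abs_nonneg _) hC
        exact mul_le_mul_of_nonneg_right (by linarith) (abs_nonneg _)
      · refine (Finset.abs_sum_le_sum_abs _ _).trans (Finset.sum_le_sum fun k _ => ?_)
        rw [abs_mul]
        exact mul_le_mul_of_nonneg_right (hbd n x k) (abs_nonneg _)
    · refine Eventually.of_forall fun x => ?_
      refine Tendsto.add ?_ (tendsto_finsetSum _ fun k _ => ?_)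
      · simpa using ((hlim x).const_mul (a x)).mul_const (G₀ x)
      · simp only [hpd]
        simpa using (((hlim' x k).const_mul (a x)).add
          ((hlim x).const_mul (pderiv k a x))).mul_const (G k x)
  refine tendsto_nhds_unique key ?_
  have : ∀ n, ∫ x, ((a x * χ n x) * G₀ x
      + ∑ k, pderiv k (fun x => a x * χ n x) x * G k x) = 0 := fun n => h _ ((hχ n).mul_left ha)
  simp only [this]
  exact tendsto_const_nhds

section General
variable {F : Type*} [NormedAddCommGroup F] [NormedSpace ℝ F]

theorem IsTest.integrable_smul {η : Space → ℝ} (h : IsTest η) {f : Space → F}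
    (hf : LocallyIntegrable f volume) : Integrable (fun x => η x • f x) :=
  hf.integrable_smul_left_of_hasCompactSupport h.continuous h.compact

theorem IsWeakPartial.congr_ae {j : Fin 3} {f f' g g' : Space → F} (h : IsWeakPartial j f g)
    (hf : f =ᵐ[volume] f') (hg : g =ᵐ[volume] g') : IsWeakPartial j f' g' := by
  refine ⟨h.locallyIntegrable.congr hf, h.locallyIntegrable_deriv.congr hg, fun η h1 h2 => ?_⟩
  have e1 : (fun x => fderiv ℝ η x (basisVec j) • f x) =ᵐ[volume]
      fun x => fderiv ℝ η x (basisVec j) • f' x := hf.mono fun x hx => by simp only [hx]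
  have e2 : (fun x => η x • g x) =ᵐ[volume] fun x => η x • g' x :=
    hg.mono fun x hx => by simp only [hx]
  rw [← integral_congr_ae e1, h.integral_eq η h1 h2, integral_congr_ae e2]

theorem IsWeakPartial.unique [CompleteSpace F] {j : Fin 3} {f g g' : Space → F}
    (h : IsWeakPartial j f g) (h' : IsWeakPartial j f g') : g =ᵐ[volume] g' := by
  refine ae_eq_of_integral_contDiff_smul_eq h.locallyIntegrable_deriv h'.locallyIntegrable_deriv
    fun η h1 h2 => ?_
  have := (h.integral_eq η h1 h2).symm.trans (h'.integral_eq η h1 h2)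
  simpa using this

theorem IsWeakPartial.weakPartial_ae [CompleteSpace F] {j : Fin 3} {f g : Space → F}
    (h : IsWeakPartial j f g) : weakPartial j f =ᵐ[volume] g :=
  (isWeakPartial_weakPartial h).unique h

theorem _root_.MeasureTheory.LocallyIntegrable.clm {G : Type*} [NormedAddCommGroup G]
    [NormedSpace ℝ G] {f : Space → F} (hf : LocallyIntegrable f volume) (L : F →L[ℝ] G) :
    LocallyIntegrable (fun x => L (f x)) volume := fun x => by
  obtain ⟨s, hs, h⟩ := hf x
  exact ⟨s, hs, L.integrable_comp h⟩

theorem IsWeakPartial.clm [CompleteSpace F] {G : Type*} [NormedAddCommGroup G] [NormedSpace ℝ G]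
    [CompleteSpace G] {j : Fin 3} {f g : Space → F} (h : IsWeakPartial j f g) (L : F →L[ℝ] G) :
    IsWeakPartial j (fun x => L (f x)) (fun x => L (g x)) := by
  refine ⟨h.locallyIntegrable.clm L, h.locallyIntegrable_deriv.clm L, fun η h1 h2 => ?_⟩
  have hη : IsTest η := ⟨h1, h2⟩
  have e1 := L.integral_comp_comm ((hη.pderiv j).integrable_smul h.locallyIntegrable)
  have e2 := L.integral_comp_comm (hη.integrable_smul h.locallyIntegrable_deriv)
  have e3 := congrArg L (h.integral_eq η h1 h2)
  simp only [map_smul, pderiv] at e1 e2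
  rw [e1, e3, map_neg, e2]

theorem IsWeakPartial.add {j : Fin 3} {f g f' g' : Space → F}
    (h : IsWeakPartial j f g) (h' : IsWeakPartial j f' g') :
    IsWeakPartial j (fun x => f x + f' x) (fun x => g x + g' x) := by
  refine ⟨h.locallyIntegrable.add h'.locallyIntegrable,
    h.locallyIntegrable_deriv.add h'.locallyIntegrable_deriv, fun η h1 h2 => ?_⟩
  have hη : IsTest η := ⟨h1, h2⟩
  simp only [smul_add]
  change ∫ x, (pderiv j η x • f x + pderiv j η x • f' x) = _
  rw [integral_add ((hη.pderiv j).integrable_smul h.locallyIntegrable)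
    ((hη.pderiv j).integrable_smul h'.locallyIntegrable),
    integral_add (hη.integrable_smul h.locallyIntegrable_deriv)
    (hη.integrable_smul h'.locallyIntegrable_deriv), neg_add, ← h.integral_eq η h1 h2,
    ← h'.integral_eq η h1 h2]
  rfl

theorem IsWeakPartial.zero (j : Fin 3) :
    IsWeakPartial j (fun _ => (0 : F)) (fun _ => (0 : F)) :=
  ⟨locallyIntegrable_zero, locallyIntegrable_zero, fun η _ _ => by simp⟩

theorem IsWeakPartial.sum {ι : Type*} (s : Finset ι) {j : Fin 3} {f g : ι → Space → F}
    (h : ∀ i, IsWeakPartial j (f i) (g i)) :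
    IsWeakPartial j (fun x => ∑ i ∈ s, f i x) (fun x => ∑ i ∈ s, g i x) := by
  classical
  induction s using Finset.induction_on with
  | empty => simpa using IsWeakPartial.zero j
  | insert i s hi ih => simpa only [Finset.sum_insert hi] using (h i).add ih

end General

/-- Integration by parts for integrable functions with integrable weak derivative against bounded
smooth multipliers. -/
theorem IsWeakPartial.integral_mul_bounded {j : Fin 3} {f g : Space → ℝ} (h : IsWeakPartial j f g)
    (hf : Integrable f) (hg : Integrable g)
    {a : Space → ℝ} {C : ℝ} (ha : ContDiff ℝ ((⊤ : ℕ∞) : WithTop ℕ∞) a) (haC : ∀ x, |a x| ≤ C)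
    (hda : ∀ k x, |pderiv k a x| ≤ C) :
    ∫ x, a x * g x = - ∫ x, pderiv j a x * f x := by
  have hsum : ∀ (b : Space → ℝ) x, ∑ k, pderiv k b x * (if k = j then f x else 0)
      = pderiv j b x * f x := by
    intro b x
    simp
  have key := integral_multiplier_eq_zero (G₀ := g) (G := fun k x => if k = j then f x else 0) hg
    (fun k => by by_cases hk : k = j <;> simp [hk, hf]) ?_ ha haC hda
  · simp only [hsum] at key
    rw [integral_add] at key
    · linarith
    · exact hg.bdd_mul ha.continuous.aestronglyMeasurable (Eventually.of_forall haC)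
    · exact hf.bdd_mul (contDiff_pderiv ha j).continuous.aestronglyMeasurable
        (Eventually.of_forall (hda j))
  · intro η hη
    simp only [hsum]
    have e := h.integral_eq η hη.contDiff hη.compact
    rw [integral_add]
    · have e' : ∫ x, pderiv j η x * f x = - ∫ x, η x * g x := e
      linarith
    · exact hη.integrable_smul h.locallyIntegrable_deriv
    · exact (hη.pderiv j).integrable_smul h.locallyIntegrable

/-! ### Mollification and products of `H¹` functions -/

theorem _root_.MeasureTheory.MemLp.bounded_mul {u a : Space → ℝ} {C : ℝ} (hu : MemLp u 2 volume)
    (ha : AEStronglyMeasurable a volume) (hC : ∀ x, |a x| ≤ C) :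
    MemLp (fun x => a x * u x) 2 volume :=
  hu.of_le_mul (c := C) (ha.mul hu.1) (Eventually.of_forall fun x => by
    rw [norm_mul]
    exact mul_le_mul_of_nonneg_right (hC x) (norm_nonneg _))

theorem IsTest.mul_memLp {η u : Space → ℝ} (hη : IsTest η) (hu : MemLp u 2 volume) :
    MemLp (fun x => η x * u x) 2 volume := by
  obtain ⟨C, hC⟩ := hη.bounded
  exact hu.bounded_mul hη.continuous.aestronglyMeasurable hC

theorem _root_.MeasureTheory.MemLp.mul_integrable {u v : Space → ℝ} (hu : MemLp u 2 volume)
    (hv : MemLp v 2 volume) : Integrable (fun x => u x * v x) :=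
  hu.integrable_mul hv

theorem IsTest.integrable_mul {η : Space → ℝ} (h : IsTest η) {f : Space → ℝ}
    (hf : LocallyIntegrable f volume) : Integrable (fun x => η x * f x) :=
  h.integrable_smul hf

/-- Translation is continuous in `L²`, so correlations of `L²` functions are continuous. -/
theorem continuous_correlation {h v : Space → ℝ} (hh : MemLp h 2 volume) (hv : MemLp v 2 volume) :
    Continuous fun s : Space => ∫ x, h x * v (s + x) := by
  have h1 : ∀ s : Space, ∫ x, h x * v (s + x)
      = inner ℝ (hh.toLp h) (DomAddAct.mk s +ᵥ hv.toLp v : Lp ℝ 2 volume) := by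
    intro s
    rw [DomAddAct.mk_vadd_toLp, L2.inner_def]
    refine integral_congr_ae ?_
    have hs : MemLp (fun x => v (s +ᵥ x)) 2 volume :=
      hv.comp_measurePreserving (measurePreserving_add_left volume s)
    filter_upwards [hh.coeFn_toLp, hs.coeFn_toLp] with x e1 e2
    rw [e1, e2]
    simp [mul_comm]
  simp only [h1]
  have : Fact ((2 : ENNReal) ≠ ⊤) := ⟨by norm_num⟩
  have h2 : Continuous fun s : Space => (DomAddAct.mk s +ᵥ hv.toLp v : Lp ℝ 2 volume) :=
    DomAddAct.continuous_mk.vadd continuous_const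
  exact continuous_const.inner h2

/-- A sequence of bump functions shrinking to the origin. -/
def bump (n : ℕ) : ContDiffBump (0 : Space) :=
  ⟨(2 * (n + 1 : ℝ))⁻¹, (n + 1 : ℝ)⁻¹, by positivity, by
    rw [mul_inv]
    have : 0 < (n + 1 : ℝ)⁻¹ := by positivity
    linarith⟩

theorem tendsto_bump_rOut : Tendsto (fun n => (bump n).rOut) atTop (𝓝 0) :=
  tendsto_inv_atTop_zero.comp (tendsto_atTop_add_const_right _ _ tendsto_natCast_atTop_atTop)

/-- The normalised bump functions. -/
def kern (n : ℕ) : Space → ℝ := (bump n).normed volume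

theorem isTest_kern (n : ℕ) : IsTest (kern n) :=
  ⟨(bump n).contDiff_normed, (bump n).hasCompactSupport_normed⟩

/-- Mollification of `v` at scale `1 / (n + 1)`. -/
def mollify (n : ℕ) (v : Space → ℝ) : Space → ℝ :=
  convolution v (kern n) (ContinuousLinearMap.lsmul ℝ ℝ) volume

theorem contDiff_mollify (n : ℕ) {v : Space → ℝ} (hv : LocallyIntegrable v volume) :
    ContDiff ℝ ((⊤ : ℕ∞) : WithTop ℕ∞) (mollify n v) :=
  (isTest_kern n).compact.contDiff_convolution_right _ hv (isTest_kern n).contDiff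

/-- Mollification turns weak derivatives into classical ones. -/
theorem pderiv_mollify (n : ℕ) {j : Fin 3} {v w : Space → ℝ} (h : IsWeakPartial j v w) :
    pderiv j (mollify n v) = mollify n w := by
  funext x
  have hk := isTest_kern n
  have h1 := hk.compact.hasFDerivAt_convolution_right (ContinuousLinearMap.lsmul ℝ ℝ)
    (μ := volume) h.locallyIntegrable (hk.contDiff.of_le (by exact_mod_cast le_top)) x
  rw [pderiv, mollify, h1.fderiv, convolution_precompR_apply _ h.locallyIntegrable
    (hk.compact.fderiv (𝕜 := ℝ)) (hk.contDiff.continuous_fderiv (by simp))]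
  have hη : IsTest fun t => kern n (x - t) :=
    ⟨hk.contDiff.comp (contDiff_const.sub contDiff_id),
      hk.compact.comp_homeomorph (Homeomorph.subLeft x)⟩
  have e := h.integral_eq _ hη.contDiff hη.compact
  have hd : ∀ t, fderiv ℝ (fun t => kern n (x - t)) t (basisVec j)
      = - fderiv ℝ (kern n) (x - t) (basisVec j) := by
    intro t
    have := ((hk.differentiable (x - t)).hasFDerivAt).comp t
      ((hasFDerivAt_id t).const_sub x)
    have h2 : HasFDerivAt (fun t => kern n (x - t)) _ t := this
    rw [h2.fderiv]
    simp
  simp only [hd, neg_smul, integral_neg, neg_inj] at e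
  simp only [mollify, convolution, ContinuousLinearMap.lsmul_apply, smul_eq_mul] at e ⊢
  simp only [mul_comm (v _), mul_comm (w _)]
  exact e

/-- Mollifications converge weakly in `L²`. -/
theorem tendsto_integral_mul_mollify {h v : Space → ℝ} (hh : MemLp h 2 volume)
    (hv : MemLp v 2 volume) :
    Tendsto (fun n => ∫ x, h x * mollify n v x) atTop (𝓝 (∫ x, h x * v x)) := by
  have hc := continuous_correlation hh hv
  have hlim := ContDiffBump.convolution_tendsto_right_of_continuous (μ := volume)
    tendsto_bump_rOut hc 0
  simp only [zero_add] at hlim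
  refine hlim.congr fun n => ?_
  have hint : Integrable (fun p : Space × Space => h p.1 * (v (p.1 - p.2) * kern n p.2))
      (volume.prod volume) := by
    have hm : AEStronglyMeasurable
        (fun p : Space × Space => h p.1 * (v (p.1 - p.2) * kern n p.2)) (volume.prod volume) := by
      refine (hh.1.comp_fst).mul ((hv.1.comp_quasiMeasurePreserving
        (quasiMeasurePreserving_sub_of_right_invariant volume volume)).mul ?_)
      exact ((isTest_kern n).continuous.comp continuous_snd).aestronglyMeasurable
    have htr : ∀ t : Space, MemLp (fun x => v (x - t)) 2 volume := fun t =>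
      hv.comp_measurePreserving (measurePreserving_sub_right volume t)
    refine (integrable_prod_iff' hm).2 ⟨Eventually.of_forall fun t => ?_, ?_⟩
    · have := (hh.mul_integrable (htr t)).mul_const (kern n t)
      simpa only [mul_assoc] using this
    · have hc' := continuous_correlation hh.norm hv.norm
      have e : (fun t => ∫ x, ‖h x * (v (x - t) * kern n t)‖)
          = fun t => |kern n t| * ∫ x, ‖h x‖ * ‖v (-t + x)‖ := by
        funext t
        rw [← integral_const_mul]
        congr 1
        funext x
        rw [norm_mul, norm_mul, Real.norm_eq_abs (kern n t), neg_add_eq_sub]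
        ring
      rw [e]
      refine Continuous.integrable_of_hasCompactSupport ?_ ?_
      · exact (isTest_kern n).continuous.abs.mul (hc'.comp continuous_neg)
      · exact ((isTest_kern n).compact.comp_left (g := fun r : ℝ => |r|) abs_zero).mul_right
  -- the pairing with the mollification is the correlation averaged against the kernel
  have hsw := integral_integral_swap
    (f := fun x t => h x * (v (x - t) * kern n t)) hint
  have e1 : ∀ x, mollify n v x = ∫ t, v (x - t) * kern n t := fun x => by
    simp [mollify, convolution_eq_swap]
  simp only [e1, ← integral_const_mul]
  rw [hsw]
  simp only [convolution, ContinuousLinearMap.lsmul_apply, smul_eq_mul]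
  refine integral_congr_ae (Eventually.of_forall fun t => ?_)
  simp only
  rw [← integral_const_mul]
  refine integral_congr_ae (Eventually.of_forall fun x => ?_)
  simp only [zero_sub, neg_add_eq_sub, kern]
  ring

theorem _root_.MeasureTheory.MemLp.locallyIntegrable_two {F : Type*} [NormedAddCommGroup F]
    {v : Space → F} (hv : MemLp v 2 volume) : LocallyIntegrable v volume :=
  hv.locallyIntegrable (by norm_num)

/-- The product rule for `H¹` functions. -/
theorem IsWeakPartial.mul {j : Fin 3} {u u' v v' : Space → ℝ} (hu : IsWeakPartial j u u')
    (hv : IsWeakPartial j v v') (mu : MemLp u 2 volume) (mu' : MemLp u' 2 volume)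
    (mv : MemLp v 2 volume) (mv' : MemLp v' 2 volume) :
    IsWeakPartial j (fun x => u x * v x) (fun x => u' x * v x + u x * v' x) := by
  have i1 := mu.mul_integrable mv
  have i2 := mu'.mul_integrable mv
  have i3 := mu.mul_integrable mv'
  refine ⟨i1.locallyIntegrable, (i2.add i3).locallyIntegrable, fun η h1 h2 => ?_⟩
  have hη : IsTest η := ⟨h1, h2⟩
  -- mollify `v`; then `η` times the mollification is a test function for `u`
  have l1 := tendsto_integral_mul_mollify ((hη.pderiv j).mul_memLp mu) mv
  have l2 := tendsto_integral_mul_mollify (hη.mul_memLp mu') mv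
  have l3 := tendsto_integral_mul_mollify (hη.mul_memLp mu) mv'
  have key : ∀ n, ∫ x, (pderiv j η x * u x) * mollify n v x
      = - (∫ x, (η x * u' x) * mollify n v x) - ∫ x, (η x * u x) * mollify n v' x := by
    intro n
    have hw := contDiff_mollify n hv.locallyIntegrable
    have hw' := pderiv_mollify n hv
    have ht : IsTest fun x => mollify n v x * η x := hη.mul_left hw
    have e := hu.integral_eq _ ht.contDiff ht.compact
    have hd : ∀ x, fderiv ℝ (fun x => mollify n v x * η x) x (basisVec j)
        = mollify n v x * pderiv j η x + mollify n v' x * η x := by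
      intro x
      rw [← hw']
      exact pderiv_mul (hw.differentiable (by simp) x) (hη.differentiable x) j
    have hw2 := contDiff_mollify n hv.locallyIntegrable_deriv
    simp only [hd, smul_eq_mul, add_mul] at e
    rw [integral_add (((hη.pderiv j).mul_left hw).integrable_mul hu.locallyIntegrable)
      ((hη.mul_left hw2).integrable_mul hu.locallyIntegrable)] at e
    have c1 : ∀ x, (pderiv j η x * u x) * mollify n v x = mollify n v x * pderiv j η x * u x :=
      fun x => by ring
    have c2 : ∀ x, (η x * u' x) * mollify n v x = mollify n v x * η x * u' x := fun x => by ring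
    have c3 : ∀ x, (η x * u x) * mollify n v' x = mollify n v' x * η x * u x := fun x => by ring
    simp only [c1, c2, c3]
    linarith
  have := tendsto_nhds_unique l1 (((l2.neg).sub l3).congr fun n => (key n).symm)
  simp only [smul_eq_mul, mul_add]
  change ∫ x, pderiv j η x * (u x * v x) = _
  rw [integral_add (hη.integrable_mul i2.locallyIntegrable)
    (hη.integrable_mul i3.locallyIntegrable)]
  simp only [mul_assoc] at this
  rw [this]
  ring

theorem pderiv_comm {w : Space → ℝ} (hw : ContDiff ℝ ((⊤ : ℕ∞) : WithTop ℕ∞) w) (j k : Fin 3)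
    (x : Space) : pderiv j (pderiv k w) x = pderiv k (pderiv j w) x := by
  have hs : IsSymmSndFDerivAt ℝ w x :=
    hw.contDiffAt.isSymmSndFDerivAt (by
      rw [minSmoothness_of_isRCLikeNormedField]
      exact WithTop.coe_le_coe.2 (le_top : (2 : ℕ∞) ≤ ⊤))
  have hd : DifferentiableAt ℝ (fderiv ℝ w) x :=
    (hw.fderiv_right (m := ((⊤ : ℕ∞) : WithTop ℕ∞)) (by simp)).differentiable (by simp) x
  have h2 : ∀ i l, pderiv i (pderiv l w) x = fderiv ℝ (fderiv ℝ w) x (basisVec i) (basisVec l) := by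
    intro i l
    have := (hd.hasFDerivAt.clm_apply (hasFDerivAt_const (basisVec l) x))
    have h3 : HasFDerivAt (pderiv l w) _ x := this
    rw [pderiv, h3.fderiv]
    simp
  rw [h2, h2]
  exact hs _ _

/-- `∂_j u ∂_k v - ∂_k u ∂_j v` is the divergence of `u ∂_k v` in direction `j` minus `u ∂_j v` in
direction `k`, for `u, v ∈ H¹`: mollify `v` only, so that its second derivatives exist and cancel. -/
theorem integral_null_lagrangian_test {j k : Fin 3} {u uj uk v vj vk : Space → ℝ}
    (huj : IsWeakPartial j u uj) (huk : IsWeakPartial k u uk)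
    (hvj : IsWeakPartial j v vj) (hvk : IsWeakPartial k v vk)
    (mu : MemLp u 2 volume) (muj : MemLp uj 2 volume) (muk : MemLp uk 2 volume)
    (mvj : MemLp vj 2 volume) (mvk : MemLp vk 2 volume)
    {a : Space → ℝ} (ha : IsTest a) :
    (∫ x, a x * uj x * vk x) - (∫ x, a x * uk x * vj x)
      + (∫ x, pderiv j a x * u x * vk x) - (∫ x, pderiv k a x * u x * vj x) = 0 := by
  have l1 := tendsto_integral_mul_mollify (ha.mul_memLp muj) mvk
  have l2 := tendsto_integral_mul_mollify (ha.mul_memLp muk) mvj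
  have l3 := tendsto_integral_mul_mollify ((ha.pderiv j).mul_memLp mu) mvk
  have l4 := tendsto_integral_mul_mollify ((ha.pderiv k).mul_memLp mu) mvj
  refine tendsto_nhds_unique (((l1.sub l2).add l3).sub l4) ?_
  refine tendsto_const_nhds.congr fun n => ?_
  have hw := contDiff_mollify n hvj.locallyIntegrable
  -- one integration by parts in `u`, the second derivative falling on the mollified `v`
  have part : ∀ {i l : Fin 3} {ui vl : Space → ℝ}, IsWeakPartial i u ui → IsWeakPartial l v vl →
      (∫ x, a x * ui x * mollify n vl x) + (∫ x, pderiv i a x * u x * mollify n vl x)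
        = - ∫ x, pderiv i (pderiv l (mollify n v)) x * a x * u x := by
    intro i l ui vl hui hvl
    have hw' := pderiv_mollify n hvl
    have hc : ContDiff ℝ ((⊤ : ℕ∞) : WithTop ℕ∞) (pderiv l (mollify n v)) := contDiff_pderiv hw l
    have ht := ha.mul_left hc
    have e := hui.integral_eq _ ht.contDiff ht.compact
    have hd : ∀ x, fderiv ℝ (fun x => pderiv l (mollify n v) x * a x) x (basisVec i)
        = pderiv l (mollify n v) x * pderiv i a x
          + pderiv i (pderiv l (mollify n v)) x * a x := fun x =>
      pderiv_mul (hc.differentiable (by simp) x) (ha.differentiable x) i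
    simp only [hd, smul_eq_mul, add_mul] at e
    rw [integral_add (((ha.pderiv i).mul_left hc).integrable_mul hui.locallyIntegrable)
      ((ha.mul_left (contDiff_pderiv hc i)).integrable_mul hui.locallyIntegrable)] at e
    rw [← hw']
    have c1 : ∀ x, a x * ui x * pderiv l (mollify n v) x
        = pderiv l (mollify n v) x * a x * ui x := fun x => by ring
    have c2 : ∀ x, pderiv i a x * u x * pderiv l (mollify n v) x
        = pderiv l (mollify n v) x * pderiv i a x * u x := fun x => by ring
    simp only [c1, c2]
    linarith
  have p1 := part huj hvk
  have p2 := part huk hvj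
  simp only [pderiv_comm hw j k] at p1
  linarith

/-- The null-Lagrangian identity with a bounded smooth weight. -/
theorem integral_null_lagrangian {j k : Fin 3} {u uj uk v vj vk : Space → ℝ}
    (huj : IsWeakPartial j u uj) (huk : IsWeakPartial k u uk)
    (hvj : IsWeakPartial j v vj) (hvk : IsWeakPartial k v vk)
    (mu : MemLp u 2 volume) (muj : MemLp uj 2 volume) (muk : MemLp uk 2 volume)
    (mvj : MemLp vj 2 volume) (mvk : MemLp vk 2 volume)
    {a : Space → ℝ} {C : ℝ} (ha : ContDiff ℝ ((⊤ : ℕ∞) : WithTop ℕ∞) a) (haC : ∀ x, |a x| ≤ C)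
    (hda : ∀ i x, |pderiv i a x| ≤ C) :
    ∫ x, (a x * (uj x * vk x - uk x * vj x)
      + (pderiv j a x * (u x * vk x) - pderiv k a x * (u x * vj x))) = 0 := by
  have hsum : ∀ (b : Space → ℝ) x, ∑ i, pderiv i b x *
      ((if i = j then u x * vk x else 0) - (if i = k then u x * vj x else 0))
      = pderiv j b x * (u x * vk x) - pderiv k b x * (u x * vj x) := by
    intro b x
    simp [mul_sub, Finset.sum_sub_distrib]
  have i1 := muj.mul_integrable mvk
  have i2 := muk.mul_integrable mvj
  have i3 := mu.mul_integrable mvk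
  have i4 := mu.mul_integrable mvj
  have key := integral_multiplier_eq_zero (G₀ := fun x => uj x * vk x - uk x * vj x)
    (G := fun i x => (if i = j then u x * vk x else 0) - (if i = k then u x * vj x else 0))
    (i1.sub i2) (fun i => ?_) ?_ ha haC hda
  · simpa only [hsum] using key
  · refine Integrable.sub ?_ ?_
    · by_cases h : i = j <;> simp [h, i3]
    · by_cases h : i = k <;> simp [h, i4]
  · intro η hη
    simp only [hsum]
    have := integral_null_lagrangian_test huj huk hvj hvk mu muj muk mvj mvk hη
    have e : ∀ {b f g : Space → ℝ}, IsTest b → Integrable (fun x => f x * g x) →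
        Integrable (fun x => b x * f x * g x) := fun hb hfg => by
      simpa only [mul_assoc, smul_eq_mul] using hb.integrable_mul hfg.locallyIntegrable
    have e12 : Integrable (fun x => η x * uj x * vk x - η x * uk x * vj x) :=
      (e hη i1).sub (e hη i2)
    have e34 : Integrable (fun x => pderiv j η x * u x * vk x - pderiv k η x * u x * vj x) :=
      (e (hη.pderiv j) i3).sub (e (hη.pderiv k) i4)
    rw [add_sub_assoc, ← integral_sub (e hη i1) (e hη i2),
      ← integral_sub (e (hη.pderiv j) i3) (e (hη.pderiv k) i4), ← integral_add e12 e34] at this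
    rw [← this]
    congr 1
    funext x
    ring

/-! ### Bilinear expressions in spinor fields -/

/-- The coordinates of a spinor in a real basis. -/
def coordCLM (p : Fin (Module.finrank ℝ Spinor)) : Spinor →L[ℝ] ℝ :=
  LinearMap.toContinuousLinearMap ((Module.finBasis ℝ Spinor).coord p)

/-- The matrix of a real bilinear form on spinors. -/
def bilinCoeff (B : Spinor →ₗ[ℝ] Spinor →ₗ[ℝ] ℝ) (p q : Fin (Module.finrank ℝ Spinor)) : ℝ :=
  B (Module.finBasis ℝ Spinor p) (Module.finBasis ℝ Spinor q)

theorem bilin_expand (B : Spinor →ₗ[ℝ] Spinor →ₗ[ℝ] ℝ) (u v : Spinor) :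
    B u v = ∑ p, ∑ q, bilinCoeff B p q *
      (coordCLM p u * coordCLM q v) := by
  set b := Module.finBasis ℝ Spinor with hb
  conv_lhs => rw [← b.sum_repr u, ← b.sum_repr v]
  simp only [map_sum, LinearMap.sum_apply, map_smul, LinearMap.smul_apply, smul_eq_mul,
    Finset.mul_sum]
  rw [Finset.sum_comm]
  refine Finset.sum_congr rfl fun p _ => Finset.sum_congr rfl fun q _ => ?_
  simp only [bilinCoeff, coordCLM, LinearMap.coe_toContinuousLinearMap', Module.Basis.coord_apply,
    ← hb]
  ring

theorem memLp_coord {u : Space → Spinor} (hu : MemLp u 2 volume)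
    (p : Fin (Module.finrank ℝ Spinor)) : MemLp (fun x => coordCLM p (u x)) 2 volume :=
  (coordCLM p).comp_memLp' hu

theorem integrable_bilin (B : Spinor →ₗ[ℝ] Spinor →ₗ[ℝ] ℝ) {u v : Space → Spinor}
    (hu : MemLp u 2 volume) (hv : MemLp v 2 volume) : Integrable (fun x => B (u x) (v x)) := by
  simp only [bilin_expand B]
  exact integrable_finsetSum _ fun p _ => integrable_finsetSum _ fun q _ =>
    ((memLp_coord hu p).mul_integrable (memLp_coord hv q)).const_mul _

theorem IsWeakPartial.bilin (B : Spinor →ₗ[ℝ] Spinor →ₗ[ℝ] ℝ) {j : Fin 3}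
    {u u' v v' : Space → Spinor} (hu : IsWeakPartial j u u')
    (hv : IsWeakPartial j v v') (mu : MemLp u 2 volume) (mu' : MemLp u' 2 volume)
    (mv : MemLp v 2 volume) (mv' : MemLp v' 2 volume) :
    IsWeakPartial j (fun x => B (u x) (v x)) (fun x => B (u' x) (v x) + B (u x) (v' x)) := by
  simp only [bilin_expand B, ← Finset.sum_add_distrib, ← mul_add]
  refine IsWeakPartial.sum _ fun p => IsWeakPartial.sum _ fun q => ?_
  exact ((hu.clm (coordCLM p)).mul (hv.clm (coordCLM q)) (memLp_coord mu p) (memLp_coord mu' p)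
    (memLp_coord mv q) (memLp_coord mv' q)).clm (ContinuousLinearMap.mul ℝ ℝ _)

/-- The null-Lagrangian identity for a real bilinear form of two spinor fields, coordinatewise. -/
theorem integral_null_lagrangian_bilin (B : Spinor →ₗ[ℝ] Spinor →ₗ[ℝ] ℝ) {j k : Fin 3}
    {u uj uk v vj vk : Space → Spinor}
    (huj : IsWeakPartial j u uj) (huk : IsWeakPartial k u uk)
    (hvj : IsWeakPartial j v vj) (hvk : IsWeakPartial k v vk)
    (mu : MemLp u 2 volume) (muj : MemLp uj 2 volume) (muk : MemLp uk 2 volume)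
    (mvj : MemLp vj 2 volume) (mvk : MemLp vk 2 volume)
    {a : Space → ℝ} {C : ℝ} (ha : ContDiff ℝ ((⊤ : ℕ∞) : WithTop ℕ∞) a) (haC : ∀ x, |a x| ≤ C)
    (hda : ∀ i x, |pderiv i a x| ≤ C) :
    ∫ x, (a x * (B (uj x) (vk x) - B (uk x) (vj x))
      + (pderiv j a x * B (u x) (vk x) - pderiv k a x * B (u x) (vj x))) = 0 := by
  have hsplit : ∀ x, (a x * (B (uj x) (vk x) - B (uk x) (vj x))
      + (pderiv j a x * B (u x) (vk x) - pderiv k a x * B (u x) (vj x)))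
      = ∑ p, ∑ q, bilinCoeff B p q *
        (a x * (coordCLM p (uj x) * coordCLM q (vk x) - coordCLM p (uk x) * coordCLM q (vj x))
          + (pderiv j a x * (coordCLM p (u x) * coordCLM q (vk x))
            - pderiv k a x * (coordCLM p (u x) * coordCLM q (vj x)))) := by
    intro x
    simp only [bilin_expand B, ← Finset.sum_sub_distrib, ← Finset.sum_add_distrib, Finset.mul_sum]
    refine Finset.sum_congr rfl fun p _ => Finset.sum_congr rfl fun q _ => ?_
    ring
  have hm : ∀ {b f : Space → ℝ}, ContDiff ℝ ((⊤ : ℕ∞) : WithTop ℕ∞) b → (∀ x, |b x| ≤ C) →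
      Integrable f → Integrable (fun x => b x * f x) := fun hb hC hf =>
    hf.bdd_mul hb.continuous.aestronglyMeasurable (Eventually.of_forall hC)
  have hint : ∀ p q, Integrable fun x =>
      bilinCoeff B p q *
        (a x * (coordCLM p (uj x) * coordCLM q (vk x) - coordCLM p (uk x) * coordCLM q (vj x))
          + (pderiv j a x * (coordCLM p (u x) * coordCLM q (vk x))
            - pderiv k a x * (coordCLM p (u x) * coordCLM q (vj x)))) := fun p q => by
    refine Integrable.const_mul (Integrable.add (hm ha haC (Integrable.sub ?_ ?_))
      (Integrable.sub (hm (contDiff_pderiv ha j) (hda j) ?_)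
        (hm (contDiff_pderiv ha k) (hda k) ?_))) _
    · exact (memLp_coord muj p).mul_integrable (memLp_coord mvk q)
    · exact (memLp_coord muk p).mul_integrable (memLp_coord mvj q)
    · exact (memLp_coord mu p).mul_integrable (memLp_coord mvk q)
    · exact (memLp_coord mu p).mul_integrable (memLp_coord mvj q)
  simp only [hsplit]
  rw [integral_finsetSum _ fun p _ => integrable_finsetSum _ fun q _ => hint p q]
  refine Finset.sum_eq_zero fun p _ => ?_
  rw [integral_finsetSum _ fun q _ => hint p q]
  refine Finset.sum_eq_zero fun q _ => ?_
  rw [integral_const_mul]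
  rw [integral_null_lagrangian (huj.clm (coordCLM p)) (huk.clm (coordCLM p))
    (hvj.clm (coordCLM q)) (hvk.clm (coordCLM q)) (memLp_coord mu p) (memLp_coord muj p)
    (memLp_coord muk p) (memLp_coord mvj q) (memLp_coord mvk q) ha haC hda, mul_zero]

/-! ### The regularised distance -/

theorem pderiv_comp {f : ℝ → ℝ} {f' : ℝ} {η : Space → ℝ} {x : Space}
    (hf : HasDerivAt f f' (η x)) (hη : DifferentiableAt ℝ η x) (j : Fin 3) :
    pderiv j (fun y => f (η y)) x = f' * pderiv j η x := by
  have h : HasFDerivAt (fun y => f (η y)) _ x := hf.comp_hasFDerivAt x hη.hasFDerivAt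
  rw [pderiv, h.fderiv]
  simp [pderiv]

theorem pderiv_comp_sub (g : Space → ℝ) (c : Space) (j : Fin 3) (x : Space) :
    pderiv j (fun y => g (y - c)) x = pderiv j g (x - c) := by
  rw [pderiv, fderiv_comp_sub]
  rfl

theorem contDiff_coord (k : Fin 3) :
    ContDiff ℝ ((⊤ : ℕ∞) : WithTop ℕ∞) (fun z : Space => z k) := by
  fun_prop

theorem pderiv_coord (j k : Fin 3) (x : Space) :
    pderiv j (fun z : Space => z k) x = if j = k then 1 else 0 := by
  have h : HasFDerivAt (fun z : Space => z k) (EuclideanSpace.proj (𝕜 := ℝ) k : Space →L[ℝ] ℝ) x :=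
    (EuclideanSpace.proj (𝕜 := ℝ) k : Space →L[ℝ] ℝ).hasFDerivAt
  rw [pderiv, h.fderiv]
  simp [basisVec, eq_comm]

/-- The regularised norm `√(|z|² + ε)`. -/
def reg (ε : ℝ) (z : Space) : ℝ := √(‖z‖ ^ 2 + ε)

theorem reg_pos {ε : ℝ} (hε : 0 < ε) (z : Space) : 0 < reg ε z := by
  unfold reg
  positivity

theorem reg_sq {ε : ℝ} (hε : 0 < ε) (z : Space) : reg ε z ^ 2 = ‖z‖ ^ 2 + ε :=
  Real.sq_sqrt (by positivity)

theorem norm_le_reg {ε : ℝ} (hε : 0 < ε) (z : Space) : ‖z‖ ≤ reg ε z :=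
  Real.le_sqrt_of_sq_le (by linarith)

theorem abs_coord_le_norm (z : Space) (k : Fin 3) : |z k| ≤ ‖z‖ := by
  have := PiLp.norm_apply_le (p := 2) z k
  simpa using this

theorem abs_coord_le_reg {ε : ℝ} (hε : 0 < ε) (z : Space) (k : Fin 3) : |z k| ≤ reg ε z :=
  (abs_coord_le_norm z k).trans (norm_le_reg hε z)

theorem contDiff_reg {ε : ℝ} (hε : 0 < ε) : ContDiff ℝ ((⊤ : ℕ∞) : WithTop ℕ∞) (reg ε) := by
  refine ContDiff.sqrt ((contDiff_norm_sq ℝ).add contDiff_const) fun z => ?_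
  positivity

theorem pderiv_reg {ε : ℝ} (hε : 0 < ε) (k : Fin 3) (z : Space) :
    pderiv k (reg ε) z = z k / reg ε z := by
  have h0 : HasFDerivAt (fun y : Space => ‖y‖ ^ 2 + ε) _ z :=
    ((hasFDerivAt_id z).norm_sq).add_const ε
  have h1 := pderiv_comp (f := Real.sqrt) (Real.hasDerivAt_sqrt (by positivity))
    h0.differentiableAt k
  have h2 : pderiv k (fun y : Space => ‖y‖ ^ 2 + ε) z = 2 * z k := by
    rw [pderiv, h0.fderiv]
    simp [inner_basisVec]
  rw [h2] at h1
  change pderiv k (fun y => √(‖y‖ ^ 2 + ε)) z = _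
  rw [h1]
  have := reg_pos hε z
  unfold reg at *
  field_simp

theorem pderiv_inv_reg {ε : ℝ} (hε : 0 < ε) (k : Fin 3) (z : Space) :
    pderiv k (fun y => (reg ε y)⁻¹) z = - z k / reg ε z ^ 3 := by
  have hp := reg_pos hε z
  rw [pderiv_comp (f := fun r => r⁻¹) (hasDerivAt_inv hp.ne')
    ((contDiff_reg hε).differentiable (by simp) z), pderiv_reg hε]
  field_simp

theorem contDiff_inv_reg {ε : ℝ} (hε : 0 < ε) :
    ContDiff ℝ ((⊤ : ℕ∞) : WithTop ℕ∞) (fun y => (reg ε y)⁻¹) :=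
  (contDiff_reg hε).inv fun z => (reg_pos hε z).ne'

theorem sqrt_le_reg (ε : ℝ) (z : Space) : √ε ≤ reg ε z :=
  Real.sqrt_le_sqrt (by nlinarith [sq_nonneg ‖z‖])

theorem inv_reg_le {ε : ℝ} (hε : 0 < ε) (z : Space) : (reg ε z)⁻¹ ≤ (√ε)⁻¹ :=
  inv_anti₀ (Real.sqrt_pos.2 hε) (sqrt_le_reg ε z)

theorem abs_pderiv_inv_reg_le {ε : ℝ} (hε : 0 < ε) (k : Fin 3) (z : Space) :
    |pderiv k (fun y => (reg ε y)⁻¹) z| ≤ (√ε)⁻¹ ^ 2 := by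
  have hp := reg_pos hε z
  rw [pderiv_inv_reg hε, abs_div, abs_neg, abs_of_pos (pow_pos hp 3)]
  calc |z k| / reg ε z ^ 3 ≤ reg ε z / reg ε z ^ 3 := by
        gcongr
        exact abs_coord_le_reg hε z k
    _ = (reg ε z)⁻¹ ^ 2 := by field_simp
    _ ≤ _ := pow_le_pow_left₀ (inv_nonneg.2 hp.le) (inv_reg_le hε z) 2

theorem norm_sq_eq_sum (z : Space) : ‖z‖ ^ 2 = ∑ k, z k ^ 2 := by
  simp [EuclideanSpace.norm_sq_eq]

theorem tendsto_reg (z : Space) {ε : ℕ → ℝ} (hε : Tendsto ε atTop (𝓝 0)) :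
    Tendsto (fun n => reg (ε n) z) atTop (𝓝 ‖z‖) := by
  have : Tendsto (fun n => √(‖z‖ ^ 2 + ε n)) atTop (𝓝 √(‖z‖ ^ 2 + 0)) :=
    (Real.continuous_sqrt.tendsto _).comp (hε.const_add _)
  rw [add_zero, Real.sqrt_sq (norm_nonneg z)] at this
  exact this

/-! ### Bounded potentials -/

/-- Integrable functions `f` for which `|f| * (1/|x|)` is everywhere finite and bounded. -/
structure BoundedPotential (f : Space → ℝ) : Prop where
  integrable : Integrable f
  bound : ∃ C, ∀ x, Integrable (fun y => |f y| / ‖x - y‖) ∧ ∫ y, |f y| / ‖x - y‖ ≤ C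

theorem ae_ne (x : Space) : ∀ᵐ y : Space, y ≠ x := by
  simp [ae_iff]

/-- A nonnegative function in `W^{1,1}` has a bounded Newton potential: `2 / |z|` is the divergence
of the unit vector field `z / |z|`, so integrating by parts bounds `∫ f(y) / |x - y| dy` by half the
sum of the `L¹` norms of the partial derivatives of `f`. -/
theorem boundedPotential_of_weakPartial {f : Space → ℝ} {g : Fin 3 → Space → ℝ}
    (hf : Integrable f) (hf0 : ∀ x, 0 ≤ f x) (hg : ∀ k, Integrable (g k))
    (h : ∀ k, IsWeakPartial k f (g k)) : BoundedPotential f := by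
  set M : ℝ := ∑ k, ∫ y, |g k y| with hM
  have hε : ∀ (x : Space) (ε : ℝ), 0 < ε →
      Integrable (fun y => f y / reg ε (y - x)) ∧ ∫ y, f y / reg ε (y - x) ≤ M / 2 := by
    intro x ε hε
    have hreg := contDiff_inv_reg hε
    -- the regularised field `V_k = z_k / √(|z|² + ε)`
    let V : Fin 3 → Space → ℝ := fun k y => (y - x) k * (reg ε (y - x))⁻¹
    have hVc : ∀ k, ContDiff ℝ ((⊤ : ℕ∞) : WithTop ℕ∞) (V k) := fun k =>
      ((contDiff_coord k).mul hreg).comp (contDiff_id.sub contDiff_const)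
    have hVd : ∀ k i y, pderiv i (V k) y = (y - x) k * (- (y - x) i / reg ε (y - x) ^ 3)
        + (if i = k then 1 else 0) * (reg ε (y - x))⁻¹ := by
      intro k i y
      have := pderiv_comp_sub (fun z => z k * (reg ε z)⁻¹) x i y
      rw [pderiv_mul ((contDiff_coord k).differentiable (by simp) _)
        (hreg.differentiable (by simp) _), pderiv_inv_reg hε, pderiv_coord] at this
      exact this
    have hV1 : ∀ k y, |V k y| ≤ 1 := by
      intro k y
      have hp := reg_pos hε (y - x)
      rw [abs_mul, abs_inv, abs_of_pos hp, ← div_eq_mul_inv, div_le_one hp]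
      exact abs_coord_le_reg hε _ k
    have hV2 : ∀ k i y, |pderiv i (V k) y| ≤ 2 * (√ε)⁻¹ := by
      intro k i y
      have hp := reg_pos hε (y - x)
      rw [hVd]
      have e1 : |(y - x) k * (- (y - x) i / reg ε (y - x) ^ 3)| ≤ (√ε)⁻¹ := by
        rw [abs_mul, abs_div, abs_neg, abs_of_pos (pow_pos hp 3)]
        calc |(y - x) k| * (|(y - x) i| / reg ε (y - x) ^ 3)
            ≤ reg ε (y - x) * (reg ε (y - x) / reg ε (y - x) ^ 3) := by
              gcongr
              · exact abs_coord_le_reg hε _ k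
              · exact abs_coord_le_reg hε _ i
          _ = (reg ε (y - x))⁻¹ := by field_simp
          _ ≤ _ := inv_reg_le hε _
      have e2 : |(if i = k then (1 : ℝ) else 0) * (reg ε (y - x))⁻¹| ≤ (√ε)⁻¹ := by
        rw [abs_mul, abs_inv, abs_of_pos hp]
        refine le_trans (mul_le_of_le_one_left (inv_nonneg.2 hp.le) ?_) (inv_reg_le hε _)
        split_ifs <;> simp
      exact (abs_add_le _ _).trans (by linarith)
    have hid : ∀ k, ∫ y, pderiv k (V k) y * f y = - ∫ y, V k y * g k y := by
      intro k
      have := (h k).integral_mul_bounded hf (hg k) (hVc k)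
        (C := max 1 (2 * (√ε)⁻¹)) (fun y => (hV1 k y).trans (le_max_left _ _))
        (fun i y => (hV2 k i y).trans (le_max_right _ _))
      linarith
    have hle : ∀ k, ∫ y, pderiv k (V k) y * f y ≤ ∫ y, |g k y| := by
      intro k
      rw [hid k, ← integral_neg]
      refine integral_mono ?_ (hg k).abs ?_
      · exact ((hg k).bdd_mul (hVc k).continuous.aestronglyMeasurable
          (Eventually.of_forall (hV1 k))).neg
      · intro y
        simp only
        refine (neg_le_abs _).trans ?_
        rw [abs_mul]
        exact mul_le_of_le_one_left (abs_nonneg _) (hV1 k y)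
    have hdi : ∀ k, Integrable fun y => pderiv k (V k) y * f y := fun k =>
      hf.bdd_mul (contDiff_pderiv (hVc k) k).continuous.aestronglyMeasurable
        (Eventually.of_forall (hV2 k k))
    have hint : Integrable fun y => f y / reg ε (y - x) := by
      simp only [div_eq_inv_mul]
      refine hf.bdd_mul (c := (√ε)⁻¹) ?_ (Eventually.of_forall fun y => ?_)
      · exact (hreg.comp (contDiff_id.sub contDiff_const)).continuous.aestronglyMeasurable
      · rw [norm_inv, Real.norm_of_nonneg (reg_pos hε _).le]
        exact inv_reg_le hε _
    refine ⟨hint, ?_⟩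
    -- `div V = 3 / √(|z|² + ε) - |z|² / √(|z|² + ε)³ ≥ 2 / √(|z|² + ε)`
    have h2 : ∫ y, 2 * (f y / reg ε (y - x)) ≤ ∫ y, ∑ k, pderiv k (V k) y * f y := by
      refine integral_mono (hint.const_mul 2) (integrable_finsetSum _ fun k _ => hdi k) fun y => ?_
      have hp := reg_pos hε (y - x)
      simp only [← Finset.sum_mul, hVd, Finset.sum_add_distrib, if_true]
      have hsum : ∑ k, (y - x) k * (- (y - x) k / reg ε (y - x) ^ 3)
          = - ‖y - x‖ ^ 2 / reg ε (y - x) ^ 3 := by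
        rw [norm_sq_eq_sum, neg_div, Finset.sum_div, ← Finset.sum_neg_distrib]
        refine Finset.sum_congr rfl fun k _ => ?_
        ring
      rw [hsum]
      simp only [Finset.sum_const, Finset.card_univ, Fintype.card_fin, nsmul_eq_mul]
      have h3 : ‖y - x‖ ^ 2 / reg ε (y - x) ^ 3 ≤ (reg ε (y - x))⁻¹ := by
        rw [inv_eq_one_div, div_le_div_iff₀ (by positivity) hp]
        have := reg_sq hε (y - x)
        have : ‖y - x‖ ^ 2 ≤ reg ε (y - x) ^ 2 := by linarith
        nlinarith
      have h4 : 2 * (f y / reg ε (y - x)) = (2 * (reg ε (y - x))⁻¹) * f y := by ring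
      rw [h4]
      refine mul_le_mul_of_nonneg_right ?_ (hf0 y)
      push_cast
      rw [neg_div]
      linarith
    rw [integral_const_mul, integral_finsetSum _ fun k _ => hdi k] at h2
    have : ∑ k, ∫ y, pderiv k (V k) y * f y ≤ M := Finset.sum_le_sum fun k _ => hle k
    linarith
  refine ⟨hf, M / 2, fun x => ?_⟩
  let ε : ℕ → ℝ := fun n => (n + 1 : ℝ)⁻¹
  have hεpos : ∀ n, 0 < ε n := fun n => by positivity
  have hεlim : Tendsto ε atTop (𝓝 0) :=
    tendsto_inv_atTop_zero.comp (tendsto_atTop_add_const_right _ _ tendsto_natCast_atTop_atTop)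
  have hmeas : AEStronglyMeasurable (fun y => |f y| / ‖x - y‖) volume :=
    (hf.1.norm.aemeasurable.div (by fun_prop)).aestronglyMeasurable
  -- Fatou as the regularisation is removed
  have hlin : ∫⁻ y, ENNReal.ofReal (|f y| / ‖x - y‖) ≤ ENNReal.ofReal (M / 2) := by
    have h1 : ∫⁻ y, ENNReal.ofReal (|f y| / ‖x - y‖)
        = ∫⁻ y, liminf (fun n => ENNReal.ofReal (f y / reg (ε n) (y - x))) atTop := by
      refine lintegral_congr_ae ?_
      filter_upwards [ae_ne x] with y hy
      refine (Tendsto.liminf_eq ?_).symm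
      refine (ENNReal.continuous_ofReal.tendsto _).comp ?_
      rw [abs_of_nonneg (hf0 y), norm_sub_rev]
      exact (tendsto_const_nhds).div (tendsto_reg (y - x) hεlim)
        (norm_ne_zero_iff.2 (sub_ne_zero.2 hy))
    rw [h1]
    refine (lintegral_liminf_le' fun n =>
      ((hε x _ (hεpos n)).1.1.aemeasurable.ennreal_ofReal)).trans ?_
    refine liminf_le_of_frequently_le' (Frequently.of_forall fun n => ?_)
    rw [← ofReal_integral_eq_lintegral_ofReal (hε x _ (hεpos n)).1
      (Eventually.of_forall fun y => div_nonneg (hf0 y) (reg_pos (hεpos n) _).le)]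
    exact ENNReal.ofReal_le_ofReal (hε x _ (hεpos n)).2
  have hnn : ∀ y, 0 ≤ |f y| / ‖x - y‖ := fun y => by positivity
  have hI : Integrable (fun y => |f y| / ‖x - y‖) := by
    refine ⟨hmeas, ?_⟩
    rw [hasFiniteIntegral_iff_ofReal (Eventually.of_forall hnn)]
    exact hlin.trans_lt ENNReal.ofReal_lt_top
  refine ⟨hI, ?_⟩
  have hM0 : 0 ≤ M / 2 := div_nonneg (Finset.sum_nonneg fun k _ =>
    integral_nonneg fun y => abs_nonneg _) (by norm_num)
  rw [← ofReal_integral_eq_lintegral_ofReal hI (Eventually.of_forall hnn)] at hlin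
  exact (ENNReal.ofReal_le_ofReal_iff hM0).1 hlin

theorem BoundedPotential.mono {f h : Space → ℝ} (hf : BoundedPotential f) {C : ℝ}
    (hh : Integrable h) (hle : ∀ x, |h x| ≤ C * |f x|) : BoundedPotential h := by
  obtain ⟨D, hD⟩ := hf.bound
  have hC : ∀ x y, |h y| / ‖x - y‖ ≤ |C| * (|f y| / ‖x - y‖) := fun x y => by
    rw [← mul_div_assoc]
    exact div_le_div_of_nonneg_right
      ((hle y).trans (mul_le_mul_of_nonneg_right (le_abs_self C) (abs_nonneg _))) (norm_nonneg _)
  have hI : ∀ x, Integrable (fun y => |h y| / ‖x - y‖) := fun x => by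
    refine ((hD x).1.const_mul |C|).mono'
      (hh.1.norm.aemeasurable.div (by fun_prop)).aestronglyMeasurable
      (Eventually.of_forall fun y => ?_)
    rw [Real.norm_of_nonneg (by positivity)]
    exact hC x y
  refine ⟨hh, |C| * D, fun x => ⟨hI x, ?_⟩⟩
  refine (integral_mono (hI x) ((hD x).1.const_mul |C|) (hC x)).trans ?_
  rw [integral_const_mul]
  exact mul_le_mul_of_nonneg_left (hD x).2 (abs_nonneg _)

theorem BoundedPotential.add {f h : Space → ℝ} (hf : BoundedPotential f)
    (hh : BoundedPotential h) : BoundedPotential (fun x => f x + h x) := by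
  obtain ⟨C, hC⟩ := hf.bound
  obtain ⟨D, hD⟩ := hh.bound
  have hsum : BoundedPotential (fun x => |f x| + |h x|) := by
    refine ⟨hf.integrable.abs.add hh.integrable.abs, C + D, fun x => ?_⟩
    have e : (fun y => |(|f y| + |h y|)| / ‖x - y‖)
        = fun y => |f y| / ‖x - y‖ + |h y| / ‖x - y‖ := by
      funext y
      rw [abs_of_nonneg (by positivity), add_div]
    rw [e]
    refine ⟨(hC x).1.add (hD x).1, ?_⟩
    rw [integral_add (hC x).1 (hD x).1]
    exact add_le_add (hC x).2 (hD x).2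
  refine hsum.mono (C := 1) (hf.integrable.add hh.integrable) fun x => ?_
  rw [one_mul]
  exact (abs_add_le _ _).trans (le_abs_self _)

theorem IsTest.isWeakPartial {η : Space → ℝ} (h : IsTest η) (j : Fin 3) :
    IsWeakPartial j η (MaxwellDirac.pderiv j η) := by
  refine ⟨h.continuous.locallyIntegrable, (h.pderiv j).continuous.locallyIntegrable,
    fun ζ h1 h2 => ?_⟩
  have hζ : IsTest ζ := ⟨h1, h2⟩
  have := integral_mul_fderiv_eq_neg_fderiv_mul_of_integrable (μ := (volume : Measure Space))
    (f := ζ) (g := η) (v := basisVec j)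
    ((hζ.pderiv j).integrable_mul h.continuous.locallyIntegrable)
    (hζ.integrable_mul (h.pderiv j).continuous.locallyIntegrable)
    (hζ.integrable_mul h.continuous.locallyIntegrable)
    (fun x _ => hζ.differentiable x) (fun x _ => h.differentiable x)
  simp only [smul_eq_mul]
  change _ = - ∫ x, ζ x * fderiv ℝ η x (basisVec j)
  rw [this, neg_neg]

theorem IsTest.boundedPotential {η : Space → ℝ} (h : IsTest η) : BoundedPotential η := by
  obtain ⟨C, hC⟩ := h.bounded
  obtain ⟨R, hR, hsub⟩ := h.compact.isCompact.isBounded.subset_ball_lt 0 0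
  -- a nonnegative test function equal to `1` on the support of `η`
  let b : ContDiffBump (0 : Space) := ⟨R, R + 1, hR, by linarith⟩
  have hb : IsTest (b : Space → ℝ) := ⟨b.contDiff, b.hasCompactSupport⟩
  have hbp : BoundedPotential (b : Space → ℝ) :=
    boundedPotential_of_weakPartial hb.integrable (fun x => b.nonneg)
      (fun k => (hb.pderiv k).integrable) (fun k => hb.isWeakPartial k)
  refine hbp.mono h.integrable (C := C) fun x => ?_
  by_cases hx : x ∈ tsupport η
  · rw [b.one_of_mem_closedBall (Metric.ball_subset_closedBall (hsub hx)), abs_one, mul_one]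
    exact hC x
  · rw [image_eq_zero_of_notMem_tsupport hx, abs_zero]
    exact mul_nonneg ((norm_nonneg _).trans (hC 0)) (abs_nonneg _)

theorem BoundedPotential.integrable_div {f : Space → ℝ} (hf : BoundedPotential f) (x : Space) :
    Integrable (fun y => f y / ‖x - y‖) := by
  obtain ⟨C, hC⟩ := hf.bound
  refine (hC x).1.mono' (hf.integrable.1.aemeasurable.div (by fun_prop)).aestronglyMeasurable
    (Eventually.of_forall fun y => ?_)
  rw [norm_div, norm_norm, Real.norm_eq_abs]

theorem BoundedPotential.abs {f : Space → ℝ} (hf : BoundedPotential f) :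
    BoundedPotential (fun x => |f x|) :=
  hf.mono (C := 1) hf.integrable.abs fun x => by simp

theorem BoundedPotential.newton_bounded {f : Space → ℝ} (hf : BoundedPotential f) :
    ∃ C, ∀ x, |newtonPotential f x| ≤ C := by
  obtain ⟨C, hC⟩ := hf.bound
  refine ⟨C, fun x => ?_⟩
  refine (abs_integral_le_integral_abs).trans ?_
  simpa only [abs_div, abs_norm] using (hC x).2

theorem aestronglyMeasurable_newton_integrand {f : Space → ℝ}
    (hf : AEStronglyMeasurable f volume) :
    AEStronglyMeasurable (fun p : Space × Space => f p.2 / ‖p.1 - p.2‖)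
      (volume.prod volume) :=
  (hf.comp_snd.aemeasurable.div (by fun_prop)).aestronglyMeasurable

theorem aestronglyMeasurable_newton {f : Space → ℝ} (hf : AEStronglyMeasurable f volume) :
    AEStronglyMeasurable (newtonPotential f) volume :=
  (aestronglyMeasurable_newton_integrand hf).integral_prod_right'

theorem BoundedPotential.newton_mul_integrable {f g : Space → ℝ} (hf : BoundedPotential f)
    (hg : Integrable g) : Integrable (fun x => newtonPotential f x * g x) := by
  obtain ⟨C, hC⟩ := hf.newton_bounded
  exact hg.bdd_mul (aestronglyMeasurable_newton hf.integrable.1) (Eventually.of_forall hC)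

theorem BoundedPotential.newton_locallyIntegrable {f : Space → ℝ} (hf : BoundedPotential f) :
    LocallyIntegrable (newtonPotential f) volume := by
  obtain ⟨C, hC⟩ := hf.newton_bounded
  exact (memLp_top_of_bound (aestronglyMeasurable_newton hf.integrable.1) C
    (Eventually.of_forall hC)).locallyIntegrable le_top

/-- The Coulomb integrand `g(x) f(y) / |x - y|` is integrable on the product space. -/
theorem BoundedPotential.integrable_prod {f g : Space → ℝ} (hf : BoundedPotential f)
    (hg : Integrable g) :
    Integrable (fun p : Space × Space => g p.1 * f p.2 / ‖p.1 - p.2‖) (volume.prod volume) := by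
  have hm : AEStronglyMeasurable (fun p : Space × Space => g p.1 * f p.2 / ‖p.1 - p.2‖)
      (volume.prod volume) := by
    simp only [mul_div_assoc]
    exact hg.1.comp_fst.mul (aestronglyMeasurable_newton_integrand hf.integrable.1)
  refine (integrable_prod_iff hm).2 ⟨Eventually.of_forall fun x => ?_, ?_⟩
  · simpa only [mul_div_assoc] using (hf.integrable_div x).const_mul (g x)
  · have e : ∀ x, ∫ y, ‖g x * f y / ‖x - y‖‖ = newtonPotential (fun y => |f y|) x * |g x| := by
      intro x
      simp only [newtonPotential, norm_div, norm_mul, Real.norm_eq_abs, abs_norm, mul_div_assoc]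
      rw [integral_const_mul, mul_comm]
    simp only [e]
    exact hf.abs.newton_mul_integrable hg.abs

theorem BoundedPotential.integral_prod_eq {f g : Space → ℝ} (hf : BoundedPotential f)
    (hg : Integrable g) :
    ∫ p : Space × Space, g p.1 * f p.2 / ‖p.1 - p.2‖ = ∫ x, g x * newtonPotential f x := by
  rw [Measure.volume_eq_prod, integral_prod _ (hf.integrable_prod hg)]
  simp only [mul_div_assoc, integral_const_mul]
  rfl

/-! ### Gaussian integrals -/

theorem integrable_gaussian {b : ℝ} (hb : 0 < b) :
    Integrable fun v : Space => Real.exp (-b * ‖v‖ ^ 2) := by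
  have := (GaussianFourier.integrable_cexp_neg_mul_sq_norm_add (b := (b : ℂ)) (V := Space)
    (by simpa using hb) 0 0).norm
  refine this.congr (Eventually.of_forall fun v => ?_)
  simp only [Complex.norm_exp]
  congr 1
  simp [← Complex.ofReal_pow]

theorem integrable_sq_mul_gaussian {b : ℝ} (hb : 0 < b) (j : Fin 3) :
    Integrable fun v : Space => v j ^ 2 * Real.exp (-b * ‖v‖ ^ 2) := by
  refine ((integrable_gaussian (half_pos hb)).const_mul (2 / b)).mono'
    (by fun_prop) (Eventually.of_forall fun v => ?_)
  rw [Real.norm_of_nonneg (by positivity)]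
  have h1 : v j ^ 2 ≤ ‖v‖ ^ 2 := sq_le_sq' (by linarith [neg_abs_le (v j), abs_coord_le_norm v j])
    ((le_abs_self _).trans (abs_coord_le_norm v j))
  have h2 : b / 2 * ‖v‖ ^ 2 ≤ Real.exp (b / 2 * ‖v‖ ^ 2) := by
    linarith [Real.add_one_le_exp (b / 2 * ‖v‖ ^ 2)]
  have h3 : Real.exp (-(b / 2) * ‖v‖ ^ 2)
      = Real.exp (b / 2 * ‖v‖ ^ 2) * Real.exp (-b * ‖v‖ ^ 2) := by
    rw [← Real.exp_add]
    congr 1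
    ring
  rw [h3, ← mul_assoc]
  refine mul_le_mul_of_nonneg_right ?_ (Real.exp_pos _).le
  calc v j ^ 2 ≤ 2 / b * (b / 2 * ‖v‖ ^ 2) := by
        rw [← mul_assoc, div_mul_div_comm, mul_comm 2 b, div_self (by positivity), one_mul]
        exact h1
    _ ≤ _ := by gcongr

theorem integrable_coord_mul_gaussian {b : ℝ} (hb : 0 < b) (j : Fin 3) :
    Integrable fun v : Space => v j * Real.exp (-b * ‖v‖ ^ 2) := by
  refine ((integrable_gaussian hb).add (integrable_sq_mul_gaussian hb j)).mono'
    (by fun_prop) (Eventually.of_forall fun v => ?_)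
  rw [norm_mul, Real.norm_of_nonneg (Real.exp_pos _).le, Real.norm_eq_abs]
  have h1 : |v j| ≤ 1 + v j ^ 2 := by
    rw [abs_le]
    constructor <;> nlinarith [sq_nonneg (v j - 1), sq_nonneg (v j + 1)]
  have := mul_le_mul_of_nonneg_right h1 (Real.exp_pos (-b * ‖v‖ ^ 2)).le
  simp only [Pi.add_apply]
  linarith

/-- The modulated Gaussian `e^{-b|v|²} e^{-2πi v·z}`. -/
def gaussWave (b : ℝ) (z v : Space) : ℂ :=
  Complex.exp (((-b * ‖v‖ ^ 2 : ℝ) : ℂ) + ((-2 * Real.pi * inner ℝ v z : ℝ) : ℂ) * Complex.I)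

theorem norm_gaussWave (b : ℝ) (z v : Space) : ‖gaussWave b z v‖ = Real.exp (-b * ‖v‖ ^ 2) := by
  rw [gaussWave, Complex.norm_exp]
  simp [-Complex.ofReal_mul, -Complex.ofReal_neg, -Complex.ofReal_pow]

theorem continuous_gaussWave (b : ℝ) (z : Space) : Continuous (gaussWave b z) := by
  unfold gaussWave
  fun_prop

theorem fderiv_gaussWave (b : ℝ) (z : Space) (j : Fin 3) (v : Space) :
    DifferentiableAt ℝ (gaussWave b z) v ∧ fderiv ℝ (gaussWave b z) v (basisVec j)
      = (((-2 * b * v j : ℝ) : ℂ) + ((-2 * Real.pi * z j : ℝ) : ℂ) * Complex.I)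
        * gaussWave b z v := by
  have h1 : HasFDerivAt (fun v : Space => -b * ‖v‖ ^ 2) _ v :=
    ((hasFDerivAt_id v).norm_sq).const_mul (-b)
  have h2 : HasFDerivAt (fun v : Space => -2 * Real.pi * inner ℝ v z) _ v :=
    ((hasFDerivAt_id v).inner ℝ (hasFDerivAt_const z v)).const_mul (-2 * Real.pi)
  have h3 := (Complex.ofRealCLM.hasFDerivAt.comp v h1).add
    ((Complex.ofRealCLM.hasFDerivAt.comp v h2).mul_const Complex.I)
  have h4 : HasFDerivAt (gaussWave b z) _ v := h3.cexp
  refine ⟨h4.differentiableAt, ?_⟩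
  rw [h4.fderiv]
  simp [gaussWave, inner_basisVec, real_inner_comm]
  ring

theorem integral_gaussWave {b : ℝ} (hb : 0 < b) (z : Space) :
    ∫ v, gaussWave b z v
      = (((Real.pi / b) ^ (3 / 2 : ℝ) * Real.exp (-Real.pi ^ 2 * ‖z‖ ^ 2 / b) : ℝ) : ℂ) := by
  have h := fourier_gaussian_innerProductSpace (b := (b : ℂ)) (V := Space) (by simpa using hb) z
  rw [Real.fourier_eq'] at h
  have e : ∀ v : Space, Complex.exp (↑(-2 * Real.pi * inner ℝ v z) * Complex.I) •
      Complex.exp (-(b : ℂ) * (‖v‖ : ℂ) ^ 2) = gaussWave b z v := by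
    intro v
    rw [smul_eq_mul, ← Complex.exp_add, gaussWave, add_comm]
    push_cast
    ring_nf
  simp only [e] at h
  rw [h, finrank_euclideanSpace_fin]
  push_cast
  rw [Complex.ofReal_cpow (by positivity)]
  push_cast
  rfl

theorem integrable_poly_gaussWave {b : ℝ} {z : Space} {c : Space → ℝ} (hc : Continuous c)
    (h : Integrable fun v => c v * Real.exp (-b * ‖v‖ ^ 2)) :
    Integrable fun v => (c v : ℂ) * gaussWave b z v := by
  refine h.norm.mono' ?_ (Eventually.of_forall fun v => ?_)
  · exact ((Complex.continuous_ofReal.comp hc).mul (continuous_gaussWave b z)).aestronglyMeasurable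
  · rw [norm_mul, norm_mul, norm_gaussWave, Complex.norm_real,
      Real.norm_of_nonneg (Real.exp_pos _).le]

/-- The Fourier transform of `ξ_j² e^{-b|ξ|²}`. -/
theorem integral_sq_mul_gaussWave {b : ℝ} (hb : 0 < b) (z : Space) (j : Fin 3) :
    ∫ v, ((v j ^ 2 : ℝ) : ℂ) * gaussWave b z v
      = (((1 - 2 * Real.pi ^ 2 * z j ^ 2 / b) / (2 * b) *
        ((Real.pi / b) ^ (3 / 2 : ℝ) * Real.exp (-Real.pi ^ 2 * ‖z‖ ^ 2 / b)) : ℝ) : ℂ) := by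
  have i0 : Integrable fun v => gaussWave b z v := by
    simpa using integrable_poly_gaussWave (c := fun _ => 1) (z := z) continuous_const
      (by simpa using integrable_gaussian hb)
  have i1 : Integrable fun v : Space => ((v j : ℝ) : ℂ) * gaussWave b z v :=
    integrable_poly_gaussWave (by fun_prop) (integrable_coord_mul_gaussian hb j)
  have i2 : Integrable fun v : Space => ((v j ^ 2 : ℝ) : ℂ) * gaussWave b z v :=
    integrable_poly_gaussWave (by fun_prop) (integrable_sq_mul_gaussian hb j)
  have hd := fderiv_gaussWave b z j
  have hcd : ∀ v : Space, HasFDerivAt (fun v : Space => ((v j : ℝ) : ℂ))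
      (Complex.ofRealCLM.comp (EuclideanSpace.proj (𝕜 := ℝ) j : Space →L[ℝ] ℝ)) v := fun v =>
    Complex.ofRealCLM.hasFDerivAt.comp v
      (EuclideanSpace.proj (𝕜 := ℝ) j : Space →L[ℝ] ℝ).hasFDerivAt
  have hcd' : ∀ v : Space, fderiv ℝ (fun v : Space => ((v j : ℝ) : ℂ)) v (basisVec j) = 1 := by
    intro v
    rw [(hcd v).fderiv]
    simp [basisVec]
  -- integrate `∂_j` of the wave, and of `v_j` times the wave
  have p0 := integral_mul_fderiv_eq_neg_fderiv_mul_of_integrable (μ := (volume : Measure Space))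
    (f := fun _ => (1 : ℂ)) (g := gaussWave b z) (v := basisVec j) (by simp)
    (by
      simp only [(hd _).2, one_mul]
      refine ((i1.const_mul ((-2 * b : ℝ) : ℂ)).add
        (i0.const_mul (((-2 * Real.pi * z j : ℝ) : ℂ) * Complex.I))).congr
        (Eventually.of_forall fun v => ?_)
      simp
      ring) (by simpa using i0) (by simp) (fun v _ => (hd v).1)
  have p1 := integral_mul_fderiv_eq_neg_fderiv_mul_of_integrable (μ := (volume : Measure Space))
    (f := fun v : Space => ((v j : ℝ) : ℂ)) (g := gaussWave b z) (v := basisVec j)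
    (by simpa only [hcd', one_mul] using i0)
    (by
      simp only [(hd _).2]
      refine ((i2.const_mul ((-2 * b : ℝ) : ℂ)).add
        (i1.const_mul (((-2 * Real.pi * z j : ℝ) : ℂ) * Complex.I))).congr
        (Eventually.of_forall fun v => ?_)
      simp
      ring) i1 (fun v _ => (hcd v).differentiableAt) (fun v _ => (hd v).1)
  have e0 : ∀ v : Space, (1 : ℂ) * fderiv ℝ (gaussWave b z) v (basisVec j)
      = ((-2 * b : ℝ) : ℂ) * (((v j : ℝ) : ℂ) * gaussWave b z v)
        + (((-2 * Real.pi * z j : ℝ) : ℂ) * Complex.I) * gaussWave b z v := fun v => by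
    rw [(hd v).2]
    push_cast
    ring
  have e1 : ∀ v : Space, ((v j : ℝ) : ℂ) * fderiv ℝ (gaussWave b z) v (basisVec j)
      = ((-2 * b : ℝ) : ℂ) * (((v j ^ 2 : ℝ) : ℂ) * gaussWave b z v)
        + (((-2 * Real.pi * z j : ℝ) : ℂ) * Complex.I) * (((v j : ℝ) : ℂ) * gaussWave b z v) :=
      fun v => by
    rw [(hd v).2]
    push_cast
    ring
  simp only [e0] at p0
  simp only [e1, hcd', one_mul] at p1
  rw [integral_add (i1.const_mul _) (i0.const_mul _), integral_const_mul, integral_const_mul] at p0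
  rw [integral_add (i2.const_mul _) (i1.const_mul _), integral_const_mul, integral_const_mul] at p1
  simp only [fderiv_fun_const, Pi.zero_apply, zero_apply, zero_mul,
    integral_zero, neg_zero] at p0
  rw [integral_gaussWave hb] at p0 p1
  set M0 : ℝ := (Real.pi / b) ^ (3 / 2 : ℝ) * Real.exp (-Real.pi ^ 2 * ‖z‖ ^ 2 / b)
  set M1 := ∫ v : Space, ((v j : ℝ) : ℂ) * gaussWave b z v
  set M2 := ∫ v : Space, ((v j ^ 2 : ℝ) : ℂ) * gaussWave b z v
  have hb' : (b : ℂ) ≠ 0 := by exact_mod_cast hb.ne'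
  push_cast at p0 p1 ⊢
  have hM1 : M1 = -(Real.pi * z j * Complex.I) / b * M0 := by
    field_simp
    linear_combination (-1 / 2 : ℂ) * p0
  rw [hM1] at p1
  have hM2 : 2 * b * M2 = M0 + (-2 * Real.pi * z j * Complex.I) *
      (-(Real.pi * z j * Complex.I) / b * M0) := by
    linear_combination -p1
  have hI : Complex.I * Complex.I = -1 := Complex.I_mul_I
  have hM3 : 2 * b * M2 = (1 - 2 * Real.pi ^ 2 * (z j) ^ 2 / b) * M0 := by
    rw [hM2]
    field_simp
    linear_combination (2 * (Real.pi : ℂ) ^ 2 * (z j : ℂ) ^ 2 * M0) * hI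
  field_simp at hM3 ⊢
  linear_combination hM3

/-! ### The subordination integrals -/

/-- The Gamma integral after the substitution `t = 1 / u`. -/
theorem integral_rpow_neg_mul_exp {s c : ℝ} (hs : 0 < s) (hc : 0 < c) :
    IntegrableOn (fun u : ℝ => u ^ (-s - 1) * Real.exp (-c / u)) (Set.Ioi 0) ∧
    ∫ u in Set.Ioi (0 : ℝ), u ^ (-s - 1) * Real.exp (-c / u) = (1 / c) ^ s * Real.Gamma s := by
  have hg : IntegrableOn (fun t : ℝ => t ^ (s - 1) * Real.exp (-(c * t))) (Set.Ioi 0) := by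
    have := integrableOn_rpow_mul_exp_neg_mul_rpow (p := 1) (s := s - 1) (b := c)
      (by linarith) (by norm_num) hc
    refine this.congr_fun (fun t _ => ?_) measurableSet_Ioi
    simp
  have e : ∀ u ∈ Set.Ioi (0 : ℝ), (|(-1 : ℝ)| * u ^ (-1 - 1 : ℝ)) •
      ((u ^ (-1 : ℝ)) ^ (s - 1) * Real.exp (-(c * u ^ (-1 : ℝ))))
      = u ^ (-s - 1) * Real.exp (-c / u) := by
    intro u hu
    have hu : 0 < u := hu
    rw [abs_neg, abs_one, one_mul, smul_eq_mul, ← mul_assoc, ← Real.rpow_mul hu.le,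
      ← Real.rpow_add hu, Real.rpow_neg_one]
    congr 2 <;> ring
  constructor
  · have := (integrableOn_Ioi_comp_rpow_iff (fun t : ℝ => t ^ (s - 1) * Real.exp (-(c * t)))
      (p := -1) (by norm_num)).2 hg
    exact this.congr_fun e measurableSet_Ioi
  · rw [← setIntegral_congr_fun measurableSet_Ioi e, integral_comp_rpow_Ioi
      (fun t : ℝ => t ^ (s - 1) * Real.exp (-(c * t))) (p := -1) (by norm_num),
      Real.integral_rpow_mul_exp_neg_mul_Ioi hs hc]

/-- `∫₀^∞ u^{-3/2} e^{-πr²/u} du = 1/r`. -/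
theorem integral_subordination_one {r : ℝ} (hr : 0 < r) :
    IntegrableOn (fun u : ℝ => u ^ (-3 / 2 : ℝ) * Real.exp (-(Real.pi * r ^ 2) / u)) (Set.Ioi 0) ∧
    ∫ u in Set.Ioi (0 : ℝ), u ^ (-3 / 2 : ℝ) * Real.exp (-(Real.pi * r ^ 2) / u) = 1 / r := by
  have h := integral_rpow_neg_mul_exp (s := 1 / 2) (c := Real.pi * r ^ 2) (by norm_num)
    (by positivity)
  norm_num at h ⊢
  refine ⟨h.1, ?_⟩
  rw [h.2, Real.Gamma_one_half_eq, Real.mul_rpow (by positivity) (by positivity),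
    ← Real.sqrt_eq_rpow, ← Real.sqrt_eq_rpow, Real.sqrt_inv, Real.sqrt_inv,
    Real.sqrt_sq hr.le]
  have : 0 < √Real.pi := Real.sqrt_pos.2 Real.pi_pos
  field_simp

/-- `∫₀^∞ u^{-5/2} e^{-πr²/u} du = 1/(2πr³)`. -/
theorem integral_subordination_three {r : ℝ} (hr : 0 < r) :
    IntegrableOn (fun u : ℝ => u ^ (-5 / 2 : ℝ) * Real.exp (-(Real.pi * r ^ 2) / u)) (Set.Ioi 0) ∧
    ∫ u in Set.Ioi (0 : ℝ), u ^ (-5 / 2 : ℝ) * Real.exp (-(Real.pi * r ^ 2) / u)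
      = 1 / (2 * Real.pi * r ^ 3) := by
  have h := integral_rpow_neg_mul_exp (s := 3 / 2) (c := Real.pi * r ^ 2) (by norm_num)
    (by positivity)
  have hG : Real.Gamma (3 / 2) = 1 / 2 * √Real.pi := by
    rw [show (3 / 2 : ℝ) = 1 / 2 + 1 by norm_num, Real.Gamma_add_one (by norm_num),
      Real.Gamma_one_half_eq]
  rw [show (-(3 / 2) - 1 : ℝ) = -5 / 2 by norm_num] at h
  refine ⟨h.1, ?_⟩
  have h32 : ∀ a : ℝ, 0 < a → a ^ (3 / 2 : ℝ) = a * √a := fun a ha => by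
    rw [show (3 / 2 : ℝ) = 1 + 1 / 2 by norm_num, Real.rpow_add ha, Real.rpow_one,
      Real.sqrt_eq_rpow]
  rw [h.2, hG, h32 _ (by positivity), Real.sqrt_div (by norm_num),
    Real.sqrt_mul Real.pi_pos.le, Real.sqrt_sq hr.le, Real.sqrt_one]
  have : 0 < √Real.pi := Real.sqrt_pos.2 Real.pi_pos
  field_simp

/-! ### The Coulomb energy in Fourier variables -/

/-- The Fourier transform `∫ e^{-2πi x·ξ} f(x) dx` of a real function. -/
def fhat (f : Space → ℝ) (ξ : Space) : ℂ := 𝓕 (fun x => (f x : ℂ)) ξ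

theorem fhat_eq (f : Space → ℝ) (ξ : Space) :
    fhat f ξ = ∫ v, Complex.exp (↑(-2 * Real.pi * inner ℝ v ξ) * Complex.I) * (f v : ℂ) := by
  simp only [fhat, Real.fourier_eq', smul_eq_mul]

theorem continuous_fhat {f : Space → ℝ} (hf : Integrable f) : Continuous (fhat f) :=
  VectorFourier.fourierIntegral_continuous Real.continuous_fourierChar
    (innerSL ℝ).continuous₂ hf.ofReal

theorem fhat_add {f g : Space → ℝ} (hf : Integrable f) (hg : Integrable g) (ξ : Space) :
    fhat (fun x => f x + g x) ξ = fhat f ξ + fhat g ξ := by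
  have hb : ∀ {f : Space → ℝ}, Integrable f → Integrable fun v =>
      Complex.exp (↑(-2 * Real.pi * inner ℝ v ξ) * Complex.I) * (f v : ℂ) := fun hf =>
    hf.ofReal.bdd_mul (c := 1) (by fun_prop) (Eventually.of_forall fun v => by
      rw [Complex.norm_exp_ofReal_mul_I])
  simp only [fhat_eq]
  rw [← integral_add (hb hf) (hb hg)]
  congr 1
  funext v
  push_cast
  ring

theorem conj_fhat (f : Space → ℝ) (ξ : Space) :
    (starRingEnd ℂ) (fhat f ξ) = fhat f (-ξ) := by
  simp only [fhat_eq]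
  rw [← integral_conj]
  congr 1
  funext v
  rw [map_mul, ← Complex.exp_conj, Complex.conj_ofReal, map_mul, Complex.conj_ofReal,
    Complex.conj_I, inner_neg_right]
  congr 2
  push_cast
  ring

theorem norm_sq_fhat {f : Space → ℝ} (ξ : Space) :
    ((‖fhat f ξ‖ ^ 2 : ℝ) : ℂ) = ∫ p : Space × Space, ((f p.1 * f p.2 : ℝ) : ℂ) *
      Complex.exp (((-2 * Real.pi * inner ℝ ξ (p.1 - p.2) : ℝ) : ℂ) * Complex.I) := by
  have h1 : ((‖fhat f ξ‖ ^ 2 : ℝ) : ℂ) = fhat f ξ * fhat f (-ξ) := by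
    rw [← conj_fhat, Complex.mul_conj, Complex.normSq_eq_norm_sq]
  rw [h1, fhat_eq, fhat_eq, ← integral_prod_mul, ← Measure.volume_eq_prod]
  congr 1
  funext p
  have : Complex.exp (((-2 * Real.pi * inner ℝ ξ (p.1 - p.2) : ℝ) : ℂ) * Complex.I)
      = Complex.exp (↑(-2 * Real.pi * inner ℝ p.1 ξ) * Complex.I)
        * Complex.exp (↑(-2 * Real.pi * inner ℝ p.2 (-ξ)) * Complex.I) := by
    rw [← Complex.exp_add, inner_sub_right, inner_neg_right, real_inner_comm, real_inner_comm p.2]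
    congr 1
    push_cast
    ring
  rw [this]
  push_cast
  ring

/-- The Fourier side of the energy, regularised by a Gaussian. -/
theorem integral_gaussian_norm_sq_fhat {f : Space → ℝ} (hf : Integrable f) {b : ℝ} (hb : 0 < b)
    (j : Fin 3) :
    ∫ ξ : Space, ξ j ^ 2 * Real.exp (-b * ‖ξ‖ ^ 2) * ‖fhat f ξ‖ ^ 2
      = ∫ p : Space × Space, f p.1 * f p.2 *
        ((1 - 2 * Real.pi ^ 2 * (p.1 - p.2) j ^ 2 / b) / (2 * b) *
        ((Real.pi / b) ^ (3 / 2 : ℝ) * Real.exp (-Real.pi ^ 2 * ‖p.1 - p.2‖ ^ 2 / b))) := by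
  have hw := integrable_sq_mul_gaussian hb j
  have hff : Integrable (fun p : Space × Space => f p.1 * f p.2) (volume.prod volume) :=
    hf.mul_prod hf
  let G : Space → Space × Space → ℂ := fun ξ p =>
    ((f p.1 * f p.2 : ℝ) : ℂ) * (((ξ j ^ 2 : ℝ) : ℂ) * gaussWave b (p.1 - p.2) ξ)
  have hG : Integrable (Function.uncurry G) (volume.prod (volume.prod volume)) := by
    refine (hw.mul_prod hff).norm.mono' ?_ (Eventually.of_forall fun q => ?_)
    · refine AEStronglyMeasurable.mul ?_ ?_
      · exact Complex.continuous_ofReal.comp_aestronglyMeasurable hff.1.comp_snd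
      · refine Continuous.aestronglyMeasurable ?_
        unfold gaussWave
        fun_prop
    · simp only [Function.uncurry, G, norm_mul, norm_gaussWave, Complex.norm_real]
      rw [Real.norm_of_nonneg (Real.exp_pos _).le]
      exact le_of_eq (by ring)
  have hsw := integral_integral_swap hG
  have e1 : ∀ ξ, ∫ p, G ξ p ∂(volume.prod volume)
      = ((ξ j ^ 2 * Real.exp (-b * ‖ξ‖ ^ 2) * ‖fhat f ξ‖ ^ 2 : ℝ) : ℂ) := by
    intro ξ
    rw [Complex.ofReal_mul, norm_sq_fhat, ← integral_const_mul, ← Measure.volume_eq_prod]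
    congr 1
    funext p
    simp only [G, gaussWave, Complex.exp_add, ← Complex.ofReal_exp]
    push_cast
    ring
  have e2 : ∀ p : Space × Space, ∫ ξ, G ξ p = ((f p.1 * f p.2 *
        ((1 - 2 * Real.pi ^ 2 * (p.1 - p.2) j ^ 2 / b) / (2 * b) *
        ((Real.pi / b) ^ (3 / 2 : ℝ) *
          Real.exp (-Real.pi ^ 2 * ‖p.1 - p.2‖ ^ 2 / b))) : ℝ) : ℂ) := by
    intro p
    simp only [G]
    rw [integral_const_mul, integral_sq_mul_gaussWave hb, ← Complex.ofReal_mul]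
  simp only [e1, e2] at hsw
  rw [integral_complex_ofReal, integral_complex_ofReal] at hsw
  exact_mod_cast hsw

/-- The hypothesis of Fubini's theorem for a subordination `K(p) = ∫₀^∞ κ(u, p) du` with nonnegative
kernel, integrated against a weight `w` for which `w K` is integrable. -/
theorem fubini_subordination {P : Type*} [MeasurableSpace P] {μ : Measure P} [SFinite μ]
    {κ : ℝ → P → ℝ} {w K : P → ℝ}
    (hκm : Measurable (Function.uncurry κ)) (hw : AEStronglyMeasurable w μ)
    (hκ0 : ∀ u, 0 < u → ∀ p, 0 ≤ κ u p)
    (hκ : ∀ᵐ p ∂μ, IntegrableOn (fun u => κ u p) (Set.Ioi 0) ∧ ∫ u in Set.Ioi 0, κ u p = K p)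
    (hK : Integrable (fun p => w p * K p) μ) :
    Integrable (fun q : ℝ × P => w q.2 * κ q.1 q.2) ((volume.restrict (Set.Ioi 0)).prod μ) := by
  have hm : AEStronglyMeasurable (fun q : ℝ × P => w q.2 * κ q.1 q.2)
      ((volume.restrict (Set.Ioi 0)).prod μ) :=
    hw.comp_snd.mul hκm.aestronglyMeasurable
  refine (integrable_prod_iff' hm).2 ⟨?_, ?_⟩
  · filter_upwards [hκ] with p hp
    exact hp.1.const_mul (w p)
  · refine hK.norm.congr ?_
    filter_upwards [hκ] with p hp
    have e : ∫ u in Set.Ioi 0, ‖w p * κ u p‖ = ∫ u in Set.Ioi 0, ‖w p‖ * κ u p :=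
      setIntegral_congr_fun measurableSet_Ioi fun u hu => by
        simp only [norm_mul]
        rw [Real.norm_of_nonneg (hκ0 u hu p)]
    rw [e, integral_const_mul, hp.2, norm_mul]
    have : 0 ≤ K p := by
      rw [← hp.2]
      exact setIntegral_nonneg measurableSet_Ioi fun u hu => hκ0 u hu p
    rw [Real.norm_of_nonneg this]

/-- The Coulomb self-energy `∬ f(x) f(y) / |x - y|`. -/
def coulomb (f : Space → ℝ) : ℝ := ∫ p : Space × Space, f p.1 * f p.2 / ‖p.1 - p.2‖

/-- The directional energy `∬ f(x) f(y) (x_j - y_j)² / |x - y|³`. -/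
def dirCoulomb (j : Fin 3) (f : Space → ℝ) : ℝ :=
  ∫ p : Space × Space, f p.1 * f p.2 * ((p.1 - p.2) j ^ 2 / ‖p.1 - p.2‖ ^ 3)

theorem ae_fst_ne_snd : ∀ᵐ p : Space × Space ∂(volume.prod volume), 0 < ‖p.1 - p.2‖ := by
  have hs : MeasurableSet {p : Space × Space | ¬ 0 < ‖p.1 - p.2‖} :=
    (measurableSet_lt measurable_const
      (measurable_fst.sub measurable_snd).norm).compl
  rw [ae_iff, Measure.measure_prod_null hs]
  refine Eventually.of_forall fun x => ?_
  have : (Prod.mk x ⁻¹' {p : Space × Space | ¬ 0 < ‖p.1 - p.2‖}) = {x} := by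
    ext y
    simp [sub_eq_zero, eq_comm]
  simp only [this]
  simp

theorem BoundedPotential.integrable_dir {f : Space → ℝ} (hf : BoundedPotential f) (j : Fin 3) :
    Integrable (fun p : Space × Space => f p.1 * f p.2 * ((p.1 - p.2) j ^ 2 / ‖p.1 - p.2‖ ^ 3))
      (volume.prod volume) := by
  refine (hf.integrable_prod hf.integrable).norm.mono' ?_ ?_
  · exact (hf.integrable.mul_prod hf.integrable).1.mul (by fun_prop : Measurable
      fun p : Space × Space => (p.1 - p.2) j ^ 2 / ‖p.1 - p.2‖ ^ 3).aestronglyMeasurable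
  · filter_upwards [ae_fst_ne_snd] with p hp
    rw [norm_mul, norm_div _ ‖p.1 - p.2‖, norm_norm, div_eq_mul_inv _ ‖p.1 - p.2‖]
    refine mul_le_mul_of_nonneg_left ?_ (norm_nonneg _)
    rw [Real.norm_of_nonneg (by positivity), div_le_iff₀ (by positivity)]
    have h1 : (p.1 - p.2) j ^ 2 ≤ ‖p.1 - p.2‖ ^ 2 :=
      sq_le_sq' (by linarith [neg_abs_le ((p.1 - p.2) j), abs_coord_le_norm (p.1 - p.2) j])
        ((le_abs_self _).trans (abs_coord_le_norm _ j))
    refine h1.trans (le_of_eq ?_)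
    field_simp

/-- The directional Coulomb energy in Fourier variables. Both sides are integrals over `u ∈ (0, ∞)`
of a Gaussian identity with parameter `b = πu`: on the Fourier side
`1/|ξ|⁴ = π² ∫ u e^{-πu|ξ|²} du`, on the physical side the powers `1/|x-y|` and `1/|x-y|³` are
subordinated. This makes every exchange of integrals absolutely convergent, although `f` need not be
in `L²`. -/
theorem BoundedPotential.directional_energy {f : Space → ℝ} (hf : BoundedPotential f)
    (j : Fin 3) :
    Integrable (fun ξ : Space => ξ j ^ 2 * ‖fhat f ξ‖ ^ 2 / ‖ξ‖ ^ 4) ∧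
    ∫ ξ : Space, ξ j ^ 2 * ‖fhat f ξ‖ ^ 2 / ‖ξ‖ ^ 4
      = Real.pi / 2 * (coulomb f - dirCoulomb j f) := by
  have hfi := hf.integrable
  have hff : Integrable (fun p : Space × Space => f p.1 * f p.2) (volume.prod volume) :=
    hfi.mul_prod hfi
  have hpi := Real.pi_pos
  -- the physical side: kernels subordinating `1/|x-y|` and `(x_j-y_j)²/|x-y|³`
  let κ₁ : ℝ → Space × Space → ℝ := fun u p =>
    u ^ (-3 / 2 : ℝ) * Real.exp (-(Real.pi * ‖p.1 - p.2‖ ^ 2) / u)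
  let κ₃ : ℝ → Space × Space → ℝ := fun u p => 2 * Real.pi * (p.1 - p.2) j ^ 2 *
    (u ^ (-5 / 2 : ℝ) * Real.exp (-(Real.pi * ‖p.1 - p.2‖ ^ 2) / u))
  have I₁ : Integrable (fun q : ℝ × (Space × Space) => (f q.2.1 * f q.2.2) * κ₁ q.1 q.2)
      ((volume.restrict (Set.Ioi 0)).prod (volume.prod volume)) := by
    refine fubini_subordination (K := fun p => 1 / ‖p.1 - p.2‖) ?_ hff.1 ?_ ?_ ?_
    · simp only [Function.uncurry_def, κ₁]
      fun_prop
    · intro u hu p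
      positivity
    · filter_upwards [ae_fst_ne_snd] with p hp
      exact integral_subordination_one hp
    · simpa only [mul_one_div] using hf.integrable_prod hfi
  have I₃ : Integrable (fun q : ℝ × (Space × Space) => (f q.2.1 * f q.2.2) * κ₃ q.1 q.2)
      ((volume.restrict (Set.Ioi 0)).prod (volume.prod volume)) := by
    refine fubini_subordination (K := fun p => (p.1 - p.2) j ^ 2 / ‖p.1 - p.2‖ ^ 3) ?_ hff.1 ?_ ?_ ?_
    · simp only [Function.uncurry_def, κ₃]
      fun_prop
    · intro u hu p
      positivity
    · filter_upwards [ae_fst_ne_snd] with p hp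
      have := integral_subordination_three hp
      refine ⟨this.1.const_mul _, ?_⟩
      simp only [κ₃]
      rw [integral_const_mul, this.2]
      field_simp
    · exact hf.integrable_dir j
  have hphys : ∀ u, 0 < u → u * ∫ ξ : Space, ξ j ^ 2 * Real.exp (-(Real.pi * u) * ‖ξ‖ ^ 2)
      * ‖fhat f ξ‖ ^ 2 = ∫ p : Space × Space, (2 * Real.pi)⁻¹ *
        ((f p.1 * f p.2) * κ₁ u p - (f p.1 * f p.2) * κ₃ u p) := by
    intro u hu
    rw [integral_gaussian_norm_sq_fhat hfi (by positivity), ← integral_const_mul]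
    congr 1
    funext p
    have h1 : (Real.pi / (Real.pi * u)) ^ (3 / 2 : ℝ) = u ^ (-3 / 2 : ℝ) := by
      rw [div_mul_eq_div_div, div_self hpi.ne', one_div, Real.inv_rpow hu.le, ← Real.rpow_neg hu.le]
      norm_num
    have h2 : -Real.pi ^ 2 * ‖p.1 - p.2‖ ^ 2 / (Real.pi * u)
        = -(Real.pi * ‖p.1 - p.2‖ ^ 2) / u := by
      field_simp
    have h3 : u ^ (-5 / 2 : ℝ) = u ^ (-3 / 2 : ℝ) / u := by
      rw [← Real.rpow_sub_one hu.ne']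
      norm_num
    simp only [κ₁, κ₃]
    rw [h1, h2, h3]
    field_simp
  have I₁₃ := ((I₁.sub I₃).const_mul (2 * Real.pi)⁻¹)
  have hu_int := I₁₃.integral_prod_left
  have hu_eq := integral_integral_swap (f := fun u p => (2 * Real.pi)⁻¹ *
        ((f p.1 * f p.2) * κ₁ u p - (f p.1 * f p.2) * κ₃ u p)) I₁₃
  -- the Fourier side: a nonnegative integrand, whose integrability follows from the physical side
  let H : ℝ → Space → ℝ := fun u ξ =>
    u * (ξ j ^ 2 * Real.exp (-(Real.pi * u) * ‖ξ‖ ^ 2) * ‖fhat f ξ‖ ^ 2)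
  have hfc := continuous_fhat hfi
  have hbd : ∃ C, ∀ ξ, ‖fhat f ξ‖ ≤ C := ⟨∫ x, ‖(f x : ℂ)‖, fun ξ =>
    VectorFourier.norm_fourierIntegral_le_integral_norm _ _ _ _ ξ⟩
  have hHu : ∀ u, 0 < u → Integrable (H u) := by
    intro u hu
    obtain ⟨C, hC⟩ := hbd
    refine Integrable.const_mul ?_ u
    refine (integrable_sq_mul_gaussian (b := Real.pi * u) (by positivity) j).mul_bdd (c := C ^ 2)
      (by fun_prop) (Eventually.of_forall fun ξ => ?_)
    rw [Real.norm_of_nonneg (by positivity)]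
    exact pow_le_pow_left₀ (norm_nonneg _) (hC ξ) 2
  have hH0 : ∀ u, 0 < u → ∀ ξ, 0 ≤ H u ξ := fun u hu ξ => by
    simp only [H]
    positivity
  have hHint : ∀ u, 0 < u → ∫ ξ, H u ξ = ∫ p : Space × Space, (2 * Real.pi)⁻¹ *
        ((f p.1 * f p.2) * κ₁ u p - (f p.1 * f p.2) * κ₃ u p) := fun u hu => by
    rw [← hphys u hu, ← integral_const_mul]
  have hH : Integrable (Function.uncurry H) ((volume.restrict (Set.Ioi 0)).prod volume) := by
    have hm : AEStronglyMeasurable (Function.uncurry H)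
        ((volume.restrict (Set.Ioi 0)).prod volume) := by
      refine Continuous.aestronglyMeasurable ?_
      simp only [Function.uncurry_def, H]
      fun_prop
    refine (integrable_prod_iff hm).2 ⟨?_, ?_⟩
    · exact (ae_restrict_mem measurableSet_Ioi).mono fun u hu => hHu u hu
    · refine hu_int.congr ((ae_restrict_mem measurableSet_Ioi).mono fun u hu => ?_)
      have e : ∫ ξ, ‖Function.uncurry H (u, ξ)‖ = ∫ ξ, H u ξ := by
        congr 1
        funext ξ
        exact Real.norm_of_nonneg (hH0 u hu ξ)
      simp only
      rw [e, hHint u hu]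
      rfl
  have hξ : ∀ ξ : Space, ξ ≠ 0 → ∫ u in Set.Ioi 0, H u ξ
      = (Real.pi ^ 2)⁻¹ * (ξ j ^ 2 * ‖fhat f ξ‖ ^ 2 / ‖ξ‖ ^ 4) := by
    intro ξ h0
    have hn : 0 < ‖ξ‖ := norm_pos_iff.2 h0
    have h1 := Real.integral_rpow_mul_exp_neg_mul_Ioi (a := 2) (r := Real.pi * ‖ξ‖ ^ 2)
      (by norm_num) (by positivity)
    have e : ∀ u ∈ Set.Ioi (0 : ℝ), H u ξ = (ξ j ^ 2 * ‖fhat f ξ‖ ^ 2) *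
        (u ^ (2 - 1 : ℝ) * Real.exp (-(Real.pi * ‖ξ‖ ^ 2 * u))) := by
      intro u hu
      rw [show (2 - 1 : ℝ) = 1 by norm_num, Real.rpow_one]
      simp only [H]
      ring_nf
    rw [setIntegral_congr_fun measurableSet_Ioi e, integral_const_mul, h1, Real.Gamma_two,
      Real.rpow_two]
    field_simp
  have hae : (fun ξ => ∫ u in Set.Ioi 0, H u ξ) =ᵐ[volume]
      fun ξ => (Real.pi ^ 2)⁻¹ * (ξ j ^ 2 * ‖fhat f ξ‖ ^ 2 / ‖ξ‖ ^ 4) := by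
    filter_upwards [ae_ne 0] with ξ h0
    exact hξ ξ h0
  have hpi2 : (Real.pi ^ 2)⁻¹ ≠ 0 := by positivity
  refine ⟨?_, ?_⟩
  · have h1 : Integrable fun ξ => ∫ u in Set.Ioi 0, H u ξ := hH.integral_prod_right
    have h2 := (h1.congr hae).const_mul (Real.pi ^ 2)
    refine h2.congr (Eventually.of_forall fun ξ => ?_)
    simp only
    field_simp
  · have hsw := integral_integral_swap hH
    rw [integral_congr_ae hae, integral_const_mul] at hsw
    have hL : ∫ u in Set.Ioi 0, ∫ ξ, H u ξ
        = ∫ u in Set.Ioi 0, ∫ p : Space × Space, (2 * Real.pi)⁻¹ *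
        ((f p.1 * f p.2) * κ₁ u p - (f p.1 * f p.2) * κ₃ u p) :=
      setIntegral_congr_fun measurableSet_Ioi fun u hu => hHint u hu
    rw [hL] at hsw
    rw [Measure.volume_eq_prod, hu_eq] at hsw
    have hfin : ∫ p : Space × Space, (∫ u in Set.Ioi (0 : ℝ), (2 * Real.pi)⁻¹ *
        ((f p.1 * f p.2) * κ₁ u p - (f p.1 * f p.2) * κ₃ u p)) ∂(volume.prod volume)
        = (2 * Real.pi)⁻¹ * (coulomb f - dirCoulomb j f) := by
      have hp : ∀ᵐ p : Space × Space ∂(volume.prod volume), ∫ u in Set.Ioi (0 : ℝ),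
          (2 * Real.pi)⁻¹ * ((f p.1 * f p.2) * κ₁ u p - (f p.1 * f p.2) * κ₃ u p)
          = (2 * Real.pi)⁻¹ * (f p.1 * f p.2 / ‖p.1 - p.2‖
            - f p.1 * f p.2 * ((p.1 - p.2) j ^ 2 / ‖p.1 - p.2‖ ^ 3)) := by
        filter_upwards [ae_fst_ne_snd] with p hp
        have h1 := integral_subordination_one hp
        have h3 := integral_subordination_three hp
        rw [integral_const_mul, integral_sub (h1.1.const_mul _) ((h3.1.const_mul _).const_mul _)]
        rw [integral_const_mul, integral_const_mul, integral_const_mul, h1.2, h3.2]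
        field_simp
      rw [integral_congr_ae hp, integral_const_mul,
        integral_sub (hf.integrable_prod hfi) (hf.integrable_dir j)]
      rfl
    rw [hfin] at hsw
    field_simp at hsw ⊢
    linarith

theorem sum_coord_sq_div (z : Space) (a : ℝ) : ∑ j, z j ^ 2 * a / ‖z‖ ^ 4 = a / ‖z‖ ^ 2 := by
  rw [← Finset.sum_div, ← Finset.sum_mul, ← norm_sq_eq_sum]
  rcases eq_or_ne z 0 with rfl | hz
  · simp
  · have : 0 < ‖z‖ := norm_pos_iff.2 hz
    field_simp

theorem BoundedPotential.sum_dirCoulomb {f : Space → ℝ} (hf : BoundedPotential f) :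
    ∑ j, dirCoulomb j f = coulomb f := by
  simp only [dirCoulomb, coulomb, Measure.volume_eq_prod]
  rw [← integral_finsetSum _ fun j _ => hf.integrable_dir j]
  refine integral_congr_ae ?_
  filter_upwards [ae_fst_ne_snd] with p hp
  rw [← Finset.mul_sum, ← Finset.sum_div, ← norm_sq_eq_sum]
  field_simp

theorem BoundedPotential.energy_eq {f : Space → ℝ} (hf : BoundedPotential f) :
    Integrable (fun ξ : Space => ‖fhat f ξ‖ ^ 2 / ‖ξ‖ ^ 2) ∧
    ∫ ξ : Space, ‖fhat f ξ‖ ^ 2 / ‖ξ‖ ^ 2 = Real.pi * coulomb f := by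
  have h := fun j => hf.directional_energy j
  have e : ∀ ξ : Space, ‖fhat f ξ‖ ^ 2 / ‖ξ‖ ^ 2
      = ∑ j, ξ j ^ 2 * ‖fhat f ξ‖ ^ 2 / ‖ξ‖ ^ 4 := fun ξ => (sum_coord_sq_div ξ _).symm
  simp only [e]
  refine ⟨integrable_finsetSum _ fun j _ => (h j).1, ?_⟩
  rw [integral_finsetSum _ fun j _ => (h j).1]
  simp only [(h _).2, ← Finset.mul_sum, Finset.sum_sub_distrib, hf.sum_dirCoulomb]
  simp
  ring

theorem BoundedPotential.coulomb_eq {f : Space → ℝ} (hf : BoundedPotential f) :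
    coulomb f = ∫ x, newtonPotential f x * f x := by
  rw [coulomb, hf.integral_prod_eq hf.integrable]
  simp only [mul_comm]

theorem BoundedPotential.newton_symm {f g : Space → ℝ} (hf : BoundedPotential f)
    (hg : BoundedPotential g) :
    ∫ x, newtonPotential f x * g x = ∫ x, newtonPotential g x * f x := by
  have h1 := hf.integral_prod_eq hg.integrable
  have h2 := hg.integral_prod_eq hf.integrable
  simp only [mul_comm (newtonPotential _ _)]
  rw [← h1, ← h2, Measure.volume_eq_prod, ← integral_prod_swap]
  congr 1
  funext p
  simp only [Prod.fst_swap, Prod.snd_swap, norm_sub_rev p.2, mul_comm]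

theorem BoundedPotential.newton_add {f g : Space → ℝ} (hf : BoundedPotential f)
    (hg : BoundedPotential g) (x : Space) :
    newtonPotential (fun y => f y + g y) x = newtonPotential f x + newtonPotential g x := by
  simp only [newtonPotential, add_div]
  exact integral_add (hf.integrable_div x) (hg.integrable_div x)

/-- The mutual Coulomb energy in Fourier variables, by polarisation. -/
theorem BoundedPotential.mutual_energy {f g : Space → ℝ} (hf : BoundedPotential f)
    (hg : BoundedPotential g) :
    ∫ x, newtonPotential f x * g x
      = Real.pi⁻¹ * ∫ ξ, ((starRingEnd ℂ) (fhat g ξ) * fhat f ξ).re / ‖ξ‖ ^ 2 := by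
  have hs := hf.add hg
  have h1 := hf.energy_eq
  have h2 := hg.energy_eq
  have h3 := hs.energy_eq
  have e : ∀ ξ : Space, ((starRingEnd ℂ) (fhat g ξ) * fhat f ξ).re / ‖ξ‖ ^ 2
      = 1 / 2 * (‖fhat (fun x => f x + g x) ξ‖ ^ 2 / ‖ξ‖ ^ 2 - ‖fhat f ξ‖ ^ 2 / ‖ξ‖ ^ 2
        - ‖fhat g ξ‖ ^ 2 / ‖ξ‖ ^ 2) := by
    intro ξ
    rw [fhat_add hf.integrable hg.integrable, ← sub_div, ← sub_div, ← mul_div_assoc]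
    congr 1
    simp only [← Complex.normSq_eq_norm_sq, Complex.normSq_apply, Complex.add_re, Complex.add_im,
      Complex.mul_re, Complex.conj_re, Complex.conj_im]
    ring
  simp only [e]
  have h31 : Integrable fun ξ : Space => ‖fhat (fun x => f x + g x) ξ‖ ^ 2 / ‖ξ‖ ^ 2
      - ‖fhat f ξ‖ ^ 2 / ‖ξ‖ ^ 2 := h3.1.sub h1.1
  rw [integral_const_mul, integral_sub h31 h2.1, integral_sub h3.1 h1.1, h1.2, h2.2,
    h3.2, hs.coulomb_eq, hf.coulomb_eq, hg.coulomb_eq]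
  have e2 : ∀ x, newtonPotential (fun y => f y + g y) x * (f x + g x)
      = (newtonPotential f x * f x + newtonPotential f x * g x)
        + (newtonPotential g x * f x + newtonPotential g x * g x) := fun x => by
    rw [hf.newton_add hg]
    ring
  simp only [e2]
  have i1 := hf.newton_mul_integrable hf.integrable
  have i2 := hf.newton_mul_integrable hg.integrable
  have i3 := hg.newton_mul_integrable hf.integrable
  have i4 := hg.newton_mul_integrable hg.integrable
  have hpi := Real.pi_pos.ne'
  have i12 : Integrable fun x => newtonPotential f x * f x + newtonPotential f x * g x :=
    i1.add i2
  have i34 : Integrable fun x => newtonPotential g x * f x + newtonPotential g x * g x :=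
    i3.add i4
  rw [integral_add i12 i34, integral_add i1 i2, integral_add i3 i4,
    hf.newton_symm hg]
  field_simp
  ring

/-! ### The gradient of the Newton potential -/

/-- The Fourier transform of `∂_j (f * 1/|x|)`, that of `1/|x|` being `1/(π|ξ|²)`. -/
def gradHat (j : Fin 3) (f : Space → ℝ) (ξ : Space) : ℂ :=
  2 * Complex.I * (ξ j : ℂ) * fhat f ξ / (‖ξ‖ ^ 2 : ℝ)

theorem norm_sq_gradHat (j : Fin 3) (f : Space → ℝ) (ξ : Space) :
    ‖gradHat j f ξ‖ ^ 2 = 4 * (ξ j ^ 2 * ‖fhat f ξ‖ ^ 2 / ‖ξ‖ ^ 4) := by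
  rw [gradHat, norm_div, norm_mul, norm_mul, norm_mul, Complex.norm_real, Complex.norm_real,
    Complex.norm_I, Real.norm_of_nonneg (sq_nonneg ‖ξ‖), div_pow, mul_pow, mul_pow,
    Real.norm_eq_abs, sq_abs, ← pow_mul]
  norm_num
  ring

theorem conj_gradHat (j : Fin 3) (f : Space → ℝ) (ξ : Space) :
    (starRingEnd ℂ) (gradHat j f ξ) = gradHat j f (-ξ) := by
  simp only [gradHat, map_div₀, map_mul, conj_fhat, Complex.conj_I, Complex.conj_ofReal, norm_neg,
    Complex.conj_ofNat]
  simp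

theorem BoundedPotential.memLp_gradHat {f : Space → ℝ} (hf : BoundedPotential f) (j : Fin 3) :
    MemLp (gradHat j f) 2 volume := by
  have hm : AEStronglyMeasurable (gradHat j f) volume := by
    have := (continuous_fhat hf.integrable).measurable
    refine Measurable.aestronglyMeasurable ?_
    unfold gradHat
    fun_prop
  rw [memLp_two_iff_integrable_sq_norm hm]
  simp only [norm_sq_gradHat]
  exact (hf.directional_energy j).1.const_mul 4

theorem fhat_pderiv {η : Space → ℝ} (hη : IsTest η) (j : Fin 3) (ξ : Space) :
    fhat (pderiv j η) ξ = 2 * Real.pi * Complex.I * (ξ j : ℂ) * fhat η ξ := by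
  have hw : ∀ v, Complex.exp (↑(-2 * Real.pi * inner ℝ v ξ) * Complex.I) = gaussWave 0 ξ v := by
    intro v
    simp [gaussWave]
  have hd := fderiv_gaussWave 0 ξ j
  have hb : ∀ {f : Space → ℝ}, Integrable f →
      Integrable fun v => gaussWave 0 ξ v * (f v : ℂ) := fun hf =>
    hf.ofReal.bdd_mul (c := 1) (continuous_gaussWave 0 ξ).aestronglyMeasurable
      (Eventually.of_forall fun v => by rw [norm_gaussWave]; simp)
  have hη' : ∀ v, fderiv ℝ (fun v => (η v : ℂ)) v (basisVec j) = (pderiv j η v : ℂ) := by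
    intro v
    have : HasFDerivAt (fun v => (η v : ℂ)) _ v :=
      Complex.ofRealCLM.hasFDerivAt.comp v (hη.differentiable v).hasFDerivAt
    rw [this.fderiv]
    simp [pderiv]
  have hdη : ∀ v, DifferentiableAt ℝ (fun v => (η v : ℂ)) v := fun v =>
    (Complex.ofRealCLM.hasFDerivAt.comp v (hη.differentiable v).hasFDerivAt).differentiableAt
  have ib := integral_mul_fderiv_eq_neg_fderiv_mul_of_integrable (μ := (volume : Measure Space))
    (f := gaussWave 0 ξ) (g := fun v => (η v : ℂ)) (v := basisVec j)
    (by
      simp only [(hd _).2, mul_assoc]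
      refine ((hb hη.integrable).const_mul
        (((-2 * Real.pi * ξ j : ℝ) : ℂ) * Complex.I)).congr (Eventually.of_forall fun v => ?_)
      push_cast
      ring)
    (by simpa only [hη'] using hb (hη.pderiv j).integrable)
    (hb hη.integrable) (fun v _ => (hd v).1) (fun v _ => hdη v)
  simp only [fhat_eq, hw]
  simp only [hη', (hd _).2] at ib
  rw [ib, ← integral_neg, ← integral_const_mul]
  congr 1
  funext v
  push_cast
  ring

/-- `∂_j (f * 1/|x|)` as an element of `L²(ℝ³; ℂ)`, defined as the inverse Plancherel transform of
`gradHat j f`. -/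
def BoundedPotential.gradLp {f : Space → ℝ} (hf : BoundedPotential f) (j : Fin 3) :
    Lp ℂ 2 (volume : Measure Space) :=
  𝓕⁻ ((hf.memLp_gradHat j).toLp (gradHat j f))

theorem BoundedPotential.inner_gradLp {f h : Space → ℝ} (hf : BoundedPotential f)
    (hh : BoundedPotential h) (j k : Fin 3) :
    inner ℂ (hf.gradLp j) (hh.gradLp k)
      = ∫ ξ, (starRingEnd ℂ) (gradHat j f ξ) * gradHat k h ξ := by
  rw [← Lp.inner_fourier_eq, gradLp, gradLp, FourierTransform.fourier_fourierInv_eq,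
    FourierTransform.fourier_fourierInv_eq, L2.inner_def]
  refine integral_congr_ae ?_
  filter_upwards [(hf.memLp_gradHat j).coeFn_toLp, (hh.memLp_gradHat k).coeFn_toLp] with ξ h1 h2
  rw [h1, h2, RCLike.inner_apply, mul_comm]

theorem IsTest.memLp_fhat {η : Space → ℝ} (hη : IsTest η) : MemLp (fhat η) 2 volume := by
  have hc : HasCompactSupport fun x => (η x : ℂ) :=
    hη.compact.comp_left (g := fun r : ℝ => (r : ℂ)) Complex.ofReal_zero
  have hd : ContDiff ℝ ((⊤ : ℕ∞) : WithTop ℕ∞) fun x => (η x : ℂ) :=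
    Complex.ofRealCLM.contDiff.comp hη.contDiff
  have := (𝓕 (hc.toSchwartzMap hd)).memLp 2 volume
  rw [SchwartzMap.fourier_coe] at this
  exact this

/-- Testing the `L²` gradient against a real test function, in Fourier variables. -/
theorem BoundedPotential.integral_test_gradLp {f : Space → ℝ} (hf : BoundedPotential f)
    (j : Fin 3) {η : Space → ℝ} (hη : IsTest η) :
    ∫ x, (η x : ℂ) * hf.gradLp j x = ∫ ξ, (starRingEnd ℂ) (fhat η ξ) * gradHat j f ξ := by
  have hc : HasCompactSupport fun x => (η x : ℂ) :=
    hη.compact.comp_left (g := fun r : ℝ => (r : ℂ)) Complex.ofReal_zero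
  have hd : ContDiff ℝ ((⊤ : ℕ∞) : WithTop ℕ∞) fun x => (η x : ℂ) :=
    Complex.ofRealCLM.contDiff.comp hη.contDiff
  let S : SchwartzMap Space ℂ := hc.toSchwartzMap hd
  have hS : ∀ x, S x = (η x : ℂ) := fun x => rfl
  have h1 : inner ℂ (S.toLp 2) (hf.gradLp j) = ∫ x, (η x : ℂ) * hf.gradLp j x := by
    rw [L2.inner_def]
    refine integral_congr_ae ?_
    filter_upwards [S.coeFn_toLp 2 volume] with x hx
    rw [hx, RCLike.inner_apply, hS, Complex.conj_ofReal, mul_comm]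
  have h2 : inner ℂ (S.toLp 2) (hf.gradLp j)
      = ∫ ξ, (starRingEnd ℂ) (fhat η ξ) * gradHat j f ξ := by
    rw [← Lp.inner_fourier_eq, gradLp, FourierTransform.fourier_fourierInv_eq,
      SchwartzMap.toLp_fourier_eq, L2.inner_def]
    refine integral_congr_ae ?_
    filter_upwards [(𝓕 S).coeFn_toLp 2 volume, (hf.memLp_gradHat j).coeFn_toLp] with ξ hx hy
    rw [hx, hy, RCLike.inner_apply, mul_comm, SchwartzMap.fourier_coe]
    rfl
  rw [← h1, h2]

/-- The `L²` gradient is the distributional derivative of the Newton potential: its pairing with `η`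
is the mutual Coulomb energy of `f` and `-∂_j η`. -/
theorem BoundedPotential.integral_test_gradLp_eq {f : Space → ℝ} (hf : BoundedPotential f)
    (j : Fin 3) {η : Space → ℝ} (hη : IsTest η) :
    ∫ x, (η x : ℂ) * hf.gradLp j x
      = ((- ∫ x, pderiv j η x * newtonPotential f x : ℝ) : ℂ) := by
  have hint : Integrable fun ξ => (starRingEnd ℂ) (fhat η ξ) * gradHat j f ξ :=
    (hη.memLp_fhat.star).integrable_mul (hf.memLp_gradHat j)
  rw [hf.integral_test_gradLp j hη]
  apply Complex.ext
  · rw [Complex.ofReal_re]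
    have h1 := hf.mutual_energy (hη.pderiv j).boundedPotential
    have h2 : (∫ ξ, (starRingEnd ℂ) (fhat η ξ) * gradHat j f ξ).re
        = ∫ ξ, ((starRingEnd ℂ) (fhat η ξ) * gradHat j f ξ).re :=
      (Complex.reCLM.integral_comp_comm hint).symm
    have e : ∀ ξ, ((starRingEnd ℂ) (fhat η ξ) * gradHat j f ξ).re
        = - (Real.pi⁻¹ * (((starRingEnd ℂ) (fhat (pderiv j η) ξ) * fhat f ξ).re / ‖ξ‖ ^ 2)) := by
      intro ξ
      have e1 : (starRingEnd ℂ) (fhat η ξ) * gradHat j f ξ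
          = ((-Real.pi⁻¹ / ‖ξ‖ ^ 2 : ℝ) : ℂ)
            * ((starRingEnd ℂ) (fhat (pderiv j η) ξ) * fhat f ξ) := by
        rw [fhat_pderiv hη, gradHat]
        simp only [map_mul, Complex.conj_I, Complex.conj_ofReal, Complex.conj_ofNat]
        have hpi : (Real.pi : ℂ) ≠ 0 := by exact_mod_cast Real.pi_pos.ne'
        push_cast
        simp
        field_simp
      rw [e1, Complex.re_ofReal_mul]
      ring
    rw [h2]
    simp only [e]
    rw [integral_neg, integral_const_mul, ← h1]
    simp only [mul_comm]
  · rw [Complex.ofReal_im, ← Complex.conj_eq_iff_im, ← integral_conj, ← integral_neg_eq_self]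
    congr 1
    funext ξ
    simp only [map_mul, conj_gradHat, conj_fhat, neg_neg]

theorem BoundedPotential.gradLp_real {f : Space → ℝ} (hf : BoundedPotential f) (j : Fin 3) :
    ∀ᵐ x, (hf.gradLp j x).im = 0 := by
  have hm := Lp.memLp (hf.gradLp j)
  refine ae_eq_zero_of_integral_contDiff_smul_eq_zero
    (hm.locallyIntegrable_two.clm Complex.imCLM) fun η h1 h2 => ?_
  have hη : IsTest η := ⟨h1, h2⟩
  have h3 := hη.integrable_smul hm.locallyIntegrable_two
  have h4 := Complex.imCLM.integral_comp_comm h3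
  have h5 := hf.integral_test_gradLp_eq j hη
  simp only [map_smul] at h4
  change ∫ x, η x • Complex.imCLM (hf.gradLp j x) = 0
  rw [h4]
  simp only [Complex.real_smul]
  rw [h5]
  simp [-Complex.ofReal_neg]

theorem BoundedPotential.isWeakPartial_gradLp {f : Space → ℝ} (hf : BoundedPotential f)
    (j : Fin 3) : IsWeakPartial j (newtonPotential f) (fun x => (hf.gradLp j x).re) := by
  have hm := Lp.memLp (hf.gradLp j)
  refine ⟨hf.newton_locallyIntegrable, hm.locallyIntegrable_two.clm Complex.reCLM,
    fun η h1 h2 => ?_⟩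
  have hη : IsTest η := ⟨h1, h2⟩
  have h3 := hη.integrable_smul hm.locallyIntegrable_two
  have h4 := Complex.reCLM.integral_comp_comm h3
  have h5 := hf.integral_test_gradLp_eq j hη
  simp only [map_smul] at h4
  change _ = - ∫ x, η x • Complex.reCLM (hf.gradLp j x)
  rw [h4]
  simp only [Complex.real_smul]
  rw [h5, Complex.reCLM_apply, Complex.ofReal_re, neg_neg]
  rfl

theorem BoundedPotential.memLp_gradLp_re {f : Space → ℝ} (hf : BoundedPotential f)
    (j : Fin 3) : MemLp (fun x => (hf.gradLp j x).re) 2 volume :=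
  Complex.reCLM.comp_memLp' (Lp.memLp (hf.gradLp j))

theorem BoundedPotential.weakPartial_newton {f : Space → ℝ} (hf : BoundedPotential f)
    (j : Fin 3) : IsWeakPartial j (newtonPotential f) (weakPartial j (newtonPotential f)) ∧
      MemLp (weakPartial j (newtonPotential f)) 2 volume :=
  ⟨isWeakPartial_weakPartial (hf.isWeakPartial_gradLp j),
    (memLp_congr_ae (hf.isWeakPartial_gradLp j).weakPartial_ae).2 (hf.memLp_gradLp_re j)⟩

/-- Parseval's identity for gradients of Newton potentials. -/
theorem BoundedPotential.integral_weakPartial_mul {f h : Space → ℝ} (hf : BoundedPotential f)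
    (hh : BoundedPotential h) (j k : Fin 3) :
    ((∫ x, weakPartial j (newtonPotential f) x * weakPartial k (newtonPotential h) x : ℝ) : ℂ)
      = ∫ ξ, (starRingEnd ℂ) (gradHat j f ξ) * gradHat k h ξ := by
  rw [← hf.inner_gradLp hh, L2.inner_def, ← integral_complex_ofReal]
  refine integral_congr_ae ?_
  filter_upwards [(hf.isWeakPartial_gradLp j).weakPartial_ae,
    (hh.isWeakPartial_gradLp k).weakPartial_ae, hf.gradLp_real j, hh.gradLp_real k]
    with x h1 h2 h3 h4
  rw [h1, h2, RCLike.inner_apply]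
  apply Complex.ext <;> simp [h3, h4, mul_comm]

/-! ### The directional virial identity for a density -/

/-- Dominated convergence on the product space with kernels dominated by the Coulomb kernel. -/
theorem tendsto_integral_prod {w : Space × Space → ℝ} {c : ℕ → Space × Space → ℝ}
    {c' : Space × Space → ℝ} {C : ℝ}
    (hw : Integrable (fun p : Space × Space => w p / ‖p.1 - p.2‖) (volume.prod volume))
    (hwm : AEStronglyMeasurable w (volume.prod volume))
    (hc : ∀ n, Measurable (c n)) (hb : ∀ n p, |c n p| ≤ C * ‖p.1 - p.2‖⁻¹ ∨ p.1 = p.2)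
    (hlim : ∀ p : Space × Space, 0 < ‖p.1 - p.2‖ → Tendsto (fun n => c n p) atTop (𝓝 (c' p))) :
    Tendsto (fun n => ∫ p, w p * c n p ∂(volume.prod volume)) atTop
      (𝓝 (∫ p, w p * c' p ∂(volume.prod volume))) := by
  refine tendsto_integral_of_dominated_convergence
    (fun p => C * ‖w p / ‖p.1 - p.2‖‖) (fun n => hwm.mul (hc n).aestronglyMeasurable)
    (hw.norm.const_mul C) (fun n => ?_) ?_
  · filter_upwards [ae_fst_ne_snd] with p hp
    have h1 : |c n p| ≤ C * ‖p.1 - p.2‖⁻¹ :=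
      (hb n p).resolve_right fun h => by simp [h] at hp
    rw [norm_mul, norm_div, norm_norm, Real.norm_eq_abs (c n p)]
    calc ‖w p‖ * |c n p| ≤ ‖w p‖ * (C * ‖p.1 - p.2‖⁻¹) := by gcongr
      _ = _ := by ring
  · filter_upwards [ae_fst_ne_snd] with p hp
    exact (hlim p hp).const_mul (w p)

/-- The virial identity with the regularised Coulomb kernel. -/
theorem virial_reg {f g : Space → ℝ} {j : Fin 3} (hf : Integrable f) (hg : Integrable g)
    (h : IsWeakPartial j f g) {a : Space → ℝ} {C : ℝ}
    (ha : ContDiff ℝ ((⊤ : ℕ∞) : WithTop ℕ∞) a) (haC : ∀ x, |a x| ≤ C)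
    (hda : ∀ k x, |pderiv k a x| ≤ C) {ε : ℝ} (hε : 0 < ε) :
    ∫ p : Space × Space, (g p.1 * f p.2) * (a p.1 * (reg ε (p.1 - p.2))⁻¹) ∂(volume.prod volume)
      = - ∫ p : Space × Space, (f p.1 * f p.2) * (pderiv j a p.1 * (reg ε (p.1 - p.2))⁻¹)
          ∂(volume.prod volume)
        + 1 / 2 * ∫ p : Space × Space, (f p.1 * f p.2) *
          ((a p.1 - a p.2) * (p.1 - p.2) j / reg ε (p.1 - p.2) ^ 3) ∂(volume.prod volume) := by
  have hC : 0 ≤ C := (abs_nonneg _).trans (haC 0)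
  have hff : Integrable (fun p : Space × Space => f p.1 * f p.2) (volume.prod volume) :=
    hf.mul_prod hf
  have hgf : Integrable (fun p : Space × Space => g p.1 * f p.2) (volume.prod volume) :=
    hg.mul_prod hf
  have hreg := contDiff_inv_reg hε
  have hdreg : ∀ z, (reg ε z)⁻¹ ≤ (√ε)⁻¹ := inv_reg_le hε
  have hreg0 : ∀ z, 0 ≤ (reg ε z)⁻¹ := fun z => inv_nonneg.2 (reg_pos hε z).le
  set K : Space → ℝ := fun z => (reg ε z)⁻¹ with hK
  set D : Space → ℝ := pderiv j K with hD
  have hKc : Continuous K := hreg.continuous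
  have hDc : Continuous D := (contDiff_pderiv hreg j).continuous
  have hKb : ∀ z, |K z| ≤ (√ε)⁻¹ := fun z => by rw [abs_of_nonneg (hreg0 z)]; exact hdreg z
  have hDb : ∀ k z, |pderiv k K z| ≤ (√ε)⁻¹ ^ 2 := fun k z => abs_pderiv_inv_reg_le hε k z
  have hDeq : ∀ z, D z = - z j / reg ε z ^ 3 := fun z => pderiv_inv_reg hε j z
  have hDodd : ∀ z, D (-z) = - D z := by
    intro z
    simp only [hDeq, reg, norm_neg, PiLp.neg_apply]
    ring
  -- integrate by parts in the first variable
  have hparts : ∀ y, ∫ x, (a x * K (x - y)) * g x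
      = - ∫ x, (a x * D (x - y) + pderiv j a x * K (x - y)) * f x := by
    intro y
    have hKy : ContDiff ℝ ((⊤ : ℕ∞) : WithTop ℕ∞) fun x => K (x - y) :=
      hreg.comp (contDiff_id.sub contDiff_const)
    have hder : ∀ k x, pderiv k (fun x => a x * K (x - y)) x
        = a x * pderiv k K (x - y) + pderiv k a x * K (x - y) := fun k x => by
      rw [pderiv_mul (ha.differentiable (by simp) x) (hKy.differentiable (by simp) x),
        pderiv_comp_sub]
    have := h.integral_mul_bounded hf hg (ha.mul hKy)
      (C := max (C * (√ε)⁻¹) (C * (√ε)⁻¹ ^ 2 + C * (√ε)⁻¹))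
      (fun x => ?_) (fun k x => ?_)
    · rw [this]
      simp only [hder]
      rfl
    · refine le_trans ?_ (le_max_left _ _)
      rw [abs_mul]
      exact mul_le_mul (haC x) (hKb _) (abs_nonneg _) hC
    · refine le_trans ?_ (le_max_right _ _)
      rw [hder]
      refine (abs_add_le _ _).trans (add_le_add ?_ ?_)
      · rw [abs_mul]
        exact mul_le_mul (haC x) (hDb _ _) (abs_nonneg _) hC
      · rw [abs_mul]
        exact mul_le_mul (hda k x) (hKb _) (abs_nonneg _) hC
  have hac : Continuous a := ha.continuous
  have hdac : Continuous (pderiv j a) := (contDiff_pderiv ha j).continuous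
  have bdd : ∀ {w m : Space × Space → ℝ} {B : ℝ}, Integrable w (volume.prod volume) →
      Continuous m → (∀ p, |m p| ≤ B) → Integrable (fun p => w p * m p) (volume.prod volume) :=
    fun hw hm hB => hw.mul_bdd hm.aestronglyMeasurable (Eventually.of_forall hB)
  have J1 := bdd (m := fun p : Space × Space => a p.1 * K (p.1 - p.2)) (B := C * (√ε)⁻¹) hgf
    (by fun_prop) fun p => by
      rw [abs_mul]
      exact mul_le_mul (haC _) (hKb _) (abs_nonneg _) hC
  have J2 := bdd (m := fun p : Space × Space => pderiv j a p.1 * K (p.1 - p.2))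
    (B := C * (√ε)⁻¹) hff (by fun_prop) fun p => by
      rw [abs_mul]
      exact mul_le_mul (hda _ _) (hKb _) (abs_nonneg _) hC
  have J3 := bdd (m := fun p : Space × Space => a p.1 * D (p.1 - p.2))
    (B := C * (√ε)⁻¹ ^ 2) hff (by fun_prop) fun p => by
      rw [abs_mul]
      exact mul_le_mul (haC _) (hDb _ _) (abs_nonneg _) hC
  have J4 := bdd (m := fun p : Space × Space => a p.2 * D (p.1 - p.2))
    (B := C * (√ε)⁻¹ ^ 2) hff (by fun_prop) fun p => by
      rw [abs_mul]
      exact mul_le_mul (haC _) (hDb _ _) (abs_nonneg _) hC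
  have J23 : Integrable (fun p : Space × Space => f p.1 * f p.2 * (pderiv j a p.1 * K (p.1 - p.2))
      + f p.1 * f p.2 * (a p.1 * D (p.1 - p.2))) (volume.prod volume) := J2.add J3
  have E1 : ∫ p : Space × Space, (g p.1 * f p.2) * (a p.1 * K (p.1 - p.2)) ∂(volume.prod volume)
      = - ∫ p : Space × Space, (f p.1 * f p.2) * (pderiv j a p.1 * K (p.1 - p.2))
          ∂(volume.prod volume)
        - ∫ p : Space × Space, (f p.1 * f p.2) * (a p.1 * D (p.1 - p.2))
          ∂(volume.prod volume) := by
    rw [integral_prod_symm _ J1, ← neg_add', ← integral_add J2 J3, integral_prod_symm _ J23,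
      ← integral_neg]
    congr 1
    funext y
    have e1 : ∀ x, g x * f y * (a x * K (x - y)) = f y * ((a x * K (x - y)) * g x) :=
      fun x => by ring
    have e2 : ∀ x, f x * f y * (pderiv j a x * K (x - y)) + f x * f y * (a x * D (x - y))
        = f y * ((a x * D (x - y) + pderiv j a x * K (x - y)) * f x) := fun x => by ring
    simp only [e1, e2, integral_const_mul, hparts]
    ring
  -- symmetrise the term with the odd kernel `D`
  have E2 : ∫ p : Space × Space, (f p.1 * f p.2) * (a p.2 * D (p.1 - p.2)) ∂(volume.prod volume)
      = - ∫ p : Space × Space, (f p.1 * f p.2) * (a p.1 * D (p.1 - p.2))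
          ∂(volume.prod volume) := by
    rw [← integral_prod_swap, ← integral_neg]
    congr 1
    funext p
    simp only [Prod.fst_swap, Prod.snd_swap]
    rw [← neg_sub p.1 p.2, hDodd]
    ring
  have E3 : ∫ p : Space × Space, (f p.1 * f p.2) *
      ((a p.1 - a p.2) * (p.1 - p.2) j / reg ε (p.1 - p.2) ^ 3) ∂(volume.prod volume)
      = - 2 * ∫ p : Space × Space, (f p.1 * f p.2) * (a p.1 * D (p.1 - p.2))
          ∂(volume.prod volume) := by
    have e : ∀ p : Space × Space, (f p.1 * f p.2) *
        ((a p.1 - a p.2) * (p.1 - p.2) j / reg ε (p.1 - p.2) ^ 3)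
        = (f p.1 * f p.2) * (a p.2 * D (p.1 - p.2))
          - (f p.1 * f p.2) * (a p.1 * D (p.1 - p.2)) := fun p => by
      rw [hDeq]
      ring
    simp only [e]
    rw [integral_sub J4 J3, E2]
    ring
  rw [E1, E3]
  ring

/-- The virial identity for a bounded smooth Lipschitz weight. -/
theorem BoundedPotential.virial {f g : Space → ℝ} {j : Fin 3} (hf : BoundedPotential f)
    (hg : Integrable g) (h : IsWeakPartial j f g) {a : Space → ℝ} {C : ℝ}
    (ha : ContDiff ℝ ((⊤ : ℕ∞) : WithTop ℕ∞) a) (haC : ∀ x, |a x| ≤ C)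
    (hda : ∀ k x, |pderiv k a x| ≤ C) (hlip : ∀ x y, |a x - a y| ≤ ‖x - y‖) :
    ∫ x, a x * (newtonPotential f x * g x)
      = - ∫ p : Space × Space, (f p.1 * f p.2) * (pderiv j a p.1 * ‖p.1 - p.2‖⁻¹)
          ∂(volume.prod volume)
        + 1 / 2 * ∫ p : Space × Space, (f p.1 * f p.2) *
          ((a p.1 - a p.2) * (p.1 - p.2) j / ‖p.1 - p.2‖ ^ 3) ∂(volume.prod volume) := by
  have hC : 0 ≤ C := (abs_nonneg _).trans (haC 0)
  let ε : ℕ → ℝ := fun n => (n + 1 : ℝ)⁻¹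
  have hεpos : ∀ n, 0 < ε n := fun n => by positivity
  have hεlim : Tendsto ε atTop (𝓝 0) :=
    tendsto_inv_atTop_zero.comp (tendsto_atTop_add_const_right _ _ tendsto_natCast_atTop_atTop)
  have hfi := hf.integrable
  have hff : Integrable (fun p : Space × Space => f p.1 * f p.2) (volume.prod volume) :=
    hfi.mul_prod hfi
  have hgf : Integrable (fun p : Space × Space => g p.1 * f p.2) (volume.prod volume) :=
    hg.mul_prod hfi
  have hregm : ∀ n, Measurable fun p : Space × Space => reg (ε n) (p.1 - p.2) := fun n =>
    (contDiff_reg (hεpos n)).continuous.measurable.comp (measurable_fst.sub measurable_snd)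
  have ham : Measurable a := ha.continuous.measurable
  have hdam : Measurable (pderiv j a) := (contDiff_pderiv ha j).continuous.measurable
  have hinv : ∀ n (p : Space × Space), p.1 ≠ p.2 →
      (reg (ε n) (p.1 - p.2))⁻¹ ≤ ‖p.1 - p.2‖⁻¹ := fun n p hp =>
    inv_anti₀ (norm_pos_iff.2 (sub_ne_zero.2 hp)) (norm_le_reg (hεpos n) _)
  have l1 := tendsto_integral_prod (w := fun p => g p.1 * f p.2)
    (c := fun n p => a p.1 * (reg (ε n) (p.1 - p.2))⁻¹) (c' := fun p => a p.1 * ‖p.1 - p.2‖⁻¹)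
    (C := C) (hf.integrable_prod hg) hgf.1
    (fun n => (ham.comp measurable_fst).mul (hregm n).inv) (fun n p => by
      by_cases hp : p.1 = p.2
      · exact Or.inr hp
      · left
        rw [abs_mul, abs_of_nonneg (inv_nonneg.2 (reg_pos (hεpos n) _).le)]
        exact mul_le_mul (haC _) (hinv n p hp) (inv_nonneg.2 (reg_pos (hεpos n) _).le) hC)
    (fun p hp => ((tendsto_reg _ hεlim).inv₀ hp.ne').const_mul _)
  have l2 := tendsto_integral_prod (w := fun p => f p.1 * f p.2)
    (c := fun n p => pderiv j a p.1 * (reg (ε n) (p.1 - p.2))⁻¹)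
    (c' := fun p => pderiv j a p.1 * ‖p.1 - p.2‖⁻¹)
    (C := C) (hf.integrable_prod hfi) hff.1
    (fun n => (hdam.comp measurable_fst).mul (hregm n).inv) (fun n p => by
      by_cases hp : p.1 = p.2
      · exact Or.inr hp
      · left
        rw [abs_mul, abs_of_nonneg (inv_nonneg.2 (reg_pos (hεpos n) _).le)]
        exact mul_le_mul (hda _ _) (hinv n p hp) (inv_nonneg.2 (reg_pos (hεpos n) _).le) hC)
    (fun p hp => ((tendsto_reg _ hεlim).inv₀ hp.ne').const_mul _)
  have l3 := tendsto_integral_prod (w := fun p => f p.1 * f p.2)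
    (c := fun n p => (a p.1 - a p.2) * (p.1 - p.2) j / reg (ε n) (p.1 - p.2) ^ 3)
    (c' := fun p => (a p.1 - a p.2) * (p.1 - p.2) j / ‖p.1 - p.2‖ ^ 3)
    (C := 1) (hf.integrable_prod hfi) hff.1
    (fun n => (((ham.comp measurable_fst).sub (ham.comp measurable_snd)).mul
      (by fun_prop)).div ((hregm n).pow_const 3)) (fun n p => by
      by_cases hp : p.1 = p.2
      · exact Or.inr hp
      · left
        have h0 := reg_pos (hεpos n) (p.1 - p.2)
        rw [abs_div, abs_mul, abs_of_pos (pow_pos h0 3), one_mul]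
        refine le_trans ?_ (hinv n p hp)
        rw [div_le_iff₀ (pow_pos h0 3)]
        have e : (reg (ε n) (p.1 - p.2))⁻¹ * reg (ε n) (p.1 - p.2) ^ 3
            = reg (ε n) (p.1 - p.2) * reg (ε n) (p.1 - p.2) := by field_simp
        rw [e]
        exact mul_le_mul ((hlip _ _).trans (norm_le_reg (hεpos n) _))
          (abs_coord_le_reg (hεpos n) _ j) (abs_nonneg _) h0.le)
    (fun p hp => tendsto_const_nhds.div ((tendsto_reg _ hεlim).pow 3) (pow_ne_zero 3 hp.ne'))
  have l4 := (l2.neg).add (l3.const_mul (1 / 2))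
  have huniq := tendsto_nhds_unique l1 (l4.congr fun n =>
    (virial_reg hfi hg h ha haC hda (hεpos n)).symm)
  rw [← huniq]
  have hag : Integrable fun x => a x * g x :=
    hg.bdd_mul ha.continuous.aestronglyMeasurable (Eventually.of_forall haC)
  have := hf.integral_prod_eq hag
  rw [Measure.volume_eq_prod] at this
  have e : ∀ x, a x * (newtonPotential f x * g x) = a x * g x * newtonPotential f x :=
    fun x => by ring
  simp only [e]
  rw [← this]
  congr 1
  funext p
  ring

/-- The weight `R sin (x_j / R)`, `R = n + 1`: a bounded substitute for the coordinate `x_j`. -/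
def sinWeight (j : Fin 3) (n : ℕ) (x : Space) : ℝ := (n + 1) * Real.sin (x j / (n + 1))

theorem contDiff_sinWeight (j : Fin 3) (n : ℕ) :
    ContDiff ℝ ((⊤ : ℕ∞) : WithTop ℕ∞) (sinWeight j n) := by
  unfold sinWeight
  fun_prop

theorem abs_sinWeight_le (j : Fin 3) (n : ℕ) (x : Space) : |sinWeight j n x| ≤ n + 1 := by
  have hn : (0 : ℝ) < n + 1 := by positivity
  rw [sinWeight, abs_mul, abs_of_pos hn]
  exact mul_le_of_le_one_right hn.le (Real.abs_sin_le_one _)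

theorem pderiv_sinWeight (j k : Fin 3) (n : ℕ) (x : Space) :
    pderiv k (sinWeight j n) x = if k = j then Real.cos (x j / (n + 1)) else 0 := by
  have hn : (n + 1 : ℝ) ≠ 0 := by positivity
  have h1 : HasDerivAt (fun t : ℝ => (n + 1) * Real.sin (t / (n + 1)))
      (Real.cos (x j / (n + 1))) (x j) := by
    have := (((hasDerivAt_id (x j)).div_const (n + 1 : ℝ)).sin).const_mul (n + 1 : ℝ)
    refine this.congr_deriv ?_
    simp only [id]
    field_simp
  have h2 := pderiv_comp (η := fun z : Space => z j) h1
    ((contDiff_coord j).differentiable (by simp) x) k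
  rw [pderiv_coord, mul_ite, mul_one, mul_zero] at h2
  exact h2

theorem abs_pderiv_sinWeight_le_one (j k : Fin 3) (n : ℕ) (x : Space) :
    |pderiv k (sinWeight j n) x| ≤ 1 := by
  rw [pderiv_sinWeight]
  split_ifs
  · exact Real.abs_cos_le_one _
  · simp

theorem abs_pderiv_sinWeight_le (j k : Fin 3) (n : ℕ) (x : Space) :
    |pderiv k (sinWeight j n) x| ≤ n + 1 :=
  (abs_pderiv_sinWeight_le_one j k n x).trans (by linarith [n.cast_nonneg (α := ℝ)])

theorem abs_sinWeight_sub_le (j : Fin 3) (n : ℕ) (x y : Space) :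
    |sinWeight j n x - sinWeight j n y| ≤ ‖x - y‖ := by
  have hn : (0 : ℝ) < n + 1 := by positivity
  have h := Real.abs_sin_sub_sin_le (x j / (n + 1)) (y j / (n + 1))
  rw [sinWeight, sinWeight, ← mul_sub, abs_mul, abs_of_pos hn]
  calc (n + 1 : ℝ) * _ ≤ (n + 1) * |x j / (n + 1) - y j / (n + 1)| := by gcongr
    _ = |(x - y) j| := by
      rw [← sub_div, abs_div, abs_of_pos hn, PiLp.sub_apply]
      field_simp
    _ ≤ _ := abs_coord_le_norm _ _

theorem tendsto_div_succ (c : ℝ) : Tendsto (fun n : ℕ => c / (n + 1 : ℝ)) atTop (𝓝 0) := by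
  have := (tendsto_one_div_add_atTop_nhds_zero_nat (𝕜 := ℝ)).const_mul c
  simpa only [mul_one_div, mul_zero] using this

theorem tendsto_sinWeight (j : Fin 3) (x : Space) :
    Tendsto (fun n => sinWeight j n x) atTop (𝓝 (x j)) := by
  have h1 : Tendsto (fun n : ℕ => x j * Real.sinc (x j / (n + 1))) atTop
      (𝓝 (x j * Real.sinc 0)) :=
    ((Real.continuous_sinc.tendsto 0).comp (tendsto_div_succ (x j))).const_mul _
  rw [Real.sinc_zero, mul_one] at h1
  refine h1.congr fun n => ?_
  have hn : (n + 1 : ℝ) ≠ 0 := by positivity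
  by_cases hx : x j = 0
  · simp [sinWeight, hx]
  · rw [sinWeight, Real.sinc_of_ne_zero (div_ne_zero hx hn)]
    field_simp

theorem tendsto_cos_div (c : ℝ) :
    Tendsto (fun n : ℕ => Real.cos (c / (n + 1))) atTop (𝓝 1) := by
  have := (Real.continuous_cos.tendsto 0).comp (tendsto_div_succ c)
  rwa [Real.cos_zero] at this

/-- The virial identity
`∫ x_j (f * 1/|x|) ∂_j f = -∬ f(x) f(y) / |x-y| + ½ ∬ f(x) f(y) (x_j-y_j)² / |x-y|³`,
with the left side read as a limit over bounded weights. -/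
theorem BoundedPotential.tendsto_virial {f g : Space → ℝ} {j : Fin 3} (hf : BoundedPotential f)
    (hg : Integrable g) (h : IsWeakPartial j f g) :
    Tendsto (fun n => ∫ x, sinWeight j n x * (newtonPotential f x * g x)) atTop
      (𝓝 (- coulomb f + 1 / 2 * dirCoulomb j f)) := by
  have hfi := hf.integrable
  have hff : Integrable (fun p : Space × Space => f p.1 * f p.2) (volume.prod volume) :=
    hfi.mul_prod hfi
  have hvir := fun n => hf.virial hg h (contDiff_sinWeight j n) (abs_sinWeight_le j n)
    (fun k => abs_pderiv_sinWeight_le j k n) (abs_sinWeight_sub_le j n)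
  simp only [hvir, pderiv_sinWeight, if_true]
  have hm : ∀ n, Measurable (sinWeight j n) := fun n =>
    (contDiff_sinWeight j n).continuous.measurable
  have l2 := tendsto_integral_prod (w := fun p => f p.1 * f p.2)
    (c := fun n p => Real.cos (p.1 j / (n + 1)) * ‖p.1 - p.2‖⁻¹)
    (c' := fun p => 1 * ‖p.1 - p.2‖⁻¹)
    (C := 1) (hf.integrable_prod hfi) hff.1
    (fun n => by fun_prop) (fun n p => by
      left
      rw [abs_mul, abs_inv, abs_norm]
      exact mul_le_mul_of_nonneg_right (Real.abs_cos_le_one _) (by positivity))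
    (fun p hp => (tendsto_cos_div _).mul_const _)
  have l3 := tendsto_integral_prod (w := fun p => f p.1 * f p.2)
    (c := fun n p => (sinWeight j n p.1 - sinWeight j n p.2) * (p.1 - p.2) j / ‖p.1 - p.2‖ ^ 3)
    (c' := fun p => (p.1 j - p.2 j) * (p.1 - p.2) j / ‖p.1 - p.2‖ ^ 3)
    (C := 1) (hf.integrable_prod hfi) hff.1
    (fun n => ((((hm n).comp measurable_fst).sub ((hm n).comp measurable_snd)).mul
      (by fun_prop)).div (by fun_prop)) (fun n p => by
      by_cases hp : p.1 = p.2
      · exact Or.inr hp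
      · left
        have h0 : 0 < ‖p.1 - p.2‖ := norm_pos_iff.2 (sub_ne_zero.2 hp)
        rw [abs_div, abs_mul, abs_of_pos (pow_pos h0 3), one_mul, div_le_iff₀ (pow_pos h0 3)]
        have e : ‖p.1 - p.2‖⁻¹ * ‖p.1 - p.2‖ ^ 3 = ‖p.1 - p.2‖ * ‖p.1 - p.2‖ := by field_simp
        rw [e]
        exact mul_le_mul (abs_sinWeight_sub_le j n _ _) (abs_coord_le_norm _ j)
          (abs_nonneg _) h0.le)
    (fun p hp =>
      (((tendsto_sinWeight j p.1).sub (tendsto_sinWeight j p.2)).mul_const _).div_const _)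
  have l4 := (l2.neg).add (l3.const_mul (1 / 2))
  have e2 : ∫ p : Space × Space, f p.1 * f p.2 * (1 * ‖p.1 - p.2‖⁻¹) ∂(volume.prod volume)
      = coulomb f := by
    simp only [one_mul, coulomb, div_eq_mul_inv]
    rfl
  have e3 : ∫ p : Space × Space, f p.1 * f p.2 *
      ((p.1 j - p.2 j) * (p.1 - p.2) j / ‖p.1 - p.2‖ ^ 3) ∂(volume.prod volume)
      = dirCoulomb j f := by
    simp only [← PiLp.sub_apply, ← sq]
    rfl
  rw [e2, e3] at l4
  exact l4

/-! ### The Dirac matrices and densities of spinor fields -/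

theorem alphaMatrix_star (k : Fin 3) : star (alphaMatrix k) = alphaMatrix k := by
  ext i j
  fin_cases k <;> fin_cases i <;> fin_cases j <;> simp [alphaMatrix, Matrix.star_apply]

theorem betaMatrix_star : star betaMatrix = betaMatrix := by
  ext i j
  fin_cases i <;> fin_cases j <;> simp [betaMatrix, Matrix.star_apply]

/-- Hermitian operators on spinors. -/
def Herm (M : Spinor →L[ℂ] Spinor) : Prop := ∀ u v, inner ℂ (M u) v = inner ℂ u (M v)

theorem herm_of_star {M : Spinor →L[ℂ] Spinor} (h : star M = M) : Herm M := fun u v => by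
  rw [← ContinuousLinearMap.adjoint_inner_right, ← ContinuousLinearMap.star_eq_adjoint, h]

theorem herm_alpha (k : Fin 3) : Herm (alpha k) :=
  herm_of_star (by rw [alpha, ← map_star, alphaMatrix_star])

theorem herm_beta : Herm beta := herm_of_star (by rw [beta, ← map_star, betaMatrix_star])

theorem herm_id : Herm (ContinuousLinearMap.id ℂ Spinor) := fun _ _ => rfl

/-- The real bilinear form `Re (u* M v)`. -/
def reForm (M : Spinor →L[ℂ] Spinor) : Spinor →ₗ[ℝ] Spinor →ₗ[ℝ] ℝ :=
  LinearMap.mk₂ ℝ (fun u v => (inner ℂ u (M v)).re)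
    (fun u u' v => by simp)
    (fun c u v => by
      rw [← Complex.coe_smul, inner_smul_left]
      simp)
    (fun u v v' => by simp)
    (fun c u v => by
      rw [← Complex.coe_smul, map_smul, inner_smul_right]
      simp)

theorem reForm_apply (M : Spinor →L[ℂ] Spinor) (u v : Spinor) :
    reForm M u v = (inner ℂ u (M v)).re := rfl

/-- The real bilinear form `Im (u* M v) = Re (u* (-i M) v)`. -/
def imForm (M : Spinor →L[ℂ] Spinor) : Spinor →ₗ[ℝ] Spinor →ₗ[ℝ] ℝ :=
  reForm (-Complex.I • M)

theorem imForm_apply (M : Spinor →L[ℂ] Spinor) (u v : Spinor) :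
    imForm M u v = (inner ℂ u (M v)).im := by
  rw [imForm, reForm_apply, smul_apply, inner_smul_right]
  simp

theorem Herm.conj {M : Spinor →L[ℂ] Spinor} (h : Herm M) (u v : Spinor) :
    (starRingEnd ℂ) (inner ℂ u (M v)) = inner ℂ v (M u) := by
  rw [inner_conj_symm, h]

theorem Herm.re_symm {M : Spinor →L[ℂ] Spinor} (h : Herm M) (u v : Spinor) :
    reForm M v u = reForm M u v := by
  rw [reForm_apply, reForm_apply, ← h.conj u v, Complex.conj_re]

theorem Herm.im_antisymm {M : Spinor →L[ℂ] Spinor} (h : Herm M) (u v : Spinor) :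
    imForm M v u = - imForm M u v := by
  rw [imForm_apply, imForm_apply, ← h.conj u v, Complex.conj_im]

theorem Herm.im_self {M : Spinor →L[ℂ] Spinor} (h : Herm M) (u : Spinor) :
    (inner ℂ u (M u)).im = 0 := by
  have := h.im_antisymm u u
  rw [imForm_apply] at this
  linarith

theorem Herm.inner_self {M : Spinor →L[ℂ] Spinor} (h : Herm M) (u : Spinor) :
    inner ℂ u (M u) = (((inner ℂ u (M u)).re : ℝ) : ℂ) :=
  Complex.ext rfl (h.im_self u)

section Field

variable {φ : Space → Spinor}

theorem MemH1.isWeakPartial (h : MemH1 φ) (k : Fin 3) :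
    IsWeakPartial k φ (weakPartial k φ) := by
  obtain ⟨g, hg, -⟩ := h.2 k
  exact isWeakPartial_weakPartial hg

theorem MemH1.memLp_weakPartial (h : MemH1 φ) (k : Fin 3) :
    MemLp (weakPartial k φ) 2 volume := by
  obtain ⟨g, hg, hg2⟩ := h.2 k
  exact (memLp_congr_ae hg.weakPartial_ae).2 hg2

theorem integrable_inner_apply (M : Spinor →L[ℂ] Spinor) {u v : Space → Spinor}
    (hu : MemLp u 2 volume) (hv : MemLp v 2 volume) :
    Integrable fun x => inner ℂ (u x) (M (v x)) := by
  refine Integrable.re_im_iff.1 ⟨integrable_bilin (reForm M) hu hv, ?_⟩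
  refine (integrable_bilin (imForm M) hu hv).congr (Eventually.of_forall fun x => ?_)
  simp only [imForm_apply]
  rfl

/-- The density `φ* M φ`; the real part makes it a real function and changes nothing for Hermitian
`M`. -/
def density (M : Spinor →L[ℂ] Spinor) (φ : Space → Spinor) (x : Space) : ℝ :=
  (inner ℂ (φ x) (M (φ x))).re

/-- The weak derivative `∂_j (φ* M φ) = 2 Re φ* M ∂_j φ`, for Hermitian `M`. -/
def densityDeriv (M : Spinor →L[ℂ] Spinor) (φ : Space → Spinor) (j : Fin 3) (x : Space) : ℝ :=
  2 * (inner ℂ (φ x) (M (weakPartial j φ x))).re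

theorem MemH1.integrable_density (h : MemH1 φ) (M : Spinor →L[ℂ] Spinor) :
    Integrable (density M φ) := integrable_bilin (reForm M) h.1 h.1

theorem MemH1.integrable_densityDeriv (h : MemH1 φ) (M : Spinor →L[ℂ] Spinor) (j : Fin 3) :
    Integrable (densityDeriv M φ j) :=
  (integrable_bilin (reForm M) h.1 (h.memLp_weakPartial j)).const_mul 2

theorem MemH1.isWeakPartial_density (h : MemH1 φ) {M : Spinor →L[ℂ] Spinor} (hM : Herm M)
    (j : Fin 3) : IsWeakPartial j (density M φ) (densityDeriv M φ j) := by
  have := (h.isWeakPartial j).bilin (reForm M) (h.isWeakPartial j) h.1 (h.memLp_weakPartial j)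
    h.1 (h.memLp_weakPartial j)
  refine this.congr_ae (Eventually.of_forall fun x => rfl) (Eventually.of_forall fun x => ?_)
  simp only [hM.re_symm (φ x) (weakPartial j φ x), densityDeriv, reForm_apply]
  ring

theorem rho_eq_density (φ : Space → Spinor) :
    rho φ = density (ContinuousLinearMap.id ℂ Spinor) φ := by
  funext x
  rw [density, rho, ContinuousLinearMap.id_apply, inner_self_eq_norm_sq_to_K]
  simp [← Complex.ofReal_pow]

theorem MemH1.boundedPotential_rho (h : MemH1 φ) : BoundedPotential (rho φ) := by
  rw [rho_eq_density]
  refine boundedPotential_of_weakPartial (h.integrable_density _) (fun x => ?_)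
    (fun k => h.integrable_densityDeriv _ k) (fun k => h.isWeakPartial_density herm_id k)
  rw [← rho_eq_density]
  exact sq_nonneg _

theorem MemH1.boundedPotential_density (h : MemH1 φ) (M : Spinor →L[ℂ] Spinor) :
    BoundedPotential (density M φ) := by
  refine h.boundedPotential_rho.mono (C := ‖M‖) (h.integrable_density M) fun x => ?_
  rw [density, rho, abs_of_nonneg (sq_nonneg ‖φ x‖)]
  calc |(inner ℂ (φ x) (M (φ x))).re| ≤ ‖inner ℂ (φ x) (M (φ x))‖ := Complex.abs_re_le_norm _
    _ ≤ ‖φ x‖ * ‖M (φ x)‖ := norm_inner_le_norm _ _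
    _ ≤ ‖φ x‖ * (‖M‖ * ‖φ x‖) := by
        gcongr
        exact M.le_opNorm _
    _ = _ := by ring

/-- Integrals of weak derivatives of densities vanish. -/
theorem MemH1.integral_densityDeriv (h : MemH1 φ) {M : Spinor →L[ℂ] Spinor} (hM : Herm M)
    (j : Fin 3) : ∫ x, densityDeriv M φ j x = 0 := by
  have hp : ∀ k x, pderiv k (fun _ => (1 : ℝ)) x = 0 := fun k x => by simp [pderiv]
  have := (h.isWeakPartial_density hM j).integral_mul_bounded (h.integrable_density M)
    (h.integrable_densityDeriv M j) (a := fun _ => 1) (C := 1) contDiff_const (by simp)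
    (by simp [hp])
  simpa [hp] using this

theorem tendsto_integral_cos {f : Space → ℝ} (hf : Integrable f) (j : Fin 3) :
    Tendsto (fun n : ℕ => ∫ x, Real.cos (x j / (n + 1)) * f x) atTop (𝓝 (∫ x, f x)) := by
  refine tendsto_integral_of_dominated_convergence (fun x => ‖f x‖) (fun n => ?_) hf.norm
    (fun n => Eventually.of_forall fun x => ?_) (Eventually.of_forall fun x => ?_)
  · exact (by fun_prop : Continuous fun x : Space => Real.cos (x j / (n + 1))).aestronglyMeasurable.mul
      hf.1
  · rw [norm_mul]
    exact mul_le_of_le_one_left (norm_nonneg _) (Real.abs_cos_le_one _)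
  · simpa using (tendsto_cos_div (x j)).mul_const (f x)

theorem integrable_sinWeight_mul {f : Space → ℝ} (hf : Integrable f) (j : Fin 3) (n : ℕ) :
    Integrable fun x => sinWeight j n x * f x :=
  hf.bdd_mul (contDiff_sinWeight j n).continuous.aestronglyMeasurable
    (Eventually.of_forall (abs_sinWeight_le j n))

theorem MemH1.tendsto_sinWeight_densityDeriv (h : MemH1 φ) {M : Spinor →L[ℂ] Spinor} (hM : Herm M)
    (j : Fin 3) : Tendsto (fun n => ∫ x, sinWeight j n x * densityDeriv M φ j x) atTop
      (𝓝 (- ∫ x, density M φ x)) := by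
  have := (tendsto_integral_cos (h.integrable_density M) j).neg
  refine this.congr fun n => ?_
  rw [(h.isWeakPartial_density hM j).integral_mul_bounded (h.integrable_density M)
    (h.integrable_densityDeriv M j) (contDiff_sinWeight j n) (abs_sinWeight_le j n)
    (fun k => abs_pderiv_sinWeight_le j k n)]
  simp only [pderiv_sinWeight, if_true]

/-- The kinetic part of the virial identity: `2 Im (∂_j φ* M ∂_k φ)` is a null Lagrangian, so against
the weight `x_j` only terms with a derivative on the weight remain. For `k = j` it vanishes
pointwise. -/
theorem MemH1.tendsto_sinWeight_imForm (h : MemH1 φ) {M : Spinor →L[ℂ] Spinor} (hM : Herm M)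
    (j k : Fin 3) :
    Tendsto (fun n => ∫ x, sinWeight j n x *
        (2 * imForm M (weakPartial j φ x) (weakPartial k φ x))) atTop
      (𝓝 (- (∫ x, imForm M (φ x) (weakPartial k φ x))
        + if k = j then ∫ x, imForm M (φ x) (weakPartial j φ x) else 0)) := by
  have i1 := fun k => integrable_bilin (imForm M) h.1 (h.memLp_weakPartial k)
  by_cases hkj : k = j
  · subst hkj
    have : ∀ x, imForm M (weakPartial k φ x) (weakPartial k φ x) = 0 := fun x => by
      have := hM.im_antisymm (weakPartial k φ x) (weakPartial k φ x)
      linarith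
    simp [this]
  · rw [if_neg hkj, add_zero]
    refine ((tendsto_integral_cos (i1 k) j).neg).congr fun n => ?_
    have hnull := integral_null_lagrangian_bilin (imForm M) (h.isWeakPartial j)
      (h.isWeakPartial k) (h.isWeakPartial j) (h.isWeakPartial k) h.1 (h.memLp_weakPartial j)
      (h.memLp_weakPartial k) (h.memLp_weakPartial j) (h.memLp_weakPartial k)
      (contDiff_sinWeight j n) (abs_sinWeight_le j n) (fun i => abs_pderiv_sinWeight_le j i n)
    have e : ∀ x, (sinWeight j n x * (imForm M (weakPartial j φ x) (weakPartial k φ x)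
        - imForm M (weakPartial k φ x) (weakPartial j φ x))
        + (pderiv j (sinWeight j n) x * imForm M (φ x) (weakPartial k φ x)
          - pderiv k (sinWeight j n) x * imForm M (φ x) (weakPartial j φ x)))
        = sinWeight j n x * (2 * imForm M (weakPartial j φ x) (weakPartial k φ x))
          + Real.cos (x j / (n + 1)) * imForm M (φ x) (weakPartial k φ x) := fun x => by
      rw [hM.im_antisymm (weakPartial j φ x) (weakPartial k φ x), pderiv_sinWeight,
        pderiv_sinWeight, if_pos rfl, if_neg hkj]
      ring
    simp only [e] at hnull
    have c1 : Integrable fun x => sinWeight j n x *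
        (2 * imForm M (weakPartial j φ x) (weakPartial k φ x)) :=
      integrable_sinWeight_mul ((integrable_bilin (imForm M) (h.memLp_weakPartial j)
        (h.memLp_weakPartial k)).const_mul 2) j n
    have c2 : Integrable fun x => Real.cos (x j / (n + 1)) * imForm M (φ x) (weakPartial k φ x) :=
      (i1 k).bdd_mul (c := 1) (by fun_prop : Continuous fun x : Space =>
        Real.cos (x j / (n + 1))).aestronglyMeasurable
        (Eventually.of_forall fun x => Real.abs_cos_le_one _)
    rw [integral_add c1 c2] at hnull
    linarith

/-! ### The Dirac equation tested against `φ` and `∂_j φ` -/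

theorem IsStationary.inner_eq {m ω : ℝ} (h : IsStationary m ω φ) : ∀ᵐ x, ∀ u : Spinor,
    -(ω : ℂ) * inner ℂ u (φ x) + (Phi φ x : ℂ) * inner ℂ u (φ x)
      - Complex.I * ∑ k, inner ℂ u (alpha k (weakPartial k φ x))
      - ∑ k, (vecA φ k x : ℂ) * inner ℂ u (alpha k (φ x))
      + (m : ℂ) * inner ℂ u (beta (φ x)) = 0 := by
  filter_upwards [h.equation] with x hx u
  have := congrArg (fun v => inner ℂ u v) hx
  simp only [inner_add_right, inner_sub_right, inner_neg_right, inner_smul_right, inner_sum,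
    inner_zero_right] at this
  rw [← this]
  ring

/-- Real part of the equation tested against `u`. -/
theorem IsStationary.re_eq {m ω : ℝ} (h : IsStationary m ω φ) : ∀ᵐ x, ∀ u : Spinor,
    -ω * (inner ℂ u (φ x)).re + Phi φ x * (inner ℂ u (φ x)).re
      + ∑ k, imForm (alpha k) u (weakPartial k φ x)
      - ∑ k, vecA φ k x * (inner ℂ u (alpha k (φ x))).re
      + m * (inner ℂ u (beta (φ x))).re = 0 := by
  filter_upwards [h.inner_eq] with x hx u
  have := congrArg Complex.re (hx u)
  simp only [Fin.sum_univ_three, imForm_apply] at this ⊢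
  simp at this
  linarith

/-- Conservation of the current, `div J = 0`: the imaginary part of the equation tested against
`φ`. -/
theorem IsStationary.div_current {m ω : ℝ} (h : IsStationary m ω φ) :
    ∀ᵐ x, ∑ k, densityDeriv (alpha k) φ k x = 0 := by
  filter_upwards [h.inner_eq] with x hx
  have := congrArg Complex.im (hx (φ x))
  have h0 := herm_id.im_self (φ x)
  rw [ContinuousLinearMap.id_apply] at h0
  simp only [Fin.sum_univ_three, densityDeriv] at this ⊢
  simp only [Complex.add_im, Complex.sub_im, Complex.mul_im, Complex.neg_re, Complex.neg_im,
    Complex.ofReal_re, Complex.ofReal_im, h0, (herm_alpha _).im_self (φ x),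
    herm_beta.im_self (φ x), Complex.I_re, Complex.I_im, Complex.add_re, Complex.zero_im] at this
  linarith

end Field

/-! ### The virial identities of a stationary solution -/

section Virial

variable {φ : Space → Spinor}

/-- The real number `Im ∫ φ* α_k ∂_k φ`, which is `I_k`. -/
def kineticIm (φ : Space → Spinor) (k : Fin 3) : ℝ :=
  ∫ x, imForm (alpha k) (φ x) (weakPartial k φ x)

theorem MemH1.integrable_imForm (h : MemH1 φ) (k : Fin 3) :
    Integrable fun x => imForm (alpha k) (φ x) (weakPartial k φ x) :=
  integrable_bilin (imForm (alpha k)) h.1 (h.memLp_weakPartial k)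

/-- `I_k` is real, because `Re φ* α_k ∂_k φ` is half the divergence of a density. -/
theorem MemH1.I_eq (h : MemH1 φ) (k : Fin 3) : I φ k = (kineticIm φ k : ℂ) := by
  have hi := integrable_inner_apply (alpha k) h.1 (h.memLp_weakPartial k)
  have hre : (∫ x, inner ℂ (φ x) (alpha k (weakPartial k φ x))).re = 0 := by
    have h0 := h.integral_densityDeriv (herm_alpha k) k
    simp only [densityDeriv] at h0
    rw [integral_const_mul] at h0
    have : ∫ x, (inner ℂ (φ x) (alpha k (weakPartial k φ x))).re
        = (∫ x, inner ℂ (φ x) (alpha k (weakPartial k φ x))).re :=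
      Complex.reCLM.integral_comp_comm hi
    linarith
  have him : (∫ x, inner ℂ (φ x) (alpha k (weakPartial k φ x))).im = kineticIm φ k := by
    have : ∫ x, (inner ℂ (φ x) (alpha k (weakPartial k φ x))).im
        = (∫ x, inner ℂ (φ x) (alpha k (weakPartial k φ x))).im :=
      Complex.imCLM.integral_comp_comm hi
    rw [← this, kineticIm]
    simp only [imForm_apply]
  rw [I]
  apply Complex.ext
  · simp [him]
  · simp [hre]

theorem MemH1.boundedPotential_current (h : MemH1 φ) (k : Fin 3) :
    BoundedPotential (current φ k) := h.boundedPotential_density (alpha k)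

theorem MemH1.integrable_rho_mul_Phi (h : MemH1 φ) : Integrable fun x => rho φ x * Phi φ x :=
  (h.boundedPotential_rho.newton_mul_integrable h.boundedPotential_rho.integrable).congr
    (Eventually.of_forall fun _ => mul_comm _ _)

theorem MemH1.integrable_current_mul_vecA (h : MemH1 φ) (k : Fin 3) :
    Integrable fun x => current φ k x * vecA φ k x :=
  ((h.boundedPotential_current k).newton_mul_integrable
    (h.boundedPotential_current k).integrable).congr (Eventually.of_forall fun _ => mul_comm _ _)

/-- The interaction functional as a combination of Coulomb energies. -/
theorem MemH1.T_eq (h : MemH1 φ) :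
    T φ = coulomb (rho φ) - ∑ k, coulomb (current φ k) := by
  have h1 := h.integrable_rho_mul_Phi
  have h2 := h.integrable_current_mul_vecA
  have h3 : Integrable fun x => ∑ k, current φ k x * vecA φ k x :=
    integrable_finsetSum _ fun k _ => h2 k
  simp only [T, interactionDensity]
  rw [integral_sub h1 h3, integral_finsetSum _ fun k _ => h2 k,
    h.boundedPotential_rho.coulomb_eq]
  simp only [(h.boundedPotential_current _).coulomb_eq, Phi, vecA, mul_comm]

theorem MemH1.integrable_interactionDensity (h : MemH1 φ) :
    Integrable (interactionDensity φ) :=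
  h.integrable_rho_mul_Phi.sub (integrable_finsetSum _ fun k _ => h.integrable_current_mul_vecA k)

theorem restMass_eq (m : ℝ) (φ : Space → Spinor) : restMass m φ = m * ∫ x, density beta φ x := rfl

theorem inner_self_re (u : Spinor) : (inner ℂ u u).re = ‖u‖ ^ 2 := by
  rw [inner_self_eq_norm_sq_to_K]
  simp [← Complex.ofReal_pow]

/-- The equation integrated against `φ`. -/
theorem IsStationary.sum_kineticIm {m ω : ℝ} (h : IsStationary m ω φ) :
    ∑ k, kineticIm φ k = ω * Q φ - restMass m φ - T φ := by
  have h1 := h.memH1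
  have e : ∀ᵐ x, ∑ k, imForm (alpha k) (φ x) (weakPartial k φ x)
      = ω * rho φ x - m * density beta φ x - interactionDensity φ x := by
    filter_upwards [h.re_eq] with x hx
    have := hx (φ x)
    rw [inner_self_re] at this
    simp only [rho, density, interactionDensity, current]
    have s : ∑ k, vecA φ k x * (inner ℂ (φ x) (alpha k (φ x))).re
      = ∑ k, (inner ℂ (φ x) (alpha k (φ x))).re * vecA φ k x := by simp only [mul_comm]
    linarith
  have i1 : Integrable fun x => ω * rho φ x := h1.boundedPotential_rho.integrable.const_mul ω
  have i2 : Integrable fun x => m * density beta φ x := (h1.integrable_density beta).const_mul m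
  have i3 : Integrable fun x => ω * rho φ x - m * density beta φ x := i1.sub i2
  have := integral_congr_ae e
  rw [integral_finsetSum _ fun k _ => h1.integrable_imForm k,
    integral_sub i3 h1.integrable_interactionDensity, integral_sub i1 i2, integral_const_mul,
    integral_const_mul] at this
  exact this

theorem integral_add_add_sub_add {a b c d e : Space → ℝ} (ha : Integrable a) (hb : Integrable b)
    (hc : Integrable c) (hd : Integrable d) (he : Integrable e) :
    ∫ x, (a x + b x + c x - d x + e x)
      = (∫ x, a x) + (∫ x, b x) + (∫ x, c x) - (∫ x, d x) + ∫ x, e x := by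
  have h1 : Integrable fun x => a x + b x := ha.add hb
  have h2 : Integrable fun x => a x + b x + c x := h1.add hc
  have h3 : Integrable fun x => a x + b x + c x - d x := h2.sub hd
  rw [integral_add h3 he, integral_sub h2 hd, integral_add h1 hc, integral_add ha hb]

theorem MemH1.integrable_newton_densityDeriv (h : MemH1 φ) {f : Space → ℝ}
    (hf : BoundedPotential f) (M : Spinor →L[ℂ] Spinor) (j : Fin 3) :
    Integrable fun x => newtonPotential f x * densityDeriv M φ j x :=
  hf.newton_mul_integrable (h.integrable_densityDeriv M j)

/-- The directional virial identity. The equation is tested against `2 x_j ∂_j φ`, with `x_j` replaced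
by bounded weights; in the limit the terms `ωQ`, `m₀`, `∑ I_k` and the Coulomb energies add up to the
equation tested against `φ`, which leaves `I_j` and the directional energies. -/
theorem IsStationary.directional_virial {m ω : ℝ} (h : IsStationary m ω φ) (j : Fin 3) :
    kineticIm φ j = - (1 / 2) *
      (dirCoulomb j (rho φ) - ∑ k, dirCoulomb j (current φ k)) := by
  have h1 := h.memH1
  have hr := h1.boundedPotential_rho
  have hJ := h1.boundedPotential_current
  have e : ∀ n : ℕ, ∀ᵐ x,
      -ω * (sinWeight j n x * densityDeriv (ContinuousLinearMap.id ℂ Spinor) φ j x)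
      + sinWeight j n x *
          (newtonPotential (rho φ) x * densityDeriv (ContinuousLinearMap.id ℂ Spinor) φ j x)
      + ∑ k, sinWeight j n x * (2 * imForm (alpha k) (weakPartial j φ x) (weakPartial k φ x))
      - ∑ k, sinWeight j n x *
          (newtonPotential (current φ k) x * densityDeriv (alpha k) φ j x)
      + m * (sinWeight j n x * densityDeriv beta φ j x) = 0 := by
    intro n
    filter_upwards [h.re_eq] with x hx
    have := hx (weakPartial j φ x)
    have s0 := herm_id.re_symm (φ x) (weakPartial j φ x)
    have sb := herm_beta.re_symm (φ x) (weakPartial j φ x)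
    have sa := fun k => (herm_alpha k).re_symm (φ x) (weakPartial j φ x)
    simp only [reForm_apply, ContinuousLinearMap.id_apply] at s0 sb sa
    simp only [s0, sb, sa, Phi, vecA] at this
    simp only [densityDeriv, Fin.sum_univ_three, ContinuousLinearMap.id_apply] at this ⊢
    linear_combination 2 * sinWeight j n x * this
  have t0 := (h1.tendsto_sinWeight_densityDeriv herm_id j).const_mul (-ω)
  have tb := (h1.tendsto_sinWeight_densityDeriv herm_beta j).const_mul m
  have tr := hr.tendsto_virial (j := j)
    (h1.integrable_densityDeriv (ContinuousLinearMap.id ℂ Spinor) j)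
    (by rw [rho_eq_density]; exact h1.isWeakPartial_density herm_id j)
  have tA := tendsto_finsetSum Finset.univ fun k _ =>
    (hJ k).tendsto_virial (j := j) (h1.integrable_densityDeriv (alpha k) j)
      (h1.isWeakPartial_density (herm_alpha k) j)
  have tk := tendsto_finsetSum Finset.univ fun k _ =>
    h1.tendsto_sinWeight_imForm (herm_alpha k) j k
  have lim := (((t0.add tr).add tk).sub tA).add tb
  have hz := tendsto_nhds_unique lim ((tendsto_const_nhds (x := (0 : ℝ))).congr fun n => ?_)
  · rw [← rho_eq_density] at hz
    have hs := h.sum_kineticIm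
    have hT := h1.T_eq
    have hm := restMass_eq m φ
    simp only [Q] at hs
    rw [Finset.sum_add_distrib, Finset.sum_neg_distrib, Finset.sum_ite_eq' Finset.univ j,
      if_pos (Finset.mem_univ j), Finset.sum_add_distrib, Finset.sum_neg_distrib,
      ← Finset.mul_sum] at hz
    simp only [kineticIm] at hs ⊢
    linarith
  · have j0 : Integrable fun x => -ω *
        (sinWeight j n x * densityDeriv (ContinuousLinearMap.id ℂ Spinor) φ j x) :=
      (integrable_sinWeight_mul (h1.integrable_densityDeriv _ j) j n).const_mul _
    have jb : Integrable fun x => m * (sinWeight j n x * densityDeriv beta φ j x) :=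
      (integrable_sinWeight_mul (h1.integrable_densityDeriv _ j) j n).const_mul _
    have jr : Integrable fun x => sinWeight j n x *
        (newtonPotential (rho φ) x * densityDeriv (ContinuousLinearMap.id ℂ Spinor) φ j x) :=
      integrable_sinWeight_mul (h1.integrable_newton_densityDeriv hr _ j) j n
    have jA : ∀ k, Integrable fun x => sinWeight j n x *
        (newtonPotential (current φ k) x * densityDeriv (alpha k) φ j x) := fun k =>
      integrable_sinWeight_mul (h1.integrable_newton_densityDeriv (hJ k) _ j) j n
    have jk : ∀ k, Integrable fun x => sinWeight j n x *
        (2 * imForm (alpha k) (weakPartial j φ x) (weakPartial k φ x)) := fun k =>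
      integrable_sinWeight_mul ((integrable_bilin (imForm (alpha k)) (h1.memLp_weakPartial j)
        (h1.memLp_weakPartial k)).const_mul 2) j n
    have jA' := integrable_finsetSum Finset.univ fun k _ => jA k
    have jk' := integrable_finsetSum Finset.univ fun k _ => jk k
    have := integral_congr_ae (e n)
    rw [integral_add_add_sub_add j0 jr jk' jA' jb, integral_const_mul, integral_const_mul,
      integral_finsetSum _ fun k _ => jA k, integral_finsetSum _ fun k _ => jk k,
      integral_zero] at this
    exact this.symm

end Virial

/-! ### The directional functionals `T_j` -/

theorem BoundedPotential.integral_sq_weakPartial {f : Space → ℝ} (hf : BoundedPotential f)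
    (j : Fin 3) : ∫ x, weakPartial j (newtonPotential f) x ^ 2
      = 2 * Real.pi * (coulomb f - dirCoulomb j f) := by
  have h1 := hf.integral_weakPartial_mul hf j j
  have e : ∀ ξ, (starRingEnd ℂ) (gradHat j f ξ) * gradHat j f ξ
      = ((4 * (ξ j ^ 2 * ‖fhat f ξ‖ ^ 2 / ‖ξ‖ ^ 4) : ℝ) : ℂ) := fun ξ => by
    rw [← norm_sq_gradHat, mul_comm, Complex.mul_conj, Complex.normSq_eq_norm_sq]
  simp only [e] at h1
  rw [integral_complex_ofReal, Complex.ofReal_inj, integral_const_mul,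
    (hf.directional_energy j).2] at h1
  simp only [pow_two]
  rw [h1]
  ring

section Directional

variable {φ : Space → Spinor}

theorem BoundedPotential.integrable_sq_weakPartial {f : Space → ℝ} (hf : BoundedPotential f)
    (j : Fin 3) : Integrable fun x => weakPartial j (newtonPotential f) x ^ 2 :=
  (hf.weakPartial_newton j).2.integrable_sq

theorem MemH1.Tdir_eq (h : MemH1 φ) (j : Fin 3) :
    Tdir φ j = 1 / 2 * (T φ - (dirCoulomb j (rho φ) - ∑ k, dirCoulomb j (current φ k))) := by
  have hr := h.boundedPotential_rho
  have hJ := h.boundedPotential_current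
  have i1 : Integrable fun x => weakPartial j (Phi φ) x ^ 2 := hr.integrable_sq_weakPartial j
  have i2 : ∀ k, Integrable fun x => weakPartial j (vecA φ k) x ^ 2 :=
    fun k => (hJ k).integrable_sq_weakPartial j
  have i3 : Integrable fun x => ∑ k, weakPartial j (vecA φ k) x ^ 2 :=
    integrable_finsetSum _ fun k _ => i2 k
  have e1 : ∫ x, weakPartial j (Phi φ) x ^ 2 = _ := hr.integral_sq_weakPartial j
  have e2 : ∀ k, ∫ x, weakPartial j (vecA φ k) x ^ 2 = _ := fun k => (hJ k).integral_sq_weakPartial j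
  rw [Tdir, integral_sub i1 i3, integral_finsetSum _ fun k _ => i2 k, h.T_eq, e1]
  simp only [e2]
  rw [← Finset.mul_sum, Finset.sum_sub_distrib]
  field_simp
  ring

theorem fourierHat_eq (f : Space → ℝ) (k : Space) :
    fourierHat f k = fhat f ((2 * Real.pi)⁻¹ • k) := by
  rw [fourierHat, fhat_eq]
  congr 1
  funext v
  rw [inner_smul_right, real_inner_comm]
  congr 2
  push_cast
  field_simp

/-- The Fourier form of `T_j`; the change of variables `k = 2πξ` accounts for the powers of `2π`. -/
theorem MemH1.integral_TdirFourierDensity (h : MemH1 φ) (j : Fin 3) :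
    Integrable (TdirFourierDensity φ j) ∧
    4 * Real.pi * (2 * Real.pi) ^ (-3 : ℤ) * ∫ k, TdirFourierDensity φ j k = Tdir φ j := by
  have hr := h.boundedPotential_rho
  have hJ := h.boundedPotential_current
  have hpi : (2 * Real.pi) ≠ 0 := by positivity
  let G : Space → ℝ := fun ξ => ξ j ^ 2 * ‖fhat (rho φ) ξ‖ ^ 2 / ‖ξ‖ ^ 4
    - ∑ l, ξ j ^ 2 * ‖fhat (current φ l) ξ‖ ^ 2 / ‖ξ‖ ^ 4
  have i2 : Integrable fun ξ : Space => ∑ l, ξ j ^ 2 * ‖fhat (current φ l) ξ‖ ^ 2 / ‖ξ‖ ^ 4 :=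
    integrable_finsetSum _ fun l _ => ((hJ l).directional_energy j).1
  have hG : Integrable G := (hr.directional_energy j).1.sub i2
  have hGint : ∫ ξ, G ξ = Real.pi * Tdir φ j := by
    rw [integral_sub (hr.directional_energy j).1 i2,
      integral_finsetSum _ fun l _ => ((hJ l).directional_energy j).1, h.Tdir_eq, h.T_eq,
      (hr.directional_energy j).2]
    simp only [((hJ _).directional_energy j).2]
    rw [← Finset.mul_sum, Finset.sum_sub_distrib]
    ring
  have e : TdirFourierDensity φ j = fun k => ((2 * Real.pi) ^ 2)⁻¹ * G ((2 * Real.pi)⁻¹ • k) := by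
    funext k
    simp only [TdirFourierDensity, G, fourierHat_eq, norm_smul, PiLp.smul_apply, smul_eq_mul,
      Fin.sum_univ_three]
    rw [Real.norm_of_nonneg (by positivity : (0 : ℝ) ≤ (2 * Real.pi)⁻¹)]
    by_cases hk : ‖k‖ = 0
    · simp [hk]
    · field_simp
  rw [e]
  refine ⟨(hG.comp_smul (inv_ne_zero hpi)).const_mul _, ?_⟩
  rw [integral_const_mul, Measure.integral_comp_smul volume G, hGint, finrank_euclideanSpace_fin,
    abs_of_pos (by positivity), smul_eq_mul]
  have : (2 * Real.pi) ^ (-3 : ℤ) = ((2 * Real.pi) ^ 3)⁻¹ := by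
    rw [zpow_neg]; norm_cast
  rw [this]
  have := Real.pi_pos.ne'
  field_simp
  ring

theorem MemH1.wellDefined (h : MemH1 φ) : WellDefined φ where
  potential := h.boundedPotential_rho.integrable_div
  vecPotential k := (h.boundedPotential_current k).integrable_div
  kinetic k := integrable_inner_apply (alpha k) h.1 (h.memLp_weakPartial k)
  charge := h.boundedPotential_rho.integrable
  mass := h.integrable_density beta
  interaction := h.integrable_interactionDensity
  gradPotential := h.boundedPotential_rho.weakPartial_newton
  gradVecPotential j k := (h.boundedPotential_current k).weakPartial_newton j
  fourier j := (h.integral_TdirFourierDensity j).1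

/-- The relations between `ωQ - m₀`, `I_j`, `T_j` and `T`. As the directional Coulomb energies add up
to the full one, summing the directional virial identities gives a second expression for `∑ I_k`;
the first is the equation tested against `φ`. -/
theorem IsStationary.kineticIm_relations {m ω : ℝ} (h : IsStationary m ω φ) :
    ω * Q φ - restMass m φ = 1 / 2 * T φ ∧ ∑ k, kineticIm φ k = - (1 / 2) * T φ ∧
      ∀ j, kineticIm φ j = Tdir φ j - 1 / 2 * T φ := by
  have h1 := h.memH1
  have hj : ∀ j, kineticIm φ j = Tdir φ j - 1 / 2 * T φ := fun j => by
    rw [h.directional_virial j, h1.Tdir_eq j]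
    ring
  have hs : ∑ k, kineticIm φ k = - (1 / 2) * T φ := by
    rw [Finset.sum_congr rfl fun j _ => h.directional_virial j, ← Finset.mul_sum,
      Finset.sum_sub_distrib, h1.boundedPotential_rho.sum_dirCoulomb, Finset.sum_comm]
    simp only [(h1.boundedPotential_current _).sum_dirCoulomb]
    rw [h1.T_eq]
  refine ⟨?_, hs, hj⟩
  have := h.sum_kineticIm
  linarith

end Directional

/-! ### The energy -/

section Energy

variable {φ : Space → Spinor}

theorem norm_phase (ω t : ℝ) : ‖Complex.exp (-(Complex.I * ω * t))‖ = 1 := by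
  have : -(Complex.I * ω * t) = ((-(ω * t) : ℝ) : ℂ) * Complex.I := by push_cast; ring
  rw [this, Complex.norm_exp_ofReal_mul_I]

theorem MemH1.weakPartial_standingWave (h : MemH1 φ) (ω t : ℝ) (k : Fin 3) :
    weakPartial k (standingWave ω φ t) =ᵐ[volume]
      fun x => Complex.exp (-(Complex.I * ω * t)) • weakPartial k φ x :=
  ((h.isWeakPartial k).clm ((Complex.exp (-(Complex.I * ω * t)) •
    ContinuousLinearMap.id ℂ Spinor).restrictScalars ℝ)).weakPartial_ae

/-- The phase drops out of the spinor energy density. -/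
theorem MemH1.spinorEnergyDensity_ae (h : MemH1 φ) (m ω t : ℝ) :
    spinorEnergyDensity m (standingWave ω φ) (fun _ => vecA φ) t =ᵐ[volume] fun x =>
      ∑ k, -Complex.I * inner ℂ (φ x) (alpha k (weakPartial k φ x))
        - ((∑ k, current φ k x * vecA φ k x : ℝ) : ℂ) + ((m * density beta φ x : ℝ) : ℂ) := by
  have hw : ∀ᵐ x, ∀ k, weakPartial k (standingWave ω φ t) x
      = Complex.exp (-(Complex.I * ω * t)) • weakPartial k φ x :=
    ae_all_iff.2 fun k => h.weakPartial_standingWave ω t k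
  filter_upwards [hw] with x hx
  have hc : (starRingEnd ℂ) (Complex.exp (-(Complex.I * ω * t)))
      * Complex.exp (-(Complex.I * ω * t)) = 1 := by
    rw [mul_comm, Complex.mul_conj, Complex.normSq_eq_norm_sq, norm_phase]
    simp
  have ha : ∀ k, inner ℂ (φ x) (alpha k (φ x)) = (current φ k x : ℂ) := fun k =>
    (herm_alpha k).inner_self _
  have hb : inner ℂ (φ x) (beta (φ x)) = (density beta φ x : ℂ) := herm_beta.inner_self _
  simp only [spinorEnergyDensity, hx, standingWave, Fin.sum_univ_three, map_sub, map_neg, map_smul,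
    inner_add_right, inner_sub_right, inner_neg_right, inner_smul_right, inner_smul_left, ha, hb]
  push_cast
  generalize (starRingEnd ℂ) (Complex.exp (-(Complex.I * ω * t))) = a at hc ⊢
  generalize Complex.exp (-(Complex.I * ω * t)) = c at hc ⊢
  linear_combination (-Complex.I * inner ℂ (φ x) (alpha 0 (weakPartial 0 φ x))
    - Complex.I * inner ℂ (φ x) (alpha 1 (weakPartial 1 φ x))
    - Complex.I * inner ℂ (φ x) (alpha 2 (weakPartial 2 φ x))
    - current φ 0 x * vecA φ 0 x - current φ 1 x * vecA φ 1 x - current φ 2 x * vecA φ 2 x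
    + m * density beta φ x) * hc

theorem MemH1.integral_spinorEnergyDensity (h : MemH1 φ) (m ω t : ℝ) :
    Integrable (spinorEnergyDensity m (standingWave ω φ) (fun _ => vecA φ) t) ∧
    ∫ x, spinorEnergyDensity m (standingWave ω φ) (fun _ => vecA φ) t x
      = ((∑ k, kineticIm φ k - ∑ k, coulomb (current φ k) + restMass m φ : ℝ) : ℂ) := by
  have i1 : ∀ k, Integrable fun x => -Complex.I * inner ℂ (φ x) (alpha k (weakPartial k φ x)) :=
    fun k => (integrable_inner_apply (alpha k) h.1 (h.memLp_weakPartial k)).const_mul _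
  have i1' : Integrable fun x => ∑ k, -Complex.I * inner ℂ (φ x) (alpha k (weakPartial k φ x)) :=
    integrable_finsetSum _ fun k _ => i1 k
  have i2 : Integrable fun x => ∑ k, current φ k x * vecA φ k x :=
    integrable_finsetSum _ fun k _ => h.integrable_current_mul_vecA k
  have i2' : Integrable fun x => ((∑ k, current φ k x * vecA φ k x : ℝ) : ℂ) := i2.ofReal
  have i3 : Integrable fun x => ((m * density beta φ x : ℝ) : ℂ) :=
    ((h.integrable_density beta).const_mul m).ofReal
  have i12 : Integrable fun x =>
      ∑ k, -Complex.I * inner ℂ (φ x) (alpha k (weakPartial k φ x))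
        - ((∑ k, current φ k x * vecA φ k x : ℝ) : ℂ) := i1'.sub i2'
  refine ⟨(i12.add i3).congr (h.spinorEnergyDensity_ae m ω t).symm, ?_⟩
  rw [integral_congr_ae (h.spinorEnergyDensity_ae m ω t), integral_add i12 i3,
    integral_sub i1' i2', integral_finsetSum _ fun k _ => i1 k, integral_complex_ofReal,
    integral_complex_ofReal, integral_finsetSum _ fun k _ => h.integrable_current_mul_vecA k,
    integral_const_mul]
  have e1 : ∀ k, ∫ x, -Complex.I * inner ℂ (φ x) (alpha k (weakPartial k φ x))
      = (kineticIm φ k : ℂ) := fun k => by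
    rw [integral_const_mul]
    exact h.I_eq k
  have e2 : ∀ k, ∫ x, current φ k x * vecA φ k x = coulomb (current φ k) := fun k => by
    rw [(h.boundedPotential_current k).coulomb_eq]
    simp only [vecA, mul_comm]
  simp only [e1, e2, ← restMass_eq]
  push_cast
  ring

theorem pderiv_cos_inner (ξ : Space) (j : Fin 3) (x : Space) :
    pderiv j (fun x => Real.cos (inner ℝ ξ x)) x = -(ξ j) * Real.sin (inner ℝ ξ x) := by
  have h : HasFDerivAt (fun x : Space => inner ℝ ξ x) (innerSL ℝ ξ) x := (innerSL ℝ ξ).hasFDerivAt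
  rw [pderiv, h.cos.fderiv]
  simp [basisVec, EuclideanSpace.inner_single_right]
  ring

theorem pderiv_sin_inner (ξ : Space) (j : Fin 3) (x : Space) :
    pderiv j (fun x => Real.sin (inner ℝ ξ x)) x = ξ j * Real.cos (inner ℝ ξ x) := by
  have h : HasFDerivAt (fun x : Space => inner ℝ ξ x) (innerSL ℝ ξ) x := (innerSL ℝ ξ).hasFDerivAt
  rw [pderiv, h.sin.fderiv]
  simp [basisVec, EuclideanSpace.inner_single_right]
  ring

/-- A conserved current is orthogonal to gradients of bounded functions with bounded derivatives. -/
theorem IsStationary.integral_pderiv_current {m ω : ℝ} (h : IsStationary m ω φ) {a : Space → ℝ}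
    {C : ℝ} (ha : ContDiff ℝ ((⊤ : ℕ∞) : WithTop ℕ∞) a) (haC : ∀ x, |a x| ≤ C)
    (hda : ∀ k x, |pderiv k a x| ≤ C) :
    ∑ k, ∫ x, pderiv k a x * current φ k x = 0 := by
  have h1 := h.memH1
  have e : ∀ k, ∫ x, pderiv k a x * current φ k x = - ∫ x, a x * densityDeriv (alpha k) φ k x :=
    fun k => by
      rw [(h1.isWeakPartial_density (herm_alpha k) k).integral_mul_bounded
        (h1.integrable_density _) (h1.integrable_densityDeriv _ k) ha haC hda, neg_neg]
      rfl
  have i : ∀ k, Integrable fun x => a x * densityDeriv (alpha k) φ k x := fun k =>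
    (h1.integrable_densityDeriv _ k).bdd_mul ha.continuous.aestronglyMeasurable
      (Eventually.of_forall haC)
  simp only [e]
  rw [Finset.sum_neg_distrib, ← integral_finsetSum _ fun k _ => i k, neg_eq_zero]
  refine integral_eq_zero_of_ae ?_
  filter_upwards [h.div_current] with x hx
  rw [← Finset.mul_sum, hx, mul_zero, Pi.zero_apply]

/-- `div J = 0` in Fourier variables. -/
theorem IsStationary.sum_fhat_current {m ω : ℝ} (h : IsStationary m ω φ) (ξ : Space) :
    ∑ k, (ξ k : ℂ) * fhat (current φ k) ξ = 0 := by
  have hJ := fun k => (h.memH1.boundedPotential_current k).integrable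
  set η : Space := (2 * Real.pi) • ξ with hη
  have hb : ∀ k, |η k| ≤ ‖η‖ := fun k => abs_coord_le_norm η k
  have c1 := h.integral_pderiv_current (a := fun x => Real.cos (inner ℝ η x)) (C := 1 + ‖η‖)
    (Real.contDiff_cos.comp (contDiff_const.inner ℝ contDiff_id))
    (fun x => (Real.abs_cos_le_one _).trans (by linarith [norm_nonneg η]))
    (fun k x => by
      rw [pderiv_cos_inner, abs_mul, abs_neg]
      nlinarith [hb k, abs_nonneg (η k), Real.abs_sin_le_one (inner ℝ η x), norm_nonneg η])
  have c2 := h.integral_pderiv_current (a := fun x => Real.sin (inner ℝ η x)) (C := 1 + ‖η‖)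
    (Real.contDiff_sin.comp (contDiff_const.inner ℝ contDiff_id))
    (fun x => (Real.abs_sin_le_one _).trans (by linarith [norm_nonneg η]))
    (fun k x => by
      rw [pderiv_sin_inner, abs_mul]
      nlinarith [hb k, abs_nonneg (η k), Real.abs_cos_le_one (inner ℝ η x), norm_nonneg η])
  simp only [pderiv_cos_inner, pderiv_sin_inner, mul_assoc, integral_const_mul] at c1 c2
  have is : ∀ k, Integrable fun x => Real.sin (inner ℝ η x) * current φ k x := fun k =>
    (hJ k).bdd_mul (c := 1) (by fun_prop : Continuous fun x : Space =>
      Real.sin (inner ℝ η x)).aestronglyMeasurable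
      (Eventually.of_forall fun x => Real.abs_sin_le_one _)
  have ic : ∀ k, Integrable fun x => Real.cos (inner ℝ η x) * current φ k x := fun k =>
    (hJ k).bdd_mul (c := 1) (by fun_prop : Continuous fun x : Space =>
      Real.cos (inner ℝ η x)).aestronglyMeasurable
      (Eventually.of_forall fun x => Real.abs_cos_le_one _)
  have ef : ∀ k, fhat (current φ k) ξ
      = ((∫ x, Real.cos (inner ℝ η x) * current φ k x : ℝ) : ℂ)
        - Complex.I * ((∫ x, Real.sin (inner ℝ η x) * current φ k x : ℝ) : ℂ) := fun k => by
    rw [fhat_eq, ← integral_complex_ofReal, ← integral_complex_ofReal, ← integral_const_mul,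
      ← integral_sub (ic k).ofReal ((is k).ofReal.const_mul _)]
    congr 1
    funext x
    have : (-2 * Real.pi * inner ℝ x ξ : ℝ) = - inner ℝ η x := by
      rw [hη, inner_smul_left, real_inner_comm]
      simp
    rw [this, Complex.exp_mul_I, ← Complex.ofReal_cos, ← Complex.ofReal_sin, Real.cos_neg,
      Real.sin_neg]
    push_cast
    ring
  have c1' := congrArg (fun r : ℝ => (r : ℂ)) c1
  have c2' := congrArg (fun r : ℝ => (r : ℂ)) c2
  have hpi : (Real.pi : ℂ) ≠ 0 := by exact_mod_cast Real.pi_pos.ne'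
  simp only [Fin.sum_univ_three, hη, PiLp.smul_apply, smul_eq_mul] at c1' c2'
  simp only [ef, Fin.sum_univ_three]
  push_cast at c1' c2'
  rw [← mul_right_inj' (mul_ne_zero two_ne_zero hpi), mul_zero]
  linear_combination c2' + Complex.I * c1'

/-- The vector potential of a conserved current is divergence free, so the cross terms by which
`|∇ × A|²` differs from `∑ |∂_j A_k|²` integrate to zero: in Fourier variables they are
`|∑ ξ_k Ĵ_k|²` up to a factor. -/
theorem IsStationary.integral_cross {m ω : ℝ} (h : IsStationary m ω φ) :
    ∑ j, ∑ k, ∫ x, weakPartial j (vecA φ k) x * weakPartial k (vecA φ j) x = 0 := by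
  have hJ := h.memH1.boundedPotential_current
  have i : ∀ j k, Integrable fun ξ =>
      (starRingEnd ℂ) (gradHat j (current φ k) ξ) * gradHat k (current φ j) ξ := fun j k =>
    ((hJ k).memLp_gradHat j).star.integrable_mul ((hJ j).memLp_gradHat k)
  rw [← Complex.ofReal_inj]
  push_cast
  have e : ∀ j k, ((∫ x, weakPartial j (vecA φ k) x * weakPartial k (vecA φ j) x : ℝ) : ℂ)
      = ∫ ξ, (starRingEnd ℂ) (gradHat j (current φ k) ξ) * gradHat k (current φ j) ξ :=
    fun j k => (hJ k).integral_weakPartial_mul (hJ j) j k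
  simp only [e]
  rw [Finset.sum_congr rfl fun j _ => (integral_finsetSum _ fun k _ => i j k).symm,
    ← integral_finsetSum _ fun j _ => integrable_finsetSum _ fun k _ => i j k]
  refine integral_eq_zero_of_ae (Eventually.of_forall fun ξ => ?_)
  have h1 := h.sum_fhat_current ξ
  have h2 := congrArg (starRingEnd ℂ) h1
  simp only [Fin.sum_univ_three, gradHat, map_add, map_mul, map_div₀, Complex.conj_I,
    Complex.conj_ofReal, map_zero, Pi.zero_apply] at h1 h2 ⊢
  linear_combination (-(2 * Complex.I) * (starRingEnd ℂ) 2 / ((‖ξ‖ ^ 2 : ℝ) : ℂ) ^ 2 * Complex.I)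
    * (ξ 0 * (starRingEnd ℂ) (fhat (current φ 0) ξ) + ξ 1 * (starRingEnd ℂ) (fhat (current φ 1) ξ)
      + ξ 2 * (starRingEnd ℂ) (fhat (current φ 2) ξ)) * h1

/-- The field energy in terms of Coulomb energies. -/
theorem IsStationary.integral_fieldDensity {m ω : ℝ} (h : IsStationary m ω φ) (t : ℝ) :
    Integrable (fieldDensity (fun _ => Phi φ) (fun _ => vecA φ) t) ∧
    ∫ x, fieldDensity (fun _ => Phi φ) (fun _ => vecA φ) t x
      = 4 * Real.pi * (coulomb (rho φ) + ∑ k, coulomb (current φ k)) := by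
  have hr := h.memH1.boundedPotential_rho
  have hJ := h.memH1.boundedPotential_current
  have e : ∀ x, fieldDensity (fun _ => Phi φ) (fun _ => vecA φ) t x
      = ∑ j, weakPartial j (Phi φ) x ^ 2 + ∑ j, ∑ k, weakPartial j (vecA φ k) x ^ 2
        - ∑ j, ∑ k, weakPartial j (vecA φ k) x * weakPartial k (vecA φ j) x := fun x => by
    simp only [fieldDensity, electric, magnetic, deriv_const, Fin.sum_univ_three]
    simp
    ring
  have i1 : ∀ j, Integrable fun x => weakPartial j (Phi φ) x ^ 2 :=
    hr.integrable_sq_weakPartial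
  have i2 : ∀ j k, Integrable fun x => weakPartial j (vecA φ k) x ^ 2 :=
    fun j k => (hJ k).integrable_sq_weakPartial j
  have i3 : ∀ j k, Integrable fun x => weakPartial j (vecA φ k) x * weakPartial k (vecA φ j) x :=
    fun j k => ((hJ k).weakPartial_newton j).2.integrable_mul ((hJ j).weakPartial_newton k).2
  have i1' := integrable_finsetSum Finset.univ fun j _ => i1 j
  have i2' := integrable_finsetSum Finset.univ fun j _ =>
    integrable_finsetSum Finset.univ fun k _ => i2 j k
  have i3' := integrable_finsetSum Finset.univ fun j _ =>
    integrable_finsetSum Finset.univ fun k _ => i3 j k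
  have i12 : Integrable fun x =>
      ∑ j, weakPartial j (Phi φ) x ^ 2 + ∑ j, ∑ k, weakPartial j (vecA φ k) x ^ 2 := i1'.add i2'
  rw [show fieldDensity (fun _ => Phi φ) (fun _ => vecA φ) t = _ from funext e]
  refine ⟨i12.sub i3', ?_⟩
  have s : ∀ {f : Space → ℝ}, BoundedPotential f →
      ∑ j, ∫ x, weakPartial j (newtonPotential f) x ^ 2 = 4 * Real.pi * coulomb f := fun hf => by
    simp only [hf.integral_sq_weakPartial]
    rw [← Finset.mul_sum, Finset.sum_sub_distrib, hf.sum_dirCoulomb]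
    simp
    ring
  have e1 : ∑ j, ∫ x, weakPartial j (Phi φ) x ^ 2 = _ := s hr
  have e2 : ∀ k, ∑ j, ∫ x, weakPartial j (vecA φ k) x ^ 2 = _ := fun k => s (hJ k)
  rw [integral_sub i12 i3', integral_add i1' i2', integral_finsetSum _ fun j _ => i1 j,
    integral_finsetSum _ fun j _ => integrable_finsetSum Finset.univ fun k _ => i2 j k,
    integral_finsetSum _ fun j _ => integrable_finsetSum Finset.univ fun k _ => i3 j k,
    Finset.sum_congr rfl fun j _ => integral_finsetSum _ fun k _ => i2 j k,
    Finset.sum_congr rfl fun j _ => integral_finsetSum _ fun k _ => i3 j k,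
    h.integral_cross, Finset.sum_comm, e1]
  simp only [e2]
  rw [← Finset.mul_sum]
  ring

/-- The energy is `∑ I_k - ∑ E_k + m₀ + ½ (E_ρ + ∑ E_k) = ∑ I_k + m₀ + ½ T`, with `E_ρ`, `E_k` the
Coulomb energies of the charge and of the current components. -/
theorem IsStationary.energy_eq {m ω : ℝ} (h : IsStationary m ω φ) (t : ℝ) :
    energy m (standingWave ω φ) (fun _ => Phi φ) (fun _ => vecA φ) t = (restMass m φ : ℂ) := by
  rw [energy, (h.memH1.integral_spinorEnergyDensity m ω t).2, (h.integral_fieldDensity t).2,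
    ← Complex.ofReal_add, Complex.ofReal_inj, h.kineticIm_relations.2.1, h.memH1.T_eq]
  field_simp
  ring

end Energy

end MaxwellDirac

end

theorem mainTheorem9 (m ω : ℝ) (φ : MaxwellDirac.Space → MaxwellDirac.Spinor)
    (hφ : MaxwellDirac.IsStationary m ω φ) :
    -- every functional below is given by convergent integrals
    MaxwellDirac.WellDefined φ ∧
    -- the two forms of `T_j` agree
    (∀ j : Fin 3, MaxwellDirac.Tdir φ j =
      4 * Real.pi * (2 * Real.pi) ^ (-3 : ℤ) * ∫ k, MaxwellDirac.TdirFourierDensity φ j k) ∧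
    -- directional virial identities
    (∀ j : Fin 3, MaxwellDirac.I φ j =
      (((1 / 2 : ℝ) * (ω * MaxwellDirac.Q φ - MaxwellDirac.restMass m φ)
        - (3 / 4 : ℝ) * MaxwellDirac.T φ + MaxwellDirac.Tdir φ j : ℝ) : ℂ)) ∧
    -- the relations with `T`
    ω * MaxwellDirac.Q φ - MaxwellDirac.restMass m φ = (1 / 2 : ℝ) * MaxwellDirac.T φ ∧
    ∑ k, MaxwellDirac.I φ k = ((-(1 / 2 : ℝ) * MaxwellDirac.T φ : ℝ) : ℂ) ∧
    -- the energy of the stationary solution is (well defined and) equal to `m₀` at all times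
    ∀ t : ℝ,
      MeasureTheory.Integrable (MaxwellDirac.spinorEnergyDensity m
        (MaxwellDirac.standingWave ω φ) (fun _ => MaxwellDirac.vecA φ) t) ∧
      MeasureTheory.Integrable (MaxwellDirac.fieldDensity
        (fun _ => MaxwellDirac.Phi φ) (fun _ => MaxwellDirac.vecA φ) t) ∧
      MaxwellDirac.energy m (MaxwellDirac.standingWave ω φ)
        (fun _ => MaxwellDirac.Phi φ) (fun _ => MaxwellDirac.vecA φ) t =
        (MaxwellDirac.restMass m φ : ℂ) := by
  obtain ⟨r1, r2, r3⟩ := hφ.kineticIm_relations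
  refine ⟨hφ.memH1.wellDefined, fun j => (hφ.memH1.integral_TdirFourierDensity j).2.symm,
    fun j => ?_, r1, ?_, fun t => ⟨(hφ.memH1.integral_spinorEnergyDensity m ω t).1,
      (hφ.integral_fieldDensity t).1, hφ.energy_eq t⟩⟩
  · rw [hφ.memH1.I_eq, r1, r3]
    congr 1
    ring
  · simp only [hφ.memH1.I_eq]
    rw [← r2]
    push_cast
    rfl
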